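/- Let $\mathbb{S}=\{1,\dots,N\}$ and let $\Gamma=(\gamma_{ij})\in\mathbb{R}^{N\times N}$ be an irreducible conservative generator ($\gamma_{ij}\ge 0$ for $i\ne j$, zero row sums) with stationary distribution $\mu$ ($\mu\Gamma=0$, $\sum_j\mu_j=1$, $\mu_j>0$). Let $f:\mathbb{R}^n\times\mathbb{S}\to\mathbb{R}^n$ and $g:\mathbb{R}^n\times\mathbb{S}\to\mathbb{R}^{n\times d}$ be continuous, and write $|\cdot|$ for the Euclidean norm of vectors and the Hilbert–Schmidt norm of matrices. Assume: 1. there are $a_i>0$ and $q\ge 2$ with $$|f(x,i)-f(y,i)|^2\vee|g(x,i)-g(y,i)|^2\le a_i\bigl(1+|x|^{q-2}+|y|^{q-2}\bigr)|x-y|^2\qquad(x,y\in\mathbb{R}^n,\ i\in\mathbb{S});$$ 2. there are $n_i\in\mathbb{R}$ and $l_1>4$ with $$2\langle x-y,f(x,i)-f(y,i)\rangle+l_1|g(x,i)-g(y,i)|^2\le n_i|x-y|^2\qquad(x,y\in\mathbb{R}^n,\ i\in\mathbb{S});$$ 3. with $n_M=\max_i|n_i|$, $$\sum_{j\in\mathbb{S}}\mu_j\frac{n_j+1}{1-(n_j+1)/(n_M+2)}<0\quad\text{and}\quad\sum_{j\in\mathbb{S}}\mu_j\frac{n_j}{1-n_j/(n_M+2)}<0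 .$$ For $0<\Delta<1/(n_M+2)$ consider the backward Euler–Maruyama scheme $$X_{k+1}=X_k+f(X_{k+1},r_{k+1})\Delta+g(X_k,r_k)\,\Delta B_k,\qquad X_0=x_0,\ r_0=i_0,$$ where $\Delta B_k=B((k+1)\Delta)-B(k\Delta)$ for a $d$-dimensional Brownian motion $B$, and $(r_k)$ is a Markov chain on $\mathbb{S}$, independent of $B$, with one-step transition matrix $\exp(\Delta\Gamma)$. Let $\mathbf{P}^\Delta_k((x,i),\cdot)$ be the $k$-step transition probability on $\mathbb{R}^n\times\mathbb{S}$ obtained by iterating the one-step transition in which, from $(x,i)$, one moves to $(u,j)$ with $j$ drawn with probability $\exp(\Delta\Gamma)_{ij}$ and $u$ the solution of $u-\Delta f(u,j)=x+g(x,i)\sqrt{\Delta}\,\xi$, with $\xi\sim N(0,I_d)$ independent of $j$. For $p\in(0,1)$ let $$d_p((x,i),(y,j))=|x-y|^p+\mathbb{1}_{\{i\ne j\}},\qquad W_p(u,v)=\inf_{\theta}\int d_p\,\mathrm{d}\theta\in[0,\infty],$$ the infimum being over all couplings $\theta$ of the probability measures $u,v$ on $\mathbb{R}^n\times\mathbb{S}$.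 Then there is $p_0\in(0,1]$, not depending on $\Delta$, such that for every $\Delta\in(0,1/(n_M+2))$: * for all $i\in\mathbb{S}$ and $y\in\mathbb{R}^n$ the equation $u-\Delta f(u,i)=y$ has exactly one solution $u\in\mathbb{R}^n$, and the law of $(X_k,r_k)$ started from $(x_0,i_0)$ is $\mathbf{P}^\Delta_k((x_0,i_0),\cdot)$ for every $k\ge 0$; * there is exactly one invariant measure of the chain, i.e. exactly one probability measure $\pi^\Delta$ on $\mathbb{R}^n\times\mathbb{S}$ with $$\pi^\Delta(A\times\{j\})=\int\mathbf{P}^\Delta_k(z,A\times\{j\})\,\pi^\Delta(\mathrm{d}z)$$ for all $k\ge0$, all Borel sets $A\subseteq\mathbb{R}^n$ and all $j\in\mathbb{S}$; * for every $p\in(0,p_0)$ there is a rate $\gamma_\Delta>0$ such that for every initial state $(x_0,i_0)$ there is a constant $C>0$ with $$W_p\bigl(\mathbf{P}^\Delta_k((x_0,i_0),\cdot),\pi^\Delta\bigr)\le C\,e^{-\gamma_\Delta k\Delta}\qquad\text{for all }k\ge 0 .$$ -/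

import Mathlib

open MeasureTheory ProbabilityTheory
open scoped NNReal ENNReal

noncomputable section

namespace HybridBEM

/-- `ℝⁿ` with the Euclidean norm. -/
abbrev Vec (n : ℕ) : Type := EuclideanSpace ℝ (Fin n)

/-- The Hilbert–Schmidt norm of a matrix. -/
def hsNorm {n d : ℕ} (A : Matrix (Fin n) (Fin d) ℝ) : ℝ :=
  Real.sqrt (∑ i, ∑ j, A i j ^ 2)

/-! ### The switching chain -/

/-- `Γ` is a conservative generator on `{1, …, N}`: nonnegative off-diagonal rates, zero row
sums. -/
def IsGenerator {N : ℕ} (Γ : Matrix (Fin N) (Fin N) ℝ) : Prop :=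
  (∀ i j, i ≠ j → 0 ≤ Γ i j) ∧ ∀ i, ∑ j, Γ i j = 0

/-- Irreducibility of a generator: any state is reached from any other one through transitions of
positive rate (diagonal entries of a generator are never positive). -/
def IsIrreducibleGenerator {N : ℕ} (Γ : Matrix (Fin N) (Fin N) ℝ) : Prop :=
  ∀ i j, Relation.ReflTransGen (fun a b => 0 < Γ a b) i j

/-- `μ` is the stationary distribution of the chain with generator `Γ`. -/
def IsStationaryDistribution {N : ℕ} (Γ : Matrix (Fin N) (Fin N) ℝ) (μ : Fin N → ℝ) : Prop :=
  Matrix.vecMul μ Γ = 0 ∧ ∑ j, μ j = 1 ∧ ∀ j, 0 < μ j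

/-- The transition matrix `exp(Δ Γ)` of the switching chain over a time step `Δ`. -/
def stepMatrix {N : ℕ} (Γ : Matrix (Fin N) (Fin N) ℝ) (Δ : ℝ) : Matrix (Fin N) (Fin N) ℝ :=
  NormedSpace.exp (Δ • Γ)

/-- `n_M = max_i |n_i|`. -/
def maxAbs {N : ℕ} (ν : Fin N → ℝ) : ℝ := ⨆ i, |ν i|

/-! ### The assumptions on the coefficients -/

/-- Continuity and the polynomial local Lipschitz condition. -/
def PolynomialLipschitz {n d N : ℕ} (f : Vec n → Fin N → Vec n)
    (g : Vec n → Fin N → Matrix (Fin n) (Fin d) ℝ) (a : Fin N → ℝ) (q : ℝ) : Prop :=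
  (∀ i, Continuous fun x => f x i) ∧ (∀ i, Continuous fun x => g x i) ∧
  (∀ i, 0 < a i) ∧ 2 ≤ q ∧
  ∀ x y i, max (‖f x i - f y i‖ ^ 2) (hsNorm (g x i - g y i) ^ 2) ≤
    a i * (1 + ‖x‖ ^ (q - 2) + ‖y‖ ^ (q - 2)) * ‖x - y‖ ^ 2

/-- The one-sided (Khasminskii-type) monotonicity condition. -/
def KhasminskiiMonotone {n d N : ℕ} (f : Vec n → Fin N → Vec n)
    (g : Vec n → Fin N → Matrix (Fin n) (Fin d) ℝ) (ν : Fin N → ℝ) (l₁ : ℝ) : Prop :=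
  4 < l₁ ∧ ∀ x y i,
    2 * inner ℝ (x - y) (f x i - f y i) + l₁ * hsNorm (g x i - g y i) ^ 2 ≤ ν i * ‖x - y‖ ^ 2

/-- The averaged stability condition with respect to the stationary distribution `μ`. -/
def AveragedStable {N : ℕ} (μ ν : Fin N → ℝ) : Prop :=
  (∃ lam₁ > 0, ∑ j, μ j * ((ν j + 1) / (1 - (ν j + 1) / (maxAbs ν + 2))) = -lam₁) ∧
  (∃ lam₂ > 0, ∑ j, μ j * (ν j / (1 - ν j / (maxAbs ν + 2))) = -lam₂)

/-! ### The backward Euler–Maruyama chain -/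

/-- `B = (B_1, …, B_d)` is a `d`-dimensional Brownian motion. -/
structure IsBrownianMotion {Ω : Type*} [MeasurableSpace Ω] (P : Measure Ω) {d : ℕ}
    (B : Fin d → ℝ≥0 → Ω → ℝ) : Prop where
  measurable : ∀ l t, Measurable (B l t)
  brownian : ∀ l, IsBrownianReal (B l) P
  indep : iIndepFun (fun l ω t => B l t ω) P

/-- The increment `ΔB_k = B((k+1)Δ) - B(kΔ)`. -/
def increment {Ω : Type*} {d : ℕ} (B : Fin d → ℝ≥0 → Ω → ℝ) (Δ : ℝ) (k : ℕ) (ω : Ω) : Vec d :=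
  WithLp.toLp 2 fun l =>
    B l (Real.toNNReal ((k + 1 : ℝ) * Δ)) ω - B l (Real.toNNReal ((k : ℝ) * Δ)) ω

/-- `r` is a Markov chain with one-step transition matrix `Q` started from `i₀`, expressed through
its finite-dimensional distributions. -/
structure IsMarkovChain {Ω : Type*} [MeasurableSpace Ω] (P : Measure Ω) {N : ℕ}
    (Q : Matrix (Fin N) (Fin N) ℝ) (i₀ : Fin N) (r : ℕ → Ω → Fin N) : Prop where
  measurable : ∀ k, Measurable (r k)
  law : ∀ (k : ℕ) (s : ℕ → Fin N),
    P {ω | ∀ m ≤ k, r m ω = s m} =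
      if s 0 = i₀ then ENNReal.ofReal (∏ m ∈ Finset.range k, Q (s m) (s (m + 1))) else 0

/-- `(X_k, r_k)` is produced by the backward Euler–Maruyama scheme
`X_{k+1} = X_k + f(X_{k+1}, r_{k+1}) Δ + g(X_k, r_k) ΔB_k`, `X_0 = x₀`, `r_0 = i₀`, driven by a
Brownian motion `B` and an independent chain `r` with transition matrix `exp(Δ Γ)`. -/
structure IsBEMSolution {Ω : Type*} [MeasurableSpace Ω] (P : Measure Ω) {n d N : ℕ}
    (f : Vec n → Fin N → Vec n) (g : Vec n → Fin N → Matrix (Fin n) (Fin d) ℝ)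
    (Γ : Matrix (Fin N) (Fin N) ℝ) (Δ : ℝ) (x₀ : Vec n) (i₀ : Fin N)
    (B : Fin d → ℝ≥0 → Ω → ℝ) (X : ℕ → Ω → Vec n) (r : ℕ → Ω → Fin N) : Prop where
  brownian : IsBrownianMotion P B
  chain : IsMarkovChain P (stepMatrix Γ Δ) i₀ r
  indep : IndepFun (fun ω l t => B l t ω) (fun ω k => r k ω) P
  measurable : ∀ k, Measurable (X k)
  initial : ∀ᵐ ω ∂P, X 0 ω = x₀
  step : ∀ k, ∀ᵐ ω ∂P, X (k + 1) ω = X k ω + Δ • f (X (k + 1) ω) (r (k + 1) ω) +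
    Matrix.toEuclideanLin (g (X k ω) (r k ω)) (increment B Δ k ω)

/-- The implicit solution map: the solution `u` of `u - Δ f(u, j) = y` (the scheme is used only
for step sizes for which this solution exists and is unique). -/
def implicitSolve {n N : ℕ} (f : Vec n → Fin N → Vec n) (Δ : ℝ) (j : Fin N) : Vec n → Vec n :=
  Function.invFun fun u => u - Δ • f u j

/-- The one-step transition probability of `(X_k, r_k)`: from `(x, i)` the chain switches to `j`
with probability `exp(Δ Γ)_{ij}`, and the new position solves the implicit equation with an
independent Gaussian increment `√Δ ξ`, `ξ ∼ N(0, I_d)`. -/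
def bemStep {n d N : ℕ} (f : Vec n → Fin N → Vec n)
    (g : Vec n → Fin N → Matrix (Fin n) (Fin d) ℝ) (Γ : Matrix (Fin N) (Fin N) ℝ) (Δ : ℝ)
    (z : Vec n × Fin N) : Measure (Vec n × Fin N) :=
  ∑ j, ENNReal.ofReal (stepMatrix Γ Δ z.2 j) •
    (stdGaussian (Vec d)).map fun ξ =>
      (implicitSolve f Δ j (z.1 + Matrix.toEuclideanLin (g z.1 z.2) (Real.sqrt Δ • ξ)), j)

/-- The `k`-step transition probability `𝐏^Δ_k((x, i), ·)` of `(X_k, r_k)`. -/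
def bemKernel {n d N : ℕ} (f : Vec n → Fin N → Vec n)
    (g : Vec n → Fin N → Matrix (Fin n) (Fin d) ℝ) (Γ : Matrix (Fin N) (Fin N) ℝ) (Δ : ℝ) :
    ℕ → Vec n × Fin N → Measure (Vec n × Fin N)
  | 0, z => Measure.dirac z
  | k + 1, z => (bemKernel f g Γ Δ k z).bind (bemStep f g Γ Δ)

/-- `π` is an invariant probability measure of the family `K` of `k`-step transition
probabilities. -/
def IsInvariantMeasure {n N : ℕ} (K : ℕ → Vec n × Fin N → Measure (Vec n × Fin N))
    (π : Measure (Vec n × Fin N)) : Prop :=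
  IsProbabilityMeasure π ∧ ∀ (k : ℕ) (A : Set (Vec n)) (j : Fin N), MeasurableSet A →
    π (A ×ˢ {j}) = ∫⁻ z, K k z (A ×ˢ {j}) ∂π

/-! ### The Wasserstein distance -/

/-- `d_p((x, i), (y, j)) = |x - y|^p + 1_{i ≠ j}`. -/
def dp {n N : ℕ} (p : ℝ) (z w : Vec n × Fin N) : ℝ :=
  ‖z.1 - w.1‖ ^ p + if z.2 ≠ w.2 then 1 else 0

/-- `W_p(u, v)`: the infimum of `∫ d_p dθ` over all couplings `θ` of `u` and `v`, with values in
`[0, ∞]`. -/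
def wasserstein {n N : ℕ} (p : ℝ) (u v : Measure (Vec n × Fin N)) : ℝ≥0∞ :=
  ⨅ θ : {θ : Measure ((Vec n × Fin N) × (Vec n × Fin N)) //
      θ.map Prod.fst = u ∧ θ.map Prod.snd = v},
    ∫⁻ zw, ENNReal.ofReal (dp p zw.1 zw.2) ∂θ.1

end HybridBEM

end

/-! The chain is realised as a random map. One noise variable consists of a Gaussian vector and an
independent successor for every switching state, so two copies can be driven by the same noise
(synchronous coupling). Everything about long-time behaviour follows from a cost on pairs that this
coupling contracts by a fixed factor per step, and from a Lyapunov function with relatively compact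
sublevel sets.

Equal switching states. Put D_i(x,y) = |x-y|² + Δ|g(x,i)-g(y,i)|² (`sqDist`). Monotonicity shows
that solving the implicit equation in state j turns the squared distance of two right-hand sides
into D_j, at the price of a factor (1-ν_jΔ)⁻¹ (`mul_sqDist_le`). The mean squared distance of the
right-hand sides started from (x,i) and (y,i) is exactly D_i(x,y)
(`lintegral_norm_add_sq_stdGaussian`), so D closes up under one step. The factor may exceed 1 in
some states. After taking the power p/2 it is at most exp((p/2)Δc_j) with c_j = ν_j/(1-ν_j/(n_M+2)),
which does not depend on Δ. Since ∑ μ_j c_j < 0, for small p a weight h close to 1 makes exp(ΔΓ)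
diag(exp((p/2)Δc)) a strict contraction. `exists_weight` builds h from a truncated Poisson equation,
with a threshold on p that is uniform in Δ; this is where p₀ comes from.

Different switching states. Comparison with the origin gives a drift condition for V =
h·D(·,0)^(p/2) (`lintegral_lyap_bemMap_le`). By irreducibility all entries of exp(ΔΓ) are positive,
so two states meet in one step with probability at least some δ > 0 (`noiseLaw_ne_le`). The cost 2V
+ 2V' + R, with R large compared with the drift constant over δ, then contracts as well
(`lintegral_cost_pairMap_le`).

Consequences. The drift makes the laws of the chain tight; the contraction makes consecutive laws
merge, so any weak limit point is invariant, and it makes any two invariant laws agree. Invariant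
laws integrate V, hence coupling a point mass with the invariant law gives a geometric bound in W_p.

The identification of the law of the scheme is separate: along a fixed switching path the position
is a function of the Brownian increments, which are independent of the switching chain and of each
other (`IsBEMSolution.map_succ`). -/

noncomputable section

namespace HybridBEM

/-! ### Markov chains driven by random maps -/

section RandomMap

variable {Z E : Type*} [MeasurableSpace Z] [MeasurableSpace E]

/-- The law of `F e z` for independent `e ∼ m` and `z ∼ ν`. -/
def stepLaw (m : Measure E) (F : E → Z → Z) (ν : Measure Z) : Measure Z :=
  (m.prod ν).map (Function.uncurry F)

/-- Two copies of a random map driven by the same noise. -/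
def pairMap (F : E → Z → Z) (e : E) (zw : Z × Z) : Z × Z := (F e zw.1, F e zw.2)

variable {m : Measure E} [IsProbabilityMeasure m] {F : E → Z → Z}

/-- Measurability is packaged as a `Fact` so that instance search can use it for iterated laws. -/
instance isProbabilityMeasure_stepLaw_iterate [hF : Fact (Measurable (Function.uncurry F))]
    (ν : Measure Z) [hν : IsProbabilityMeasure ν] (k : ℕ) :
    IsProbabilityMeasure ((stepLaw m F)^[k] ν) := by
  induction k generalizing ν with
  | zero => simpa
  | succ k ih =>
    rw [Function.iterate_succ_apply]
    have : IsProbabilityMeasure (stepLaw m F ν) :=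
      Measure.isProbabilityMeasure_map hF.out.aemeasurable
    exact ih _

lemma measurable_pairMap (hF : Measurable (Function.uncurry F)) :
    Measurable (Function.uncurry (pairMap F)) := by
  unfold pairMap
  have h1 : Measurable fun p : E × (Z × Z) => F p.1 p.2.1 :=
    hF.comp (f := fun p : E × (Z × Z) => (p.1, p.2.1)) (by fun_prop)
  have h2 : Measurable fun p : E × (Z × Z) => F p.1 p.2.2 :=
    hF.comp (f := fun p : E × (Z × Z) => (p.1, p.2.2)) (by fun_prop)
  exact h1.prodMk h2

lemma lintegral_stepLaw (hF : Measurable (Function.uncurry F)) (ν : Measure Z) [SFinite ν]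
    {φ : Z → ℝ≥0∞} (hφ : Measurable φ) :
    ∫⁻ z, φ z ∂stepLaw m F ν = ∫⁻ z, ∫⁻ e, φ (F e z) ∂m ∂ν := by
  rw [stepLaw, lintegral_map hφ hF]
  exact lintegral_prod_symm' _ (hφ.comp hF)

lemma stepLaw_pairMap_fst (hF : Measurable (Function.uncurry F)) (θ : Measure (Z × Z))
    [IsProbabilityMeasure θ] :
    (stepLaw m (pairMap F) θ).map Prod.fst = stepLaw m F (θ.map Prod.fst) := by
  have : IsProbabilityMeasure (θ.map Prod.fst) :=
    Measure.isProbabilityMeasure_map measurable_fst.aemeasurable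
  rw [stepLaw, stepLaw, Measure.map_map measurable_fst (measurable_pairMap hF)]
  conv_rhs => rw [← Measure.map_id (μ := m), Measure.map_prod_map _ _ measurable_id measurable_fst,
    Measure.map_map hF (by fun_prop)]
  rfl

lemma stepLaw_pairMap_snd (hF : Measurable (Function.uncurry F)) (θ : Measure (Z × Z))
    [IsProbabilityMeasure θ] :
    (stepLaw m (pairMap F) θ).map Prod.snd = stepLaw m F (θ.map Prod.snd) := by
  have : IsProbabilityMeasure (θ.map Prod.snd) :=
    Measure.isProbabilityMeasure_map measurable_snd.aemeasurable
  rw [stepLaw, stepLaw, Measure.map_map measurable_snd (measurable_pairMap hF)]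
  conv_rhs => rw [← Measure.map_id (μ := m), Measure.map_prod_map _ _ measurable_id measurable_snd,
    Measure.map_map hF (by fun_prop)]
  rfl

/-- Each component sees noise of law `m`, so it is a copy of the chain; this is why running both on
the same noise produces a coupling. -/
lemma stepLaw_pairMap_iterate_marginals (hF : Measurable (Function.uncurry F)) (k : ℕ)
    (θ : Measure (Z × Z)) [IsProbabilityMeasure θ] :
    ((stepLaw m (pairMap F))^[k] θ).map Prod.fst = (stepLaw m F)^[k] (θ.map Prod.fst) ∧
    ((stepLaw m (pairMap F))^[k] θ).map Prod.snd = (stepLaw m F)^[k] (θ.map Prod.snd) := by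
  induction k generalizing θ with
  | zero => simp
  | succ k ih =>
    have : IsProbabilityMeasure (stepLaw m (pairMap F) θ) :=
      Measure.isProbabilityMeasure_map (measurable_pairMap hF).aemeasurable
    simp only [Function.iterate_succ_apply]
    rw [(ih _).1, (ih _).2, stepLaw_pairMap_fst hF, stepLaw_pairMap_snd hF]
    exact ⟨rfl, rfl⟩

/-- A geometric drift condition, iterated and truncated at an arbitrary level `M`. -/
lemma lintegral_min_iterate_le (hF : Measurable (Function.uncurry F)) {Φ : Z → ℝ≥0∞}
    (hΦ : Measurable Φ) {ρ b : ℝ≥0∞} (H : ∀ z, ∫⁻ e, Φ (F e z) ∂m ≤ ρ * Φ z + b)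
    (M : ℝ≥0∞) (k : ℕ) (ν : Measure Z) [IsProbabilityMeasure ν] :
    ∫⁻ z, min (Φ z) M ∂((stepLaw m F)^[k] ν) ≤
      ∫⁻ z, min (ρ ^ k * Φ z + b * ∑ i ∈ Finset.range k, ρ ^ i) M ∂ν := by
  induction k generalizing ν with
  | zero => simp
  | succ k ih =>
    have : IsProbabilityMeasure (stepLaw m F ν) :=
      Measure.isProbabilityMeasure_map hF.aemeasurable
    rw [Function.iterate_succ_apply]
    refine (ih _).trans ?_
    rw [lintegral_stepLaw hF ν (by fun_prop)]
    refine lintegral_mono fun z => ?_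
    have hFz : Measurable fun e => F e z := hF.comp (measurable_id.prodMk measurable_const)
    -- The mean of a minimum is at most the minimum of the means. The truncation keeps the estimate
    -- meaningful when `Φ` is not known to be integrable under `ν`.
    refine le_min ?_ ?_
    · calc _ ≤ ∫⁻ e, (ρ ^ k * Φ (F e z) + b * ∑ i ∈ Finset.range k, ρ ^ i) ∂m :=
            lintegral_mono fun e => min_le_left _ _
        _ = ρ ^ k * ∫⁻ e, Φ (F e z) ∂m + b * ∑ i ∈ Finset.range k, ρ ^ i := by
            rw [lintegral_add_right _ measurable_const,
              lintegral_const_mul _ (show Measurable fun e => Φ (F e z) from hΦ.comp hFz)]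
            simp
        _ ≤ ρ ^ k * (ρ * Φ z + b) + b * ∑ i ∈ Finset.range k, ρ ^ i := by gcongr; exact H z
        _ = _ := by rw [Finset.sum_range_succ, pow_succ]; ring
    · calc _ ≤ ∫⁻ _, M ∂m := lintegral_mono fun e => min_le_right _ _
        _ = M := by simp

lemma sum_range_pow_le_inv (ρ : ℝ≥0∞) (k : ℕ) : ∑ i ∈ Finset.range k, ρ ^ i ≤ (1 - ρ)⁻¹ := by
  rw [← ENNReal.tsum_geometric]
  exact ENNReal.sum_le_tsum _

/-- Under a geometric drift condition every invariant probability integrates the Lyapunov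
function. -/
lemma lintegral_le_of_stepLaw_eq (hF : Measurable (Function.uncurry F)) {Φ : Z → ℝ≥0∞}
    (hΦ : Measurable Φ) (hΦ' : ∀ z, Φ z ≠ ∞) {ρ b : ℝ≥0∞} (hρ : ρ < 1)
    (H : ∀ z, ∫⁻ e, Φ (F e z) ∂m ≤ ρ * Φ z + b)
    {π : Measure Z} [IsProbabilityMeasure π] (hπ : stepLaw m F π = π) :
    ∫⁻ z, Φ z ∂π ≤ b * (1 - ρ)⁻¹ := by
  set B := b * (1 - ρ)⁻¹ with hB
  have hfix : ∀ k, (stepLaw m F)^[k] π = π := fun k => Function.iterate_fixed hπ k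
  -- Integrability of `Φ` under `π` is not known in advance. At a fixed level `M` dominated
  -- convergence in `k` removes the term ρ^k Φ; only afterwards does `M` tend to infinity.
  have key : ∀ M : ℕ, ∫⁻ z, min (Φ z) M ∂π ≤ B := by
    intro M
    have h1 : ∀ k, ∫⁻ z, min (Φ z) M ∂π ≤ ∫⁻ z, min (ρ ^ k * Φ z + B) M ∂π := by
      intro k
      have := lintegral_min_iterate_le (m := m) hF hΦ H (M : ℝ≥0∞) k π
      rw [hfix] at this
      refine this.trans (lintegral_mono fun z => ?_)
      have : b * ∑ i ∈ Finset.range k, ρ ^ i ≤ B := by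
        rw [hB]
        gcongr
        exact sum_range_pow_le_inv ρ k
      gcongr
    have h2 : Filter.Tendsto (fun k => ∫⁻ z, min (ρ ^ k * Φ z + B) M ∂π) Filter.atTop
        (nhds (∫⁻ _, min (0 + B) M ∂π)) := by
      refine tendsto_lintegral_of_dominated_convergence (fun _ => (M : ℝ≥0∞))
        (fun k => by fun_prop) (fun k => .of_forall fun z => min_le_right _ _) (by simp)
        (.of_forall fun z => ?_)
      have h3 : Filter.Tendsto (fun k => ρ ^ k * Φ z) Filter.atTop (nhds (0 * Φ z)) :=
        ENNReal.Tendsto.mul_const (ENNReal.tendsto_pow_atTop_nhds_zero_of_lt_one hρ)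
          (Or.inr (hΦ' z))
      rw [zero_mul] at h3
      exact (h3.add tendsto_const_nhds).min tendsto_const_nhds
    refine (ge_of_tendsto' h2 h1).trans ?_
    simp
  have hsup : ∀ z, Φ z = ⨆ M : ℕ, min (Φ z) M := by
    intro z
    refine le_antisymm ?_ (iSup_le fun M => min_le_left _ _)
    obtain ⟨M, hM⟩ := ENNReal.exists_nat_gt (hΦ' z)
    exact le_iSup_of_le M (le_min le_rfl hM.le)
  calc ∫⁻ z, Φ z ∂π = ∫⁻ z, ⨆ M : ℕ, min (Φ z) M ∂π := lintegral_congr hsup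
    _ = ⨆ M : ℕ, ∫⁻ z, min (Φ z) M ∂π := by
        refine lintegral_iSup (fun M => by fun_prop) fun i j hij z => ?_
        have : (i : ℝ≥0∞) ≤ j := by exact_mod_cast hij
        dsimp only
        gcongr
    _ ≤ B := iSup_le key

/-- The synchronous coupling of the laws of the chain started from `ν` and `ν'`. -/
lemma exists_coupling_iterate (hF : Measurable (Function.uncurry F)) {L : Z × Z → ℝ≥0∞}
    (hL : Measurable L) {ρ : ℝ≥0∞} (H : ∀ zw, ∫⁻ e, L (pairMap F e zw) ∂m ≤ ρ * L zw)
    (ν ν' : Measure Z) [IsProbabilityMeasure ν] [IsProbabilityMeasure ν'] (k : ℕ) :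
    ∃ θ : Measure (Z × Z), IsProbabilityMeasure θ ∧
      θ.map Prod.fst = (stepLaw m F)^[k] ν ∧ θ.map Prod.snd = (stepLaw m F)^[k] ν' ∧
      ∀ M, ∫⁻ zw, min (L zw) M ∂θ ≤ ∫⁻ zw, min (ρ ^ k * L zw) M ∂(ν.prod ν') := by
  have : Fact (Measurable (Function.uncurry (pairMap F))) := ⟨measurable_pairMap hF⟩
  refine ⟨(stepLaw m (pairMap F))^[k] (ν.prod ν'), inferInstance, ?_, ?_, fun M => ?_⟩
  · rw [(stepLaw_pairMap_iterate_marginals hF k _).1]; simp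
  · rw [(stepLaw_pairMap_iterate_marginals hF k _).2]; simp
  · simpa using lintegral_min_iterate_le (m := m) (measurable_pairMap hF) hL (b := 0)
      (by simpa using H) M k (ν.prod ν')

end RandomMap

/-! ### Invariant probabilities of contracting random maps. -/

section Invariant

variable {Z E : Type*} [MetricSpace Z] [MeasurableSpace Z] [BorelSpace Z]
  [MeasurableSpace E]
  {m : Measure E} [IsProbabilityMeasure m] {F : E → Z → Z}

/-- Probability measures with couplings of arbitrarily small truncated cost integrate bounded
Lipschitz functions almost equally. -/
lemma abs_integral_sub_le_of_coupling {L : Z × Z → ℝ≥0∞} {c : ℝ≥0∞}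
    (hdist : ∀ zw, ENNReal.ofReal (min 1 (dist zw.1 zw.2)) ≤ c * min (L zw) 1)
    {φ : Z → ℝ} {A K : ℝ≥0} (hA : ∀ x y, dist (φ x) (φ y) ≤ A) (hK : LipschitzWith K φ)
    (θ : Measure (Z × Z)) [IsProbabilityMeasure θ] (hL : Measurable L) :
    ENNReal.ofReal |∫ z, φ z ∂(θ.map Prod.fst) - ∫ z, φ z ∂(θ.map Prod.snd)| ≤
      (max A K : ℝ≥0) * c * ∫⁻ zw, min (L zw) 1 ∂θ := by
  obtain ⟨x₀⟩ : Nonempty Z := by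
    obtain ⟨zw⟩ : Nonempty (Z × Z) := nonempty_of_isProbabilityMeasure θ
    exact ⟨zw.1⟩
  have hbound : ∀ z, ‖φ z‖ ≤ ‖φ x₀‖ + A := fun z => by
    have := hA z x₀
    rw [dist_eq_norm] at this
    calc ‖φ z‖ = ‖φ x₀ + (φ z - φ x₀)‖ := by congr 1; ring
      _ ≤ _ := (norm_add_le _ _).trans (by gcongr)
  have i1 : Integrable (fun zw : Z × Z => φ zw.1) θ :=
    .of_bound (hK.continuous.measurable.comp measurable_fst).aestronglyMeasurable _
      (.of_forall fun zw => hbound zw.1)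
  have i2 : Integrable (fun zw : Z × Z => φ zw.2) θ :=
    .of_bound (hK.continuous.measurable.comp measurable_snd).aestronglyMeasurable _
      (.of_forall fun zw => hbound zw.2)
  rw [integral_map measurable_fst.aemeasurable hK.continuous.measurable.aestronglyMeasurable,
    integral_map measurable_snd.aemeasurable hK.continuous.measurable.aestronglyMeasurable,
    ← integral_sub i1 i2, ← Real.norm_eq_abs, ofReal_norm]
  refine (enorm_integral_le_lintegral_enorm _).trans ?_
  rw [← lintegral_const_mul _ (by fun_prop)]
  refine lintegral_mono fun zw => ?_
  have h1 : ‖φ zw.1 - φ zw.2‖ ≤ (max A K : ℝ≥0) * min 1 (dist zw.1 zw.2) := by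
    rw [mul_min_of_nonneg _ _ (NNReal.coe_nonneg _), ← dist_eq_norm]
    refine le_min ?_ ?_
    · rw [mul_one]
      exact (hA _ _).trans (by exact_mod_cast le_max_left A K)
    · refine (hK.dist_le_mul _ _).trans ?_
      gcongr
      exact le_max_right A K
  calc ‖φ zw.1 - φ zw.2‖ₑ = ENNReal.ofReal ‖φ zw.1 - φ zw.2‖ := (ofReal_norm _).symm
    _ ≤ ENNReal.ofReal ((max A K : ℝ≥0) * min 1 (dist zw.1 zw.2)) := ENNReal.ofReal_le_ofReal h1
    _ = (max A K : ℝ≥0) * ENNReal.ofReal (min 1 (dist zw.1 zw.2)) := by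
        rw [ENNReal.ofReal_mul (NNReal.coe_nonneg _), ENNReal.ofReal_coe_nnreal]
    _ ≤ _ := by rw [mul_assoc]; gcongr; exact hdist zw

/-- Bounded Lipschitz functions detect weak convergence, so the constant sequence `u` converges to
`v`; weak limits are unique. -/
lemma ext_of_forall_lipschitz_integral_eq {u v : Measure Z} [IsProbabilityMeasure u]
    [IsProbabilityMeasure v]
    (h : ∀ (φ : Z → ℝ) (A K : ℝ≥0), (∀ x y, dist (φ x) (φ y) ≤ A) → LipschitzWith K φ →
      ∫ z, φ z ∂u = ∫ z, φ z ∂v) : u = v := by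
  let u' : ProbabilityMeasure Z := ⟨u, inferInstance⟩
  let v' : ProbabilityMeasure Z := ⟨v, inferInstance⟩
  have : Filter.Tendsto (fun _ : ℕ => u') Filter.atTop (nhds v') := by
    rw [tendsto_iff_forall_lipschitz_integral_tendsto]
    rintro φ ⟨A, hA⟩ ⟨K, hK⟩
    have := h φ A.toNNReal K (fun x y => (hA x y).trans (Real.le_coe_toNNReal A)) hK
    simp only [ProbabilityMeasure.coe_mk, u', v', this]
    exact tendsto_const_nhds
  have := tendsto_nhds_unique tendsto_const_nhds this
  exact congrArg (fun ν : ProbabilityMeasure Z => (ν : Measure Z)) this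

lemma tendsto_lintegral_min_pow_mul {Z : Type*} [MeasurableSpace Z] {L : Z → ℝ≥0∞}
    (hL : Measurable L) (hL' : ∀ z, L z ≠ ∞) {ρ : ℝ≥0∞} (hρ : ρ < 1) (θ : Measure Z)
    [IsProbabilityMeasure θ] :
    Filter.Tendsto (fun k : ℕ => ∫⁻ z, min (ρ ^ k * L z) 1 ∂θ) Filter.atTop (nhds 0) := by
  have h0 : Filter.Tendsto (fun k : ℕ => ∫⁻ z, min (ρ ^ k * L z) 1 ∂θ) Filter.atTop
      (nhds (∫⁻ _, 0 ∂θ)) := by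
    refine tendsto_lintegral_of_dominated_convergence (fun _ => 1) (fun k => by fun_prop)
      (fun k => .of_forall fun z => min_le_right _ _) (by simp) (.of_forall fun z => ?_)
    have h3 : Filter.Tendsto (fun k => ρ ^ k * L z) Filter.atTop (nhds (0 * L z)) :=
      ENNReal.Tendsto.mul_const (ENNReal.tendsto_pow_atTop_nhds_zero_of_lt_one hρ)
        (Or.inr (hL' z))
    rw [zero_mul] at h3
    simpa using h3.min (tendsto_const_nhds (x := (1 : ℝ≥0∞)))
  simpa using h0

/-- Uniqueness of the invariant probability of a contracting random map. -/
lemma stepLaw_invariant_unique (hF : Measurable (Function.uncurry F)) {L : Z × Z → ℝ≥0∞}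
    (hL : Measurable L) (hL' : ∀ zw, L zw ≠ ∞) {ρ c : ℝ≥0∞} (hρ : ρ < 1) (hc : c ≠ ∞)
    (H : ∀ zw, ∫⁻ e, L (pairMap F e zw) ∂m ≤ ρ * L zw)
    (hdist : ∀ zw, ENNReal.ofReal (min 1 (dist zw.1 zw.2)) ≤ c * min (L zw) 1)
    {u v : Measure Z} [IsProbabilityMeasure u] [IsProbabilityMeasure v]
    (hu : stepLaw m F u = u) (hv : stepLaw m F v = v) : u = v := by
  refine ext_of_forall_lipschitz_integral_eq fun φ A K hA hK => ?_
  have h0 := tendsto_lintegral_min_pow_mul hL hL' hρ (u.prod v)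
  -- As `u` and `v` are fixed by the evolution, the coupling obtained after `k` steps from `u.prod
  -- v` still couples `u` with `v`, now at a cost tending to zero.
  have h1 : ∀ k : ℕ, ENNReal.ofReal |∫ z, φ z ∂u - ∫ z, φ z ∂v| ≤
      (max A K : ℝ≥0) * c * ∫⁻ zw, min (ρ ^ k * L zw) 1 ∂(u.prod v) := by
    intro k
    obtain ⟨θ, hθ, hθ1, hθ2, hθ3⟩ := exists_coupling_iterate hF hL H u v k
    rw [Function.iterate_fixed hu] at hθ1
    rw [Function.iterate_fixed hv] at hθ2
    have := abs_integral_sub_le_of_coupling hdist hA hK θ hL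
    rw [hθ1, hθ2] at this
    refine this.trans ?_
    exact mul_le_mul_right (hθ3 1) _
  have h2 := ge_of_tendsto' (ENNReal.Tendsto.const_mul h0
    (Or.inr (ENNReal.mul_ne_top ENNReal.coe_ne_top hc))) h1
  simp only [mul_zero, nonpos_iff_eq_zero, ENNReal.ofReal_eq_zero] at h2
  have := abs_nonpos_iff.mp h2
  linarith

/-- Existence of an invariant probability of a contracting random map with a Lyapunov function
with relatively compact sublevel sets. -/
lemma exists_stepLaw_invariant (hF : Measurable (Function.uncurry F))
    (hFc : ∀ e, Continuous (F e)) {L : Z × Z → ℝ≥0∞}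
    (hL : Measurable L) (hL' : ∀ zw, L zw ≠ ∞) {Φ : Z → ℝ≥0∞} (hΦ : Measurable Φ)
    {ρ b c : ℝ≥0∞} (hρ : ρ < 1) (hb : b ≠ ∞) (hc : c ≠ ∞)
    (H : ∀ zw, ∫⁻ e, L (pairMap F e zw) ∂m ≤ ρ * L zw)
    (hdist : ∀ zw, ENNReal.ofReal (min 1 (dist zw.1 zw.2)) ≤ c * min (L zw) 1)
    (HΦ : ∀ z, ∫⁻ e, Φ (F e z) ∂m ≤ ρ * Φ z + b)
    (hcpt : ∀ r : ℝ≥0, ∃ C : Set Z, IsCompact C ∧ ∀ z, Φ z ≤ r → z ∈ C)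
    (z₀ : Z) (hz₀ : Φ z₀ ≠ ∞) :
    ∃ π : Measure Z, IsProbabilityMeasure π ∧ stepLaw m F π = π := by
  have : Fact (Measurable (Function.uncurry F)) := ⟨hF⟩
  let ν : ℕ → ProbabilityMeasure Z := fun k =>
    ⟨(stepLaw m F)^[k] (Measure.dirac z₀), inferInstance⟩
  set B := Φ z₀ + b * (1 - ρ)⁻¹ with hB
  have hBtop : B ≠ ∞ := by
    refine ENNReal.add_ne_top.2 ⟨hz₀, ENNReal.mul_ne_top hb ?_⟩
    simpa [tsub_eq_zero_iff_le] using hρ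
  have hmom : ∀ k, ∫⁻ z, Φ z ∂(ν k : Measure Z) ≤ B := by
    intro k
    have := lintegral_min_iterate_le (m := m) hF hΦ HΦ ∞ k (Measure.dirac z₀)
    simp only [le_top, inf_of_le_left] at this
    refine this.trans ?_
    rw [lintegral_dirac' _ (by fun_prop)]
    have h1 : ρ ^ k ≤ 1 := pow_le_one' hρ.le k
    calc _ ≤ 1 * Φ z₀ + b * (1 - ρ)⁻¹ := by
          gcongr
          exact sum_range_pow_le_inv ρ k
      _ = B := by rw [one_mul]
  have htight : IsTightMeasureSet {((μ : ProbabilityMeasure Z) : Measure Z) | μ ∈ Set.range ν} := by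
    rw [isTightMeasureSet_iff_exists_isCompact_measure_compl_le]
    intro ε hε
    by_cases hεt : ε = ∞
    · exact ⟨∅, isCompact_empty, fun _ _ => by simp [hεt]⟩
    -- Markov's inequality at level (B + 1)/ε; the added 1 keeps the level positive when B = 0.
    have hr : (B + 1) / ε ≠ ∞ := ENNReal.div_ne_top (by simp [hBtop]) hε.ne'
    obtain ⟨C, hC, hC'⟩ := hcpt ((B + 1) / ε).toNNReal
    rw [ENNReal.coe_toNNReal hr] at hC'
    refine ⟨C, hC, ?_⟩
    rintro _ ⟨_, ⟨k, rfl⟩, rfl⟩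
    have hr0 : (B + 1) / ε ≠ 0 := by simp [ENNReal.div_eq_zero_iff, hεt]
    calc (ν k : Measure Z) Cᶜ ≤ (ν k : Measure Z) {z | (B + 1) / ε ≤ Φ z} :=
          measure_mono fun z hz => (not_le.1 fun h => hz (hC' z h)).le
      _ ≤ (∫⁻ z, Φ z ∂(ν k : Measure Z)) / ((B + 1) / ε) :=
          meas_ge_le_lintegral_div hΦ.aemeasurable hr0 hr
      _ ≤ (B + 1) / ((B + 1) / ε) := by
          gcongr
          exact (hmom k).trans le_self_add
      _ = ε := by
          rw [ENNReal.div_div_cancel (by simp) (by simp [hBtop])]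
  have hcomp := isCompact_closure_of_isTightMeasureSet htight
  -- A nonprincipal ultrafilter picks a weak limit point of the tight sequence without extracting a
  -- subsequence.
  let U : Ultrafilter ℕ := Filter.hyperfilter ℕ
  have hU : (U : Filter ℕ) ≤ Filter.atTop := Nat.hyperfilter_le_atTop
  obtain ⟨π, -, hπ⟩ := hcomp.ultrafilter_le_nhds (U.map ν) (by
    rw [Filter.le_principal_iff]
    exact Filter.mem_map.2 (Filter.univ_mem' fun k => subset_closure ⟨k, rfl⟩))
  have hπ' : Filter.Tendsto ν U (nhds π) := hπ
  refine ⟨π, inferInstance, ?_⟩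
  have : IsProbabilityMeasure (stepLaw m F (π : Measure Z)) :=
    Measure.isProbabilityMeasure_map hF.aemeasurable
  refine ext_of_forall_lipschitz_integral_eq fun φ A K hA hK => ?_
  have hbound : ∀ z, ‖φ z‖ ≤ ‖φ z₀‖ + A := fun z => by
    have := hA z z₀
    rw [dist_eq_norm] at this
    calc ‖φ z‖ = ‖φ z₀ + (φ z - φ z₀)‖ := by congr 1; ring
      _ ≤ _ := (norm_add_le _ _).trans (by gcongr)
  have hmeas : ∀ z, Measurable fun e => φ (F e z) := fun z =>
    hK.continuous.measurable.comp (hF.comp (measurable_id.prodMk measurable_const))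
  -- ψ is the transition operator applied to φ. Continuity of each `F e` gives the Feller property,
  -- so ψ may be tested against weak limits.
  let ψ : BoundedContinuousFunction Z ℝ := BoundedContinuousFunction.ofNormedAddCommGroup
    (fun z => ∫ e, φ (F e z) ∂m)
    (continuous_of_dominated (fun z => (hmeas z).aestronglyMeasurable)
      (fun z => .of_forall fun e => hbound _) (integrable_const _)
      (.of_forall fun e => hK.continuous.comp (hFc e)))
    (‖φ z₀‖ + A) (fun z => by
      refine (norm_integral_le_integral_norm _).trans ?_
      calc ∫ e, ‖φ (F e z)‖ ∂m ≤ ∫ _, (‖φ z₀‖ + A) ∂m :=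
            integral_mono_of_nonneg (.of_forall fun _ => norm_nonneg _) (integrable_const _)
              (.of_forall fun e => hbound _)
        _ = _ := by simp)
  let φ' : BoundedContinuousFunction Z ℝ := BoundedContinuousFunction.ofNormedAddCommGroup
    φ hK.continuous (‖φ z₀‖ + A) hbound
  have hstep : ∀ (u : Measure Z) [IsProbabilityMeasure u],
      ∫ z, φ z ∂(stepLaw m F u) = ∫ z, ψ z ∂u := by
    intro u _
    rw [stepLaw, integral_map hF.aemeasurable hK.continuous.measurable.aestronglyMeasurable,
      integral_prod_symm]
    · rfl
    · exact .of_bound (hK.continuous.measurable.comp hF).aestronglyMeasurable _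
        (.of_forall fun e => hbound _)
  rw [hstep]
  have t1 : Filter.Tendsto (fun k => ∫ z, ψ z ∂(ν k : Measure Z)) U (nhds (∫ z, ψ z ∂(π : Measure Z))) :=
    (ProbabilityMeasure.tendsto_iff_forall_integral_tendsto.1 hπ') ψ
  have t2 : Filter.Tendsto (fun k => ∫ z, φ z ∂(ν k : Measure Z)) U (nhds (∫ z, φ z ∂(π : Measure Z))) :=
    (ProbabilityMeasure.tendsto_iff_forall_integral_tendsto.1 hπ') φ'
  have : IsProbabilityMeasure (stepLaw m F (Measure.dirac z₀)) :=
    Measure.isProbabilityMeasure_map hF.aemeasurable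
  have h0 := tendsto_lintegral_min_pow_mul hL hL' hρ
    ((stepLaw m F (Measure.dirac z₀)).prod (Measure.dirac z₀))
  -- ν_(k+1) and ν_k are the k-step laws started from the one-step law of `z₀` and from `z₀` itself,
  -- so the coupling forces their integrals of φ together. No Cesàro averaging is needed.
  have h1 : ∀ k : ℕ, ENNReal.ofReal |∫ z, ψ z ∂(ν k : Measure Z) - ∫ z, φ z ∂(ν k : Measure Z)| ≤
      (max A K : ℝ≥0) * c * ∫⁻ zw, min (ρ ^ k * L zw) 1
        ∂((stepLaw m F (Measure.dirac z₀)).prod (Measure.dirac z₀)) := by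
    intro k
    obtain ⟨θ, hθ, hθ1, hθ2, hθ3⟩ := exists_coupling_iterate hF hL H
      (stepLaw m F (Measure.dirac z₀)) (Measure.dirac z₀) k
    have := abs_integral_sub_le_of_coupling hdist hA hK θ hL
    rw [hθ1, hθ2, ← Function.iterate_succ_apply, Function.iterate_succ_apply', hstep] at this
    refine this.trans ?_
    exact mul_le_mul_right (hθ3 1) _
  have h2 : Filter.Tendsto
      (fun k => |∫ z, ψ z ∂(ν k : Measure Z) - ∫ z, φ z ∂(ν k : Measure Z)|) Filter.atTop
      (nhds 0) := by
    have h3 := ENNReal.Tendsto.const_mul h0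
      (Or.inr (ENNReal.mul_ne_top ENNReal.coe_ne_top hc) : _ ∨ ((max A K : ℝ≥0) : ℝ≥0∞) * c ≠ ∞)
    simp only [mul_zero] at h3
    have h4 := tendsto_of_tendsto_of_tendsto_of_le_of_le tendsto_const_nhds h3
      (fun k => zero_le) h1
    simpa [Function.comp_def, ENNReal.toReal_ofReal] using
      (ENNReal.tendsto_toReal ENNReal.zero_ne_top).comp h4
  have h5 := tendsto_nhds_unique (h2.mono_left hU) (t1.sub t2).abs
  have := abs_eq_zero.1 h5.symm
  linarith

end Invariant

/-! ### The transition matrices of the switching chain -/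

section Generator

open Matrix

variable {N : ℕ} {Γ : Matrix (Fin N) (Fin N) ℝ} {μ : Fin N → ℝ}

lemma hasSum_exp_apply (A : Matrix (Fin N) (Fin N) ℝ) (i j : Fin N) :
    HasSum (fun k : ℕ => ((k.factorial : ℝ)⁻¹) * (A ^ k) i j) (NormedSpace.exp A i j) := by
  let _ : NormedRing (Matrix (Fin N) (Fin N) ℝ) := Matrix.linftyOpNormedRing
  let _ : NormedAlgebra ℝ (Matrix (Fin N) (Fin N) ℝ) := Matrix.linftyOpNormedAlgebra
  have h := NormedSpace.exp_series_hasSum_exp' (𝕂 := ℝ) A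
  have h' := Pi.hasSum.1 (Pi.hasSum.1 h i) j
  simp only [Matrix.smul_apply, smul_eq_mul] at h'
  exact h'

lemma pow_nonneg_apply {A : Matrix (Fin N) (Fin N) ℝ} (hA : ∀ i j, 0 ≤ A i j) (k : ℕ) (i j : Fin N) :
    0 ≤ (A ^ k) i j := by
  induction k generalizing i j with
  | zero =>
    rw [pow_zero, Matrix.one_apply]
    split_ifs <;> norm_num
  | succ k ih =>
    rw [pow_succ, Matrix.mul_apply]
    exact Finset.sum_nonneg fun l _ => mul_nonneg (ih i l) (hA l j)

lemma exp_nonneg_apply {A : Matrix (Fin N) (Fin N) ℝ} (hA : ∀ i j, 0 ≤ A i j) (i j : Fin N) :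
    0 ≤ NormedSpace.exp A i j :=
  (hasSum_exp_apply A i j).nonneg fun k => mul_nonneg (by positivity) (pow_nonneg_apply hA k i j)

lemma exp_pos_apply {A : Matrix (Fin N) (Fin N) ℝ} (hA : ∀ i j, 0 ≤ A i j) {i j : Fin N}
    {k : ℕ} (hk : 0 < (A ^ k) i j) : 0 < NormedSpace.exp A i j := by
  have h := hasSum_exp_apply A i j
  have h1 : ((k.factorial : ℝ)⁻¹) * (A ^ k) i j ≤ NormedSpace.exp A i j :=
    le_hasSum h k fun l _ => mul_nonneg (by positivity) (pow_nonneg_apply hA l i j)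
  exact lt_of_lt_of_le (by positivity) h1

/-- A shift making all entries of a generator nonnegative, with positive diagonal. -/
def diagShift (Γ : Matrix (Fin N) (Fin N) ℝ) : ℝ := 1 + ∑ i, |Γ i i|

lemma add_diagShift_nonneg (hΓ : IsGenerator Γ) (i j : Fin N) :
    0 ≤ (Γ + diagShift Γ • (1 : Matrix (Fin N) (Fin N) ℝ)) i j := by
  by_cases h : i = j
  · subst h
    have : |Γ i i| ≤ ∑ i, |Γ i i| :=
      Finset.single_le_sum (f := fun i => |Γ i i|) (fun _ _ => abs_nonneg _) (Finset.mem_univ i)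
    have h2 := neg_abs_le (Γ i i)
    simp [diagShift]
    linarith
  · simpa [h] using hΓ.1 i j h

/-- The scalar shift commutes with Γ, so exp(tΓ) is a positive multiple of the exponential of a
shifted matrix. For a generator and t ≥ 0 the entries of that matrix are nonnegative, and signs can
be read off the power series. -/
lemma stepMatrix_eq_smul (Γ : Matrix (Fin N) (Fin N) ℝ) (t : ℝ) :
    stepMatrix Γ t = Real.exp (-(t * diagShift Γ)) •
      NormedSpace.exp (t • (Γ + diagShift Γ • (1 : Matrix (Fin N) (Fin N) ℝ))) := by
  have h1 : t • Γ = t • (Γ + diagShift Γ • (1 : Matrix (Fin N) (Fin N) ℝ)) +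
      (-(t * diagShift Γ)) • (1 : Matrix (Fin N) (Fin N) ℝ) := by
    rw [smul_add, smul_smul, neg_smul]; abel
  rw [stepMatrix, h1, Matrix.exp_add_of_commute _ _ ((Commute.one_right _).smul_right _)]
  have h2 : NormedSpace.exp ((-(t * diagShift Γ)) • (1 : Matrix (Fin N) (Fin N) ℝ)) =
      Real.exp (-(t * diagShift Γ)) • (1 : Matrix (Fin N) (Fin N) ℝ) := by
    rw [Matrix.smul_one_eq_diagonal, Matrix.exp_diagonal, Matrix.smul_one_eq_diagonal]
    congr 1
    ext i
    rw [Pi.coe_exp, Real.exp_eq_exp_ℝ]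
  rw [h2, Matrix.mul_smul, Matrix.mul_one]

lemma stepMatrix_nonneg (hΓ : IsGenerator Γ) {t : ℝ} (ht : 0 ≤ t) (i j : Fin N) :
    0 ≤ stepMatrix Γ t i j := by
  rw [stepMatrix_eq_smul]
  refine mul_nonneg (Real.exp_pos _).le (exp_nonneg_apply (fun a b => ?_) i j)
  exact mul_nonneg ht (add_diagShift_nonneg hΓ a b)

/-- A path of k positive rates makes an entry of the k-th power of the shifted generator positive,
and one positive term of the series suffices. -/
lemma stepMatrix_pos (hΓ : IsGenerator Γ) (hirr : IsIrreducibleGenerator Γ) {t : ℝ} (ht : 0 < t)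
    (i j : Fin N) : 0 < stepMatrix Γ t i j := by
  rw [stepMatrix_eq_smul]
  set A := t • (Γ + diagShift Γ • (1 : Matrix (Fin N) (Fin N) ℝ)) with hA
  have hA0 : ∀ a b, 0 ≤ A a b := fun a b => mul_nonneg ht.le (add_diagShift_nonneg hΓ a b)
  have hApos : ∀ a b, 0 < Γ a b → 0 < A a b := by
    intro a b hab
    refine mul_pos ht ?_
    have h1 : 0 ≤ diagShift Γ := by unfold diagShift; positivity
    have h2 : 0 ≤ (1 : Matrix (Fin N) (Fin N) ℝ) a b := by
      rw [Matrix.one_apply]; split_ifs <;> norm_num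
    have : 0 ≤ (diagShift Γ • (1 : Matrix (Fin N) (Fin N) ℝ)) a b := mul_nonneg h1 h2
    rw [Matrix.add_apply]
    linarith
  obtain ⟨k, hk⟩ : ∃ k : ℕ, 0 < (A ^ k) i j := by
    induction hirr i j with
    | refl => exact ⟨0, by simp⟩
    | @tail b c _ hbc ih =>
      obtain ⟨k, hk⟩ := ih
      refine ⟨k + 1, ?_⟩
      rw [pow_succ, Matrix.mul_apply]
      exact Finset.sum_pos' (fun l _ => mul_nonneg (pow_nonneg_apply hA0 k i l) (hA0 l c))
        ⟨b, Finset.mem_univ b, mul_pos hk (hApos b c hbc)⟩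
  exact mul_pos (Real.exp_pos _) (exp_pos_apply hA0 hk)

lemma stepMatrix_add (Γ : Matrix (Fin N) (Fin N) ℝ) (s t : ℝ) :
    stepMatrix Γ (s + t) = stepMatrix Γ s * stepMatrix Γ t := by
  rw [stepMatrix, add_smul, Matrix.exp_add_of_commute _ _
    (((Commute.refl Γ).smul_left s).smul_right t)]
  rfl

/-- Γ annihilates the constant vector, so only the zeroth term of the exponential series survives;
stationarity of μ gives the transposed statement below in the same way. -/
lemma sum_stepMatrix (hΓ : IsGenerator Γ) (t : ℝ) (i : Fin N) : ∑ j, stepMatrix Γ t i j = 1 := by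
  have h := hasSum_sum (s := Finset.univ) fun j _ => hasSum_exp_apply (t • Γ) i j
  have h0 : (t • Γ) *ᵥ (fun _ => 1) = 0 := by
    ext a
    simp [Matrix.mulVec, dotProduct, ← Finset.mul_sum, hΓ.2 a]
  have hk : ∀ k : ℕ, ∑ j, ((k.factorial : ℝ)⁻¹) * ((t • Γ) ^ k) i j = if k = 0 then 1 else 0 := by
    intro k
    rw [← Finset.mul_sum]
    have h1 : ∑ j, ((t • Γ) ^ k) i j = (((t • Γ) ^ k) *ᵥ (fun _ => 1)) i := by
      simp [Matrix.mulVec, dotProduct]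
    rw [h1]
    cases k with
    | zero => simp
    | succ k => rw [pow_succ, ← Matrix.mulVec_mulVec, h0]; simp
  simp_rw [hk] at h
  exact h.unique (hasSum_ite_eq 0 1)

lemma vecMul_stepMatrix (hμ : IsStationaryDistribution Γ μ) (t : ℝ) :
    μ ᵥ* stepMatrix Γ t = μ := by
  ext j
  have h := hasSum_sum (s := Finset.univ) fun i _ => (hasSum_exp_apply (t • Γ) i j).mul_left (μ i)
  have h0 : μ ᵥ* (t • Γ) = 0 := by rw [Matrix.vecMul_smul, hμ.1, smul_zero]
  have hk : ∀ k : ℕ, ∑ i, μ i * (((k.factorial : ℝ)⁻¹) * ((t • Γ) ^ k) i j) =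
      if k = 0 then μ j else 0 := by
    intro k
    have h1 : ∑ i, μ i * (((k.factorial : ℝ)⁻¹) * ((t • Γ) ^ k) i j) =
        ((k.factorial : ℝ)⁻¹) * (μ ᵥ* ((t • Γ) ^ k)) j := by
      simp only [Matrix.vecMul, dotProduct, Finset.mul_sum]
      exact Finset.sum_congr rfl fun i _ => by ring
    rw [h1]
    cases k with
    | zero => simp
    | succ k => rw [pow_succ', ← Matrix.vecMul_vecMul, h0]; simp
  simp_rw [hk] at h
  exact h.unique (hasSum_ite_eq 0 (μ j))

/-- Stochastic matrices do not increase the supremum norm. -/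
lemma abs_stepMatrix_mulVec_le (hΓ : IsGenerator Γ) {t K : ℝ} (ht : 0 ≤ t) {u : Fin N → ℝ}
    (hu : ∀ j, |u j| ≤ K) (i : Fin N) : |(stepMatrix Γ t *ᵥ u) i| ≤ K := by
  calc |∑ j, stepMatrix Γ t i j * u j| ≤ ∑ j, |stepMatrix Γ t i j * u j| :=
        Finset.abs_sum_le_sum_abs _ _
    _ ≤ ∑ j, stepMatrix Γ t i j * K := by
        refine Finset.sum_le_sum fun j _ => ?_
        rw [abs_mul, abs_of_nonneg (stepMatrix_nonneg hΓ ht i j)]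
        exact mul_le_mul_of_nonneg_left (hu j) (stepMatrix_nonneg hΓ ht i j)
    _ = K := by rw [← Finset.sum_mul, sum_stepMatrix hΓ, one_mul]

lemma sum_mul_stepMatrix_mulVec (hμ : IsStationaryDistribution Γ μ) (t : ℝ) (u : Fin N → ℝ) :
    ∑ i, μ i * (stepMatrix Γ t *ᵥ u) i = ∑ i, μ i * u i := by
  have := Matrix.dotProduct_mulVec μ (stepMatrix Γ t) u
  rw [vecMul_stepMatrix hμ] at this
  exact this

/-- The semigroup `exp(tΓ)` tends to zero on centered functions. -/
lemma exists_time_abs_le (hΓ : IsGenerator Γ) (hirr : IsIrreducibleGenerator Γ)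
    (hμ : IsStationaryDistribution Γ μ) {u : Fin N → ℝ} (hu : ∑ i, μ i * u i = 0) {ε : ℝ}
    (hε : 0 < ε) :
    ∃ T : ℕ, ∀ t : ℝ, T ≤ t → ∀ i, |(stepMatrix Γ t *ᵥ u) i| ≤ ε := by
  -- Doeblin minorisation at time 1, with δ the smallest entry of the transition matrix, capped at 1
  -- so that 1 - δ ≥ 0.
  obtain ⟨δ, hδ0, hδ1, hδ⟩ : ∃ δ : ℝ, 0 < δ ∧ δ ≤ 1 ∧ ∀ i j, δ * μ j ≤ stepMatrix Γ 1 i j := by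
    have hne : Nonempty (Fin N) := by
      by_contra h
      rw [not_nonempty_iff] at h
      have := hμ.2.1
      simp at this
    obtain ⟨⟨a, b⟩, hab⟩ := Finite.exists_min fun p : Fin N × Fin N => stepMatrix Γ 1 p.1 p.2
    refine ⟨min (stepMatrix Γ 1 a b) 1, lt_min (stepMatrix_pos hΓ hirr one_pos a b) one_pos,
      min_le_right _ _, fun i j => ?_⟩
    have hμ1 : μ j ≤ 1 := by
      rw [← hμ.2.1]
      exact Finset.single_le_sum (fun i _ => (hμ.2.2 i).le) (Finset.mem_univ j)
    calc _ ≤ stepMatrix Γ 1 a b * 1 :=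
          mul_le_mul (min_le_left _ _) hμ1 (hμ.2.2 j).le (stepMatrix_pos hΓ hirr one_pos a b).le
      _ ≤ _ := by rw [mul_one]; exact hab (i, j)
  set K := ∑ j, |u j| with hK
  have hK' : ∀ j, |u j| ≤ K := fun j =>
    Finset.single_le_sum (f := fun j => |u j|) (fun _ _ => abs_nonneg _) (Finset.mem_univ j)
  -- Subtracting δμ from each row does not change the action on centered functions, and leaves a
  -- nonnegative matrix with row sums 1 - δ.
  have hcontr : ∀ (v : Fin N → ℝ) (k : ℝ), ∑ i, μ i * v i = 0 → (∀ j, |v j| ≤ k) →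
      ∀ i, |(stepMatrix Γ 1 *ᵥ v) i| ≤ (1 - δ) * k := by
    intro v k hv hk i
    have h1 : (stepMatrix Γ 1 *ᵥ v) i = ∑ j, (stepMatrix Γ 1 i j - δ * μ j) * v j := by
      have : ∑ j, (stepMatrix Γ 1 i j - δ * μ j) * v j =
          ∑ j, stepMatrix Γ 1 i j * v j - δ * ∑ j, μ j * v j := by
        rw [Finset.mul_sum, ← Finset.sum_sub_distrib]
        exact Finset.sum_congr rfl fun j _ => by ring
      rw [this, hv, mul_zero, sub_zero]
      rfl
    rw [h1]
    calc _ ≤ ∑ j, |(stepMatrix Γ 1 i j - δ * μ j) * v j| := Finset.abs_sum_le_sum_abs _ _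
      _ ≤ ∑ j, (stepMatrix Γ 1 i j - δ * μ j) * k := by
          refine Finset.sum_le_sum fun j _ => ?_
          have := sub_nonneg.2 (hδ i j)
          rw [abs_mul, abs_of_nonneg this]
          exact mul_le_mul_of_nonneg_left (hk j) this
      _ = (1 - δ) * k := by
          rw [← Finset.sum_mul, Finset.sum_sub_distrib, sum_stepMatrix hΓ, ← Finset.mul_sum,
            hμ.2.1, mul_one]
  have hpow : ∀ k : ℕ, ∀ i, |(stepMatrix Γ k *ᵥ u) i| ≤ (1 - δ) ^ k * K := by
    intro k
    induction k with
    | zero => intro i; simpa [stepMatrix] using hK' i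
    | succ k ih =>
      intro i
      have := hcontr (stepMatrix Γ k *ᵥ u) _ (by rw [sum_mul_stepMatrix_mulVec hμ, hu]) ih i
      rw [Matrix.mulVec_mulVec, ← stepMatrix_add] at this
      push_cast
      rw [add_comm (k : ℝ) 1, pow_succ', mul_assoc]
      exact this
  obtain ⟨T, hT⟩ := exists_pow_lt_of_lt_one (show 0 < ε / (K + 1) by positivity)
    (show 1 - δ < 1 by linarith)
  refine ⟨T, fun t ht i => ?_⟩
  have h1 : stepMatrix Γ t = stepMatrix Γ (t - T) * stepMatrix Γ T := by
    rw [← stepMatrix_add]; congr 1; ring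
  rw [h1, ← Matrix.mulVec_mulVec]
  refine (abs_stepMatrix_mulVec_le hΓ (sub_nonneg.2 ht) (hpow T) i).trans ?_
  have hK0 : 0 ≤ K := by positivity
  calc (1 - δ) ^ T * K ≤ ε / (K + 1) * (K + 1) := by
        have : 0 ≤ (1 - δ) ^ T := pow_nonneg (by linarith) T
        gcongr
        linarith
    _ = ε := by field_simp

/-- A weight `h` for which the Feynman–Kac matrix `exp(ΔΓ) diag(exp(sΔc))` is a strict
contraction; the range of `s` does not depend on `Δ`. -/
lemma exists_weight (hΓ : IsGenerator Γ) (hirr : IsIrreducibleGenerator Γ)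
    (hμ : IsStationaryDistribution Γ μ) {c : Fin N → ℝ} (hc : ∑ j, μ j * c j < 0) :
    ∃ s₀ : ℝ, 0 < s₀ ∧ ∀ Δ : ℝ, 0 < Δ → Δ ≤ 1 → ∀ s : ℝ, 0 < s → s ≤ s₀ →
      ∃ (h : Fin N → ℝ) (η : ℝ), 0 < η ∧ η < 1 ∧ (∀ i, 1 / 2 ≤ h i ∧ h i ≤ 3 / 2) ∧
        ∀ i, ∑ j, stepMatrix Γ Δ i j * (Real.exp (s * Δ * c j) * h j) ≤ (1 - η) * h i := by
  set lam := -∑ j, μ j * c j with hlam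
  have hlam0 : 0 < lam := by linarith
  set u : Fin N → ℝ := fun j => c j + lam with hu
  have hu0 : ∑ i, μ i * u i = 0 := by
    simp only [hu, mul_add, Finset.sum_add_distrib, ← Finset.sum_mul, hμ.2.1]
    linarith
  obtain ⟨T, hT⟩ := exists_time_abs_le hΓ hirr hμ hu0 (show 0 < lam / 4 by linarith)
  set K := ∑ j, |u j| with hK
  have hK' : ∀ j, |u j| ≤ K := fun j =>
    Finset.single_le_sum (f := fun j => |u j|) (fun _ _ => abs_nonneg _) (Finset.mem_univ j)
  have hK0 : 0 ≤ K := by positivity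
  set C := ∑ j, |c j| with hC
  have hC' : ∀ j, |c j| ≤ C := fun j =>
    Finset.single_le_sum (f := fun j => |c j|) (fun _ _ => abs_nonneg _) (Finset.mem_univ j)
  have hC0 : 0 ≤ C := by positivity
  set W := ((T : ℝ) + 1) * K with hW
  have hW0 : 0 ≤ W := by positivity
  set R := C * W + 2 * C ^ 2 with hR
  have hR0 : 0 ≤ R := by positivity
  -- In order, the bounds on s give: |s w| ≤ 1/2, hence h in [1/2, 3/2]; |sΔc_j| ≤ 1, for the
  -- quadratic bound on exp; s R ≤ lam/4, absorbing the second-order terms collected in R; and s·lam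
  -- ≤ 1, so that η < 1. None involves Δ.
  refine ⟨min (1 / (2 * (W + 1))) (min (1 / (C + 1)) (min (lam / (4 * (R + 1))) (1 / lam))),
    by positivity, fun Δ hΔ hΔ1 s hs hs₀ => ?_⟩
  simp only [le_min_iff] at hs₀
  obtain ⟨hs1, hs2, hs3, hs4⟩ := hs₀
  rw [le_div_iff₀ (by positivity)] at hs1 hs2 hs3 hs4
  -- M steps cover a time between T and T + 1, which bounds the corrector uniformly in Δ.
  set M := ⌈(T : ℝ) / Δ⌉₊ with hM
  have hM1 : (T : ℝ) ≤ M * Δ := by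
    rw [← div_le_iff₀ hΔ]; exact Nat.le_ceil _
  have hM2 : M * Δ ≤ T + 1 := by
    have : (M : ℝ) < T / Δ + 1 := Nat.ceil_lt_add_one (by positivity)
    calc M * Δ ≤ (T / Δ + 1) * Δ := by gcongr
      _ = T + Δ := by field_simp
      _ ≤ _ := by linarith
  set q : ℕ → Fin N → ℝ := fun l => stepMatrix Γ (l * Δ) *ᵥ u with hq
  have hqK : ∀ l i, |q l i| ≤ K := fun l i =>
    abs_stepMatrix_mulVec_le hΓ (by positivity) hK' i
  have hqs : ∀ l, stepMatrix Γ Δ *ᵥ q l = q (l + 1) := by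
    intro l
    simp only [hq]
    rw [Matrix.mulVec_mulVec, ← stepMatrix_add]
    congr 2
    push_cast
    ring
  -- A truncated solution of the Poisson equation: with Q = exp(ΔΓ), the telescoping sum gives Qw =
  -- w - ΔQu + ΔQ^(M+1)u, and the last power is small by the choice of T. In h = 1 + s w this
  -- replaces c by its mean -lam at first order in s.
  set w : Fin N → ℝ := Δ • ∑ l ∈ Finset.range M, q (l + 1) with hw
  have hwW : ∀ i, |w i| ≤ W := by
    intro i
    simp only [hw, Pi.smul_apply, Finset.sum_apply, smul_eq_mul, abs_mul, abs_of_pos hΔ]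
    calc Δ * |∑ l ∈ Finset.range M, q (l + 1) i| ≤ Δ * ∑ l ∈ Finset.range M, K := by
          gcongr
          exact (Finset.abs_sum_le_sum_abs _ _).trans (Finset.sum_le_sum fun l _ => hqK _ _)
      _ = (M * Δ) * K := by simp; ring
      _ ≤ W := by rw [hW]; gcongr
  have hQw : stepMatrix Γ Δ *ᵥ w = w - Δ • q 1 + Δ • q (M + 1) := by
    have h1 : stepMatrix Γ Δ *ᵥ w = Δ • ∑ l ∈ Finset.range M, q (l + 1 + 1) := by
      rw [hw, Matrix.mulVec_smul, Matrix.mulVec_sum]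
      simp_rw [hqs]
    have h2 : ∑ l ∈ Finset.range M, q (l + 1 + 1) + q 1 =
        ∑ l ∈ Finset.range M, q (l + 1) + q (M + 1) := by
      rw [← Finset.sum_range_succ (fun l => q (l + 1)), Finset.sum_range_succ']
    rw [h1, hw, eq_sub_of_add_eq h2, smul_sub, smul_add]
    abel
  have hq1 : ∀ i, q 1 i = (stepMatrix Γ Δ *ᵥ c) i + lam := by
    intro i
    simp only [hq, hu, Nat.cast_one, one_mul, Matrix.mulVec, dotProduct, mul_add,
      Finset.sum_add_distrib]
    rw [← Finset.sum_mul, sum_stepMatrix hΓ, one_mul]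
  have hqM : ∀ i, q (M + 1) i ≤ lam / 4 := fun i =>
    (le_abs_self _).trans (hT _ (by push_cast; nlinarith) i)
  set h : Fin N → ℝ := fun i => 1 + s * w i with hh
  have hsw : ∀ i, |s * w i| ≤ 1 / 2 := by
    intro i
    rw [abs_mul, abs_of_pos hs]
    have := mul_le_mul_of_nonneg_left (hwW i) hs.le
    nlinarith
  have hbd : ∀ i, 1 / 2 ≤ h i ∧ h i ≤ 3 / 2 := by
    intro i
    have := abs_le.1 (hsw i)
    simp only [hh]
    constructor <;> linarith
  refine ⟨h, s * Δ * lam / 4, by positivity, ?_, hbd, fun i => ?_⟩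
  · have : s * Δ * lam ≤ 1 := by
      calc s * Δ * lam = (s * lam) * Δ := by ring
        _ ≤ 1 * 1 := by gcongr
        _ = 1 := one_mul 1
    linarith
  have hpt : ∀ j, Real.exp (s * Δ * c j) * h j ≤ 1 + s * w j + s * Δ * c j + s ^ 2 * Δ * R := by
    intro j
    set x := s * Δ * c j with hx
    have hxabs : |x| ≤ s * Δ * C := by
      rw [hx, abs_mul, abs_of_pos (by positivity : 0 < s * Δ)]
      gcongr
      exact hC' j
    have hx1 : |x| ≤ 1 := by
      refine hxabs.trans ?_
      calc s * Δ * C ≤ s * 1 * (C + 1) := by gcongr; linarith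
        _ ≤ 1 := by linarith
    have he : Real.exp x ≤ 1 + x + x ^ 2 := by
      have := (abs_le.1 (Real.abs_exp_sub_one_sub_id_le hx1)).2
      linarith
    have hb := hbd j
    have hx2 : x ^ 2 ≤ s ^ 2 * Δ * C ^ 2 := by
      calc x ^ 2 = |x| ^ 2 := (sq_abs x).symm
        _ ≤ (s * Δ * C) ^ 2 := by gcongr
        _ = (s ^ 2 * Δ * C ^ 2) * Δ := by ring
        _ ≤ (s ^ 2 * Δ * C ^ 2) * 1 := by gcongr
        _ = _ := mul_one _
    have hxw : x * (s * w j) ≤ s ^ 2 * Δ * (C * W) := by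
      calc x * (s * w j) ≤ |x * (s * w j)| := le_abs_self _
        _ = |x| * (s * |w j|) := by rw [abs_mul, abs_mul s, abs_of_pos hs]
        _ ≤ (s * Δ * C) * (s * W) := by gcongr; exact hwW j
        _ = _ := by ring
    calc Real.exp x * h j ≤ (1 + x + x ^ 2) * h j := by
          gcongr; linarith
      _ = 1 + s * w j + x + x * (s * w j) + x ^ 2 * h j := by simp only [hh]; ring
      _ ≤ 1 + s * w j + x + s ^ 2 * Δ * (C * W) + (s ^ 2 * Δ * C ^ 2) * 2 := by
          have : x ^ 2 * h j ≤ (s ^ 2 * Δ * C ^ 2) * 2 :=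
            mul_le_mul hx2 (by linarith) (by linarith) (by positivity)
          linarith
      _ = _ := by rw [hR]; ring
  have hsum : ∑ j, stepMatrix Γ Δ i j * (1 + s * w j + s * Δ * c j + s ^ 2 * Δ * R) =
      1 + s * (stepMatrix Γ Δ *ᵥ w) i + s * Δ * (stepMatrix Γ Δ *ᵥ c) i + s ^ 2 * Δ * R := by
    have e : ∀ j, stepMatrix Γ Δ i j * (1 + s * w j + s * Δ * c j + s ^ 2 * Δ * R) =
        stepMatrix Γ Δ i j * (1 + s ^ 2 * Δ * R) + s * (stepMatrix Γ Δ i j * w j) +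
          s * Δ * (stepMatrix Γ Δ i j * c j) := fun j => by ring
    simp_rw [e, Finset.sum_add_distrib, ← Finset.mul_sum, ← Finset.sum_mul, sum_stepMatrix hΓ]
    simp only [Matrix.mulVec, dotProduct]
    ring
  have hQi : (stepMatrix Γ Δ *ᵥ w) i = w i - Δ * q 1 i + Δ * q (M + 1) i := by
    rw [hQw]; simp
  calc ∑ j, stepMatrix Γ Δ i j * (Real.exp (s * Δ * c j) * h j)
      ≤ ∑ j, stepMatrix Γ Δ i j * (1 + s * w j + s * Δ * c j + s ^ 2 * Δ * R) :=
        Finset.sum_le_sum fun j _ =>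
          mul_le_mul_of_nonneg_left (hpt j) (stepMatrix_nonneg hΓ hΔ.le i j)
    _ = 1 + s * w i - s * Δ * lam + s * Δ * q (M + 1) i + s * Δ * (s * R) := by
        rw [hsum, hQi, hq1]; ring
    _ ≤ 1 + s * w i - s * Δ * lam + s * Δ * (lam / 4) + s * Δ * (lam / 4) := by
        have h1 : s * R ≤ lam / 4 := by nlinarith
        have h2 := hqM i
        gcongr
    -- Half of the gain s·Δ·lam survives the two errors; since h ≤ 3/2 ≤ 2 it dominates η h with η =
    -- s·Δ·lam/4.
    _ = h i - s * Δ * lam / 4 * 2 := by simp only [hh]; ring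
    _ ≤ h i - s * Δ * lam / 4 * h i := by
        have := (hbd i).2
        gcongr
        linarith
    _ = _ := by ring

end Generator

/-! ### The implicit equation -/

section Implicit

/-- A continuous, strongly monotone map that is Lipschitz on bounded sets is surjective. -/
lemma surjective_of_strongly_monotone {H : Type*} [NormedAddCommGroup H] [InnerProductSpace ℝ H]
    [CompleteSpace H] {T : H → H} {c : ℝ} (hc : 0 < c)
    (hmono : ∀ u v, c * ‖u - v‖ ^ 2 ≤ inner ℝ (u - v) (T u - T v))
    (hlip : ∀ R : ℝ, ∃ K : ℝ, ∀ u v, ‖u‖ ≤ R → ‖v‖ ≤ R → ‖T u - T v‖ ≤ K * ‖u - v‖) :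
    Function.Surjective T := by
  intro y
  -- Banach's fixed point theorem is applied on this ball only. The radius makes ‖G 0‖ equal to
  -- (tc/2)R, exactly the room left by the contraction factor 1 - tc/2.
  set R := 2 * ‖y - T 0‖ / c with hR
  have hR0 : 0 ≤ R := by positivity
  obtain ⟨K₀, hK₀⟩ := hlip R
  set K := max K₀ 1 with hK
  have hK1 : 1 ≤ K := le_max_right _ _
  have hKlip : ∀ u v, ‖u‖ ≤ R → ‖v‖ ≤ R → ‖T u - T v‖ ≤ K * ‖u - v‖ := fun u v hu hv =>
    (hK₀ u v hu hv).trans (by gcongr; exact le_max_left _ _)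
  -- tK² ≤ c bounds the squared Lipschitz constant of G by 1 - tc ≤ (1 - tc/2)²; tc ≤ 1 keeps the
  -- factor nonnegative.
  set t := min (c / K ^ 2) (1 / c) with ht
  have ht0 : 0 < t := by positivity
  have ht1 : t * K ^ 2 ≤ c := by
    rw [← le_div_iff₀ (by positivity)]; exact min_le_left _ _
  have ht2 : t * c ≤ 1 := by
    rw [← le_div_iff₀ hc]; exact min_le_right _ _
  set G : H → H := fun u => u - t • (T u - y) with hG
  set k := 1 - t * c / 2 with hk
  have hk0 : 0 ≤ k := by simp only [hk]; linarith
  have hk1 : k < 1 := by simp only [hk]; linarith [mul_pos ht0 hc]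
  have hGlip : ∀ u v, ‖u‖ ≤ R → ‖v‖ ≤ R → ‖G u - G v‖ ≤ k * ‖u - v‖ := by
    intro u v hu hv
    refine le_of_sq_le_sq ?_ (by positivity)
    have e : G u - G v = (u - v) - t • (T u - T v) := by
      simp only [hG]; rw [smul_sub, smul_sub, smul_sub]; abel
    rw [e, norm_sub_sq_real, inner_smul_right, norm_smul, Real.norm_of_nonneg ht0.le]
    have h1 := hmono u v
    have h2 : ‖T u - T v‖ ^ 2 ≤ (K * ‖u - v‖) ^ 2 := by gcongr; exact hKlip u v hu hv
    have h3 : (t * ‖T u - T v‖) ^ 2 ≤ t * c * ‖u - v‖ ^ 2 := by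
      calc (t * ‖T u - T v‖) ^ 2 ≤ t ^ 2 * (K * ‖u - v‖) ^ 2 := by rw [mul_pow]; gcongr
        _ = t * (t * K ^ 2) * ‖u - v‖ ^ 2 := by ring
        _ ≤ t * c * ‖u - v‖ ^ 2 := by gcongr
    have h4 := mul_le_mul_of_nonneg_left h1 ht0.le
    have h5 : 0 ≤ (t * c / 2) ^ 2 * ‖u - v‖ ^ 2 := by positivity
    simp only [hk]
    nlinarith
  have hG0 : ∀ u, ‖u‖ ≤ R → ‖G u‖ ≤ R := by
    intro u hu
    have h1 := hGlip u 0 hu (by simpa using hR0)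
    have h2 : G 0 = t • (y - T 0) := by simp only [hG]; rw [zero_sub, ← smul_neg, neg_sub]
    have h3 : ‖G 0‖ = t * c / 2 * R := by
      rw [h2, norm_smul, Real.norm_of_nonneg ht0.le, hR]; field_simp
    calc ‖G u‖ = ‖(G u - G 0) + G 0‖ := by rw [sub_add_cancel]
      _ ≤ ‖G u - G 0‖ + ‖G 0‖ := norm_add_le _ _
      _ ≤ k * R + t * c / 2 * R := by
          rw [h3]
          gcongr
          refine h1.trans ?_
          rw [sub_zero]
          gcongr
      _ = R := by simp only [hk]; ring
  have hmaps : Set.MapsTo G (Metric.closedBall 0 R) (Metric.closedBall 0 R) := by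
    intro u hu
    rw [mem_closedBall_zero_iff] at hu ⊢
    exact hG0 u hu
  have hcontr : ContractingWith ⟨k, hk0⟩ (hmaps.restrict G _ _) := by
    refine ⟨by exact_mod_cast hk1, LipschitzWith.of_dist_le_mul fun u v => ?_⟩
    rw [Subtype.dist_eq, Subtype.dist_eq, dist_eq_norm, dist_eq_norm]
    exact hGlip u v (mem_closedBall_zero_iff.1 u.2) (mem_closedBall_zero_iff.1 v.2)
  obtain ⟨u, -, hu, -⟩ := hcontr.exists_fixedPoint' Metric.isClosed_closedBall.isComplete hmaps
    (x := 0) (by simpa using hR0) (edist_ne_top _ _)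
  refine ⟨u, ?_⟩
  have h1 : u - t • (T u - y) = u := hu
  have h2 : t • (T u - y) = 0 := by simpa using h1
  have h3 := (smul_eq_zero.1 h2).resolve_left ht0.ne'
  exact sub_eq_zero.1 h3

variable {n d N : ℕ} {f : Vec n → Fin N → Vec n} {g : Vec n → Fin N → Matrix (Fin n) (Fin d) ℝ}
  {a : Fin N → ℝ} {q : ℝ} {ν : Fin N → ℝ} {l₁ Δ : ℝ}

/-- The squared distance `|x - y|² + Δ |g(x, i) - g(y, i)|²`. -/
def sqDist (g : Vec n → Fin N → Matrix (Fin n) (Fin d) ℝ) (Δ : ℝ) (x y : Vec n) (i : Fin N) : ℝ :=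
  ‖x - y‖ ^ 2 + Δ * hsNorm (g x i - g y i) ^ 2

lemma abs_le_maxAbs (ν : Fin N → ℝ) (i : Fin N) : |ν i| ≤ maxAbs ν :=
  le_ciSup (f := fun i => |ν i|) (Set.finite_range _).bddAbove i

lemma maxAbs_nonneg (ν : Fin N → ℝ) : 0 ≤ maxAbs ν := Real.iSup_nonneg fun _ => abs_nonneg _

lemma abs_mul_step_lt_one (hΔ : 0 < Δ) (hΔ' : Δ < 1 / (maxAbs ν + 2)) (i : Fin N) :
    |ν i * Δ| < 1 := by
  have h0 := maxAbs_nonneg ν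
  rw [lt_div_iff₀ (by linarith)] at hΔ'
  rw [abs_mul, abs_of_pos hΔ]
  have := mul_le_mul_of_nonneg_right (abs_le_maxAbs ν i) hΔ.le
  nlinarith

lemma step_lt_one (hΔ' : Δ < 1 / (maxAbs ν + 2)) : Δ < 1 := by
  refine hΔ'.trans ?_
  have h0 := maxAbs_nonneg ν
  rw [div_lt_one (by linarith)]
  linarith

lemma surjective_sub_smul (h1 : PolynomialLipschitz f g a q) (h2 : KhasminskiiMonotone f g ν l₁)
    (hΔ : 0 < Δ) (hΔ' : Δ < 1 / (maxAbs ν + 2)) (i : Fin N) :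
    Function.Surjective fun u => u - Δ • f u i := by
  obtain ⟨hf, hg, ha, hq, hlip⟩ := h1
  obtain ⟨hl, hmono⟩ := h2
  have hν := (abs_lt.1 (abs_mul_step_lt_one (ν := ν) hΔ hΔ' i)).2
  -- The monotonicity constant is 1 - ν_iΔ/2, which exceeds 1/2 because ν_iΔ < 1.
  refine surjective_of_strongly_monotone (c := 1 / 2) (by norm_num) (fun u v => ?_) (fun R => ?_)
  · have e : (u - Δ • f u i) - (v - Δ • f v i) = (u - v) - Δ • (f u i - f v i) := by
      rw [smul_sub]; abel
    rw [e, inner_sub_right, inner_smul_right, real_inner_self_eq_norm_sq]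
    have h := hmono u v i
    have h3 : 0 ≤ l₁ * hsNorm (g u i - g v i) ^ 2 := by
      have : 0 < l₁ := by linarith
      positivity
    have h4 : 2 * inner ℝ (u - v) (f u i - f v i) ≤ ν i * ‖u - v‖ ^ 2 := by linarith
    have h5 := mul_le_mul_of_nonneg_left h4 hΔ.le
    have h6 := mul_le_mul_of_nonneg_right hν.le (sq_nonneg ‖u - v‖)
    nlinarith
  · set R' := max R 0 with hR'
    refine ⟨1 + Δ * Real.sqrt (a i * (1 + R' ^ (q - 2) + R' ^ (q - 2))), fun u v hu hv => ?_⟩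
    have e : (u - Δ • f u i) - (v - Δ • f v i) = (u - v) - Δ • (f u i - f v i) := by
      rw [smul_sub]; abel
    have h3 : ‖f u i - f v i‖ ≤
        Real.sqrt (a i * (1 + R' ^ (q - 2) + R' ^ (q - 2))) * ‖u - v‖ := by
      have hR0 : 0 ≤ R' := le_max_right _ _
      have hrp := Real.rpow_nonneg hR0 (q - 2)
      refine le_of_sq_le_sq ?_ (by positivity)
      rw [mul_pow, Real.sq_sqrt (mul_nonneg (ha i).le (by linarith))]
      refine ((le_max_left _ _).trans (hlip u v i)).trans ?_
      have hai := (ha i).le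
      have hq' : 0 ≤ q - 2 := by linarith
      gcongr
      · exact hu.trans (le_max_left _ _)
      · exact hv.trans (le_max_left _ _)
    rw [e]
    calc _ ≤ ‖u - v‖ + ‖Δ • (f u i - f v i)‖ := norm_sub_le _ _
      _ ≤ ‖u - v‖ + Δ * (Real.sqrt (a i * (1 + R' ^ (q - 2) + R' ^ (q - 2))) * ‖u - v‖) := by
          rw [norm_smul, Real.norm_of_nonneg hΔ.le]; gcongr
      _ = _ := by ring

/-- The implicit step contracts the squared distance up to the factor `1 - ν_i Δ`. -/
lemma mul_sqDist_le (h2 : KhasminskiiMonotone f g ν l₁)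
    (hΔ : 0 < Δ) (hΔ' : Δ < 1 / (maxAbs ν + 2)) (i : Fin N) (u v : Vec n) :
    (1 - ν i * Δ) * sqDist g Δ u v i ≤ ‖(u - Δ • f u i) - (v - Δ • f v i)‖ ^ 2 := by
  obtain ⟨hl, hmono⟩ := h2
  have hν := (abs_lt.1 (abs_mul_step_lt_one (ν := ν) hΔ hΔ' i))
  have e : (u - Δ • f u i) - (v - Δ • f v i) = (u - v) - Δ • (f u i - f v i) := by
    rw [smul_sub]; abel
  rw [e, norm_sub_sq_real, inner_smul_right, sqDist]
  have h := mul_le_mul_of_nonneg_left (hmono u v i) hΔ.le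
  -- The diffusion part of the distance is paid for by l₁, since 1 - ν_iΔ < 2 < l₁.
  have h3 : (1 - ν i * Δ) * (Δ * hsNorm (g u i - g v i) ^ 2) ≤
      l₁ * (Δ * hsNorm (g u i - g v i) ^ 2) := by
    gcongr; linarith
  nlinarith [sq_nonneg ‖Δ • (f u i - f v i)‖]

lemma injective_sub_smul (h2 : KhasminskiiMonotone f g ν l₁)
    (hΔ : 0 < Δ) (hΔ' : Δ < 1 / (maxAbs ν + 2)) (i : Fin N) :
    Function.Injective fun u => u - Δ • f u i := by
  intro u v huv
  have h := mul_sqDist_le h2 hΔ hΔ' i u v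
  rw [sub_eq_zero.2 huv, norm_zero, zero_pow two_ne_zero] at h
  have hν := (abs_lt.1 (abs_mul_step_lt_one (ν := ν) hΔ hΔ' i)).2
  have h3 : sqDist g Δ u v i ≤ 0 := by
    by_contra hh
    push Not at hh
    nlinarith
  have h4 : ‖u - v‖ ^ 2 ≤ 0 := by
    have : 0 ≤ Δ * hsNorm (g u i - g v i) ^ 2 := by positivity
    unfold sqDist at h3
    linarith
  have h5 : ‖u - v‖ = 0 := by nlinarith [norm_nonneg (u - v)]
  exact sub_eq_zero.1 (norm_eq_zero.1 h5)

lemma implicitSolve_spec (h1 : PolynomialLipschitz f g a q) (h2 : KhasminskiiMonotone f g ν l₁)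
    (hΔ : 0 < Δ) (hΔ' : Δ < 1 / (maxAbs ν + 2)) (i : Fin N) (y : Vec n) :
    implicitSolve f Δ i y - Δ • f (implicitSolve f Δ i y) i = y :=
  Function.rightInverse_invFun (surjective_sub_smul h1 h2 hΔ hΔ' i) y

lemma implicitSolve_eq (h2 : KhasminskiiMonotone f g ν l₁)
    (hΔ : 0 < Δ) (hΔ' : Δ < 1 / (maxAbs ν + 2)) (i : Fin N) (u : Vec n) :
    implicitSolve f Δ i (u - Δ • f u i) = u :=
  Function.leftInverse_invFun (injective_sub_smul h2 hΔ hΔ' i) u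

lemma sqDist_implicitSolve_le (h1 : PolynomialLipschitz f g a q)
    (h2 : KhasminskiiMonotone f g ν l₁) (hΔ : 0 < Δ) (hΔ' : Δ < 1 / (maxAbs ν + 2)) (i : Fin N)
    (y y' : Vec n) :
    sqDist g Δ (implicitSolve f Δ i y) (implicitSolve f Δ i y') i ≤
      (1 - ν i * Δ)⁻¹ * ‖y - y'‖ ^ 2 := by
  have h := mul_sqDist_le h2 hΔ hΔ' i (implicitSolve f Δ i y) (implicitSolve f Δ i y')
  rw [implicitSolve_spec h1 h2 hΔ hΔ', implicitSolve_spec h1 h2 hΔ hΔ'] at h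
  have hν := (abs_lt.1 (abs_mul_step_lt_one (ν := ν) hΔ hΔ' i)).2
  rw [inv_mul_eq_div, le_div_iff₀ (by linarith)]
  linarith

lemma sqDist_nonneg (g : Vec n → Fin N → Matrix (Fin n) (Fin d) ℝ) (hΔ : 0 < Δ) (x y : Vec n)
    (i : Fin N) : 0 ≤ sqDist g Δ x y i := by
  unfold sqDist; positivity

lemma norm_sq_le_sqDist (g : Vec n → Fin N → Matrix (Fin n) (Fin d) ℝ) (hΔ : 0 < Δ) (x y : Vec n)
    (i : Fin N) : ‖x - y‖ ^ 2 ≤ sqDist g Δ x y i := by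
  have : 0 ≤ Δ * hsNorm (g x i - g y i) ^ 2 := by positivity
  unfold sqDist; linarith

lemma continuous_implicitSolve (h1 : PolynomialLipschitz f g a q)
    (h2 : KhasminskiiMonotone f g ν l₁) (hΔ : 0 < Δ) (hΔ' : Δ < 1 / (maxAbs ν + 2)) (i : Fin N) :
    Continuous (implicitSolve f Δ i) := by
  have hν := (abs_lt.1 (abs_mul_step_lt_one (ν := ν) hΔ hΔ' i)).2
  have hc : 0 ≤ (1 - ν i * Δ)⁻¹ := inv_nonneg.2 (by linarith)
  refine (LipschitzWith.of_dist_le_mul (K := ⟨Real.sqrt ((1 - ν i * Δ)⁻¹), Real.sqrt_nonneg _⟩)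
    fun y y' => ?_).continuous
  rw [dist_eq_norm, dist_eq_norm]
  refine le_of_sq_le_sq ?_ (mul_nonneg (NNReal.coe_nonneg _) (norm_nonneg _))
  rw [mul_pow]
  change _ ≤ Real.sqrt _ ^ 2 * _
  rw [Real.sq_sqrt hc]
  exact (norm_sq_le_sqDist g hΔ _ _ i).trans (sqDist_implicitSolve_le h1 h2 hΔ hΔ' i y y')

lemma hsNorm_sq (A : Matrix (Fin n) (Fin d) ℝ) : hsNorm A ^ 2 = ∑ i, ∑ j, A i j ^ 2 :=
  Real.sq_sqrt (Finset.sum_nonneg fun _ _ => Finset.sum_nonneg fun _ _ => sq_nonneg _)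

lemma sqDist_le_two_mul (g : Vec n → Fin N → Matrix (Fin n) (Fin d) ℝ) (hΔ : 0 < Δ)
    (x y z : Vec n) (i : Fin N) :
    sqDist g Δ x y i ≤ 2 * (sqDist g Δ x z i + sqDist g Δ y z i) := by
  have h1 : ‖x - y‖ ^ 2 ≤ 2 * (‖x - z‖ ^ 2 + ‖y - z‖ ^ 2) := by
    have e : x - y = (x - z) - (y - z) := by abel
    have := norm_sub_le (x - z) (y - z)
    rw [← e] at this
    nlinarith [sq_nonneg (‖x - z‖ - ‖y - z‖), norm_nonneg (x - y)]
  have h2 : hsNorm (g x i - g y i) ^ 2 ≤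
      2 * (hsNorm (g x i - g z i) ^ 2 + hsNorm (g y i - g z i) ^ 2) := by
    simp only [hsNorm_sq, ← Finset.sum_add_distrib, Finset.mul_sum]
    refine Finset.sum_le_sum fun k _ => Finset.sum_le_sum fun l _ => ?_
    simp only [Matrix.sub_apply]
    nlinarith [sq_nonneg (g x i k l - g z i k l + (g y i k l - g z i k l))]
  unfold sqDist
  nlinarith [mul_le_mul_of_nonneg_left h2 hΔ.le]

lemma measurable_hsNorm_comp {Ω : Type*} [MeasurableSpace Ω] {A : Ω → Matrix (Fin n) (Fin d) ℝ}
    (hA : ∀ i j, Measurable fun ω => A ω i j) : Measurable fun ω => hsNorm (A ω) := by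
  unfold hsNorm
  exact (Finset.measurable_sum _ fun i _ => Finset.measurable_sum _ fun j _ =>
    (hA i j).pow_const 2).sqrt

end Implicit

/-! ### Gaussian moments -/

section Gaussian

variable {n d : ℕ}

lemma toEuclideanLin_apply_coord (A : Matrix (Fin n) (Fin d) ℝ) (ξ : Vec d) (i : Fin n) :
    Matrix.toEuclideanLin A ξ i = inner ℝ (WithLp.toLp 2 (A i) : Vec d) ξ := by
  simp [Matrix.toEuclideanLin, Matrix.mulVec, dotProduct, PiLp.inner_apply, mul_comm]

lemma integral_inner_stdGaussian (v : Vec d) : ∫ ξ, inner ℝ v ξ ∂stdGaussian (Vec d) = 0 :=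
  integral_strongDual_stdGaussian (innerSL ℝ v)

lemma memLp_inner_stdGaussian (v : Vec d) :
    MemLp (fun ξ => inner ℝ v ξ) 2 (stdGaussian (Vec d)) :=
  (IsGaussian.memLp_two_id (μ := stdGaussian (Vec d))).const_inner v

lemma integral_inner_sq_stdGaussian (v : Vec d) :
    ∫ ξ, inner ℝ v ξ ^ 2 ∂stdGaussian (Vec d) = ‖v‖ ^ 2 := by
  have h : Var[fun ξ => inner ℝ v ξ; stdGaussian (Vec d)] = ‖innerSL ℝ v‖ ^ 2 :=
    variance_dual_stdGaussian (E := Vec d) (innerSL ℝ v)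
  rw [variance_eq_sub (memLp_inner_stdGaussian v), innerSL_apply_norm] at h
  rw [integral_inner_stdGaussian v] at h
  simpa using h

/-- The cross terms have mean zero, and the identity covariance turns the noise into the
Hilbert–Schmidt norm. Applied to differences, the right-hand side is `sqDist`. -/
lemma lintegral_norm_add_sq_stdGaussian (x : Vec n) (A : Matrix (Fin n) (Fin d) ℝ) {Δ : ℝ}
    (hΔ : 0 ≤ Δ) :
    ∫⁻ ξ, ENNReal.ofReal (‖x + Matrix.toEuclideanLin A (Real.sqrt Δ • ξ)‖ ^ 2) ∂stdGaussian (Vec d)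
      = ENNReal.ofReal (‖x‖ ^ 2 + Δ * hsNorm A ^ 2) := by
  set v : Fin n → Vec d := fun i => WithLp.toLp 2 (A i) with hv
  have e : ∀ ξ : Vec d, ‖x + Matrix.toEuclideanLin A (Real.sqrt Δ • ξ)‖ ^ 2 =
      ∑ i, (x i ^ 2 + 2 * Real.sqrt Δ * x i * inner ℝ (v i) ξ + Δ * inner ℝ (v i) ξ ^ 2) := by
    intro ξ
    rw [EuclideanSpace.real_norm_sq_eq]
    refine Finset.sum_congr rfl fun i _ => ?_
    rw [map_smul, PiLp.add_apply, PiLp.smul_apply, toEuclideanLin_apply_coord, smul_eq_mul]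
    have := Real.sq_sqrt hΔ
    simp only [hv]
    linear_combination (inner ℝ (WithLp.toLp 2 (A i) : Vec d) ξ) ^ 2 * this
  have hint1 : ∀ i, Integrable (fun ξ => inner ℝ (v i) ξ) (stdGaussian (Vec d)) := fun i =>
    (memLp_inner_stdGaussian (v i)).integrable one_le_two
  have hint2 : ∀ i, Integrable (fun ξ => inner ℝ (v i) ξ ^ 2) (stdGaussian (Vec d)) := fun i =>
    (memLp_inner_stdGaussian (v i)).integrable_sq
  have hintA : ∀ i, Integrable (fun ξ => x i ^ 2 + 2 * Real.sqrt Δ * x i * inner ℝ (v i) ξ)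
      (stdGaussian (Vec d)) := fun i => (integrable_const _).add ((hint1 i).const_mul _)
  have hint : ∀ i, Integrable (fun ξ => x i ^ 2 + 2 * Real.sqrt Δ * x i * inner ℝ (v i) ξ +
      Δ * inner ℝ (v i) ξ ^ 2) (stdGaussian (Vec d)) := fun i =>
    (hintA i).add ((hint2 i).const_mul _)
  rw [← ofReal_integral_eq_lintegral_ofReal]
  · congr 1
    simp_rw [e]
    rw [integral_finsetSum _ fun i _ => hint i, EuclideanSpace.real_norm_sq_eq, hsNorm_sq,
      Finset.mul_sum, ← Finset.sum_add_distrib]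
    refine Finset.sum_congr rfl fun i _ => ?_
    rw [integral_add (hintA i) ((hint2 i).const_mul _),
      integral_add (integrable_const _) ((hint1 i).const_mul _), integral_const_mul,
      integral_const_mul, integral_inner_stdGaussian, integral_inner_sq_stdGaussian,
      EuclideanSpace.real_norm_sq_eq]
    simp [hv]
  · simp_rw [e]
    exact integrable_finsetSum _ fun i _ => hint i
  · exact .of_forall fun ξ => by positivity

/-- Monotonicity of L^p norms on a probability space reduces the p-th moment to the second one. -/
lemma lintegral_norm_add_rpow_stdGaussian_le (x : Vec n) (A : Matrix (Fin n) (Fin d) ℝ) {Δ p : ℝ}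
    (hΔ : 0 ≤ Δ) (hp : 0 < p) (hp2 : p ≤ 2) :
    ∫⁻ ξ, ENNReal.ofReal (‖x + Matrix.toEuclideanLin A (Real.sqrt Δ • ξ)‖ ^ p) ∂stdGaussian (Vec d)
      ≤ ENNReal.ofReal ((‖x‖ ^ 2 + Δ * hsNorm A ^ 2) ^ (p / 2)) := by
  set Y : Vec d → Vec n := fun ξ => x + Matrix.toEuclideanLin A (Real.sqrt Δ • ξ) with hY
  have hYm : AEStronglyMeasurable Y (stdGaussian (Vec d)) := by
    have : Continuous Y := by
      have := LinearMap.continuous_of_finiteDimensional (Matrix.toEuclideanLin A)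
      fun_prop
    exact this.aestronglyMeasurable
  have h := eLpNorm'_le_eLpNorm'_of_exponent_le hp hp2 (stdGaussian (Vec d)) hYm
  rw [eLpNorm', eLpNorm'] at h
  have h2 : ∫⁻ ξ, ‖Y ξ‖ₑ ^ (2 : ℝ) ∂stdGaussian (Vec d) =
      ENNReal.ofReal (‖x‖ ^ 2 + Δ * hsNorm A ^ 2) := by
    rw [← lintegral_norm_add_sq_stdGaussian x A hΔ]
    refine lintegral_congr fun ξ => ?_
    rw [← ofReal_norm, ENNReal.ofReal_rpow_of_nonneg (norm_nonneg _) (by norm_num),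
      Real.rpow_two]
  rw [h2] at h
  have h3 := ENNReal.rpow_le_rpow h hp.le
  rw [← ENNReal.rpow_mul, one_div_mul_cancel hp.ne', ENNReal.rpow_one, ← ENNReal.rpow_mul,
    one_div_mul_eq_div, ENNReal.ofReal_rpow_of_nonneg (by positivity) (by positivity)] at h3
  refine le_trans (le_of_eq ?_) h3
  refine lintegral_congr fun ξ => ?_
  rw [← ofReal_norm, ENNReal.ofReal_rpow_of_nonneg (norm_nonneg _) hp.le]

end Gaussian

/-! ### The scheme as a random map -/

section Scheme

variable {n d N : ℕ} {f : Vec n → Fin N → Vec n} {g : Vec n → Fin N → Matrix (Fin n) (Fin d) ℝ}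
  {Γ : Matrix (Fin N) (Fin N) ℝ}
  {a : Fin N → ℝ} {q : ℝ} {ν : Fin N → ℝ} {l₁ Δ : ℝ}

/-- The law of the next switching state. -/
def switchLaw (Γ : Matrix (Fin N) (Fin N) ℝ) (Δ : ℝ) (i : Fin N) : Measure (Fin N) :=
  ∑ j, ENNReal.ofReal (stepMatrix Γ Δ i j) • Measure.dirac j

/-- The law of the noise of one step: an independent successor for every switching state, and an
independent standard Gaussian vector. -/
def noiseLaw (d : ℕ) (Γ : Matrix (Fin N) (Fin N) ℝ) (Δ : ℝ) :
    Measure ((Fin N → Fin N) × Vec d) :=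
  (Measure.pi (switchLaw Γ Δ)).prod (stdGaussian (Vec d))

/-- The position reached from `z` when the next switching state is `j` and the Gaussian noise
is `ξ`. -/
def nextPos (f : Vec n → Fin N → Vec n) (g : Vec n → Fin N → Matrix (Fin n) (Fin d) ℝ) (Δ : ℝ)
    (j : Fin N) (z : Vec n × Fin N) (ξ : Vec d) : Vec n :=
  implicitSolve f Δ j (z.1 + Matrix.toEuclideanLin (g z.1 z.2) (Real.sqrt Δ • ξ))

/-- The random map driving the scheme. -/
def bemMap (f : Vec n → Fin N → Vec n) (g : Vec n → Fin N → Matrix (Fin n) (Fin d) ℝ) (Δ : ℝ)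
    (e : (Fin N → Fin N) × Vec d) (z : Vec n × Fin N) : Vec n × Fin N :=
  (nextPos f g Δ (e.1 z.2) z e.2, e.1 z.2)

lemma isProbabilityMeasure_switchLaw (hΓ : IsGenerator Γ) (hΔ : 0 < Δ) (i : Fin N) :
    IsProbabilityMeasure (switchLaw Γ Δ i) := by
  constructor
  simp only [switchLaw, Measure.coe_finsetSum, Measure.coe_smul, Finset.sum_apply, Pi.smul_apply,
    measure_univ, smul_eq_mul, mul_one]
  rw [← ENNReal.ofReal_sum_of_nonneg fun j _ => stepMatrix_nonneg hΓ hΔ.le i j,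
    sum_stepMatrix hΓ, ENNReal.ofReal_one]

lemma isProbabilityMeasure_noiseLaw (d : ℕ) (hΓ : IsGenerator Γ) (hΔ : 0 < Δ) :
    IsProbabilityMeasure (noiseLaw d Γ Δ) := by
  have := isProbabilityMeasure_switchLaw hΓ hΔ
  unfold noiseLaw
  infer_instance

/-- Only the successor of `i` enters, and its marginal is row `i` of the transition matrix. -/
lemma lintegral_noiseLaw (hΓ : IsGenerator Γ) (hΔ : 0 < Δ) (i : Fin N)
    {H : Fin N → Vec d → ℝ≥0∞} (hH : ∀ j, Measurable (H j)) :
    ∫⁻ e, H (e.1 i) e.2 ∂noiseLaw d Γ Δ =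
      ∑ j, ENNReal.ofReal (stepMatrix Γ Δ i j) * ∫⁻ ξ, H j ξ ∂stdGaussian (Vec d) := by
  have := isProbabilityMeasure_switchLaw hΓ hΔ
  have hm : Measurable fun e : (Fin N → Fin N) × Vec d => H (e.1 i) e.2 :=
    measurable_from_prod_countable_right fun τ => hH (τ i)
  rw [noiseLaw, lintegral_prod _ hm.aemeasurable]
  have h := (measurePreserving_eval (switchLaw Γ Δ) i).lintegral_comp
    (f := fun j => ∫⁻ ξ, H j ξ ∂stdGaussian (Vec d)) .of_discrete
  simp only [Function.eval] at h
  rw [h, switchLaw, lintegral_finsetSum_measure]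
  simp

lemma continuous_add_toEuclideanLin (hg : ∀ i, Continuous fun x => g x i) (i : Fin N) :
    Continuous fun p : Vec n × Vec d =>
      p.1 + Matrix.toEuclideanLin (g p.1 i) (Real.sqrt Δ • p.2) := by
  refine continuous_fst.add ?_
  have h1 : Continuous fun p : Vec n × Vec d =>
      (g p.1 i).mulVec (WithLp.ofLp (Real.sqrt Δ • p.2)) :=
    ((hg i).comp continuous_fst).matrix_mulVec
      ((PiLp.continuous_ofLp 2 _).comp (by fun_prop))
  exact (PiLp.continuous_toLp 2 _).comp h1

lemma continuous_nextPos (h1 : PolynomialLipschitz f g a q)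
    (h2 : KhasminskiiMonotone f g ν l₁) (hΔ : 0 < Δ) (hΔ' : Δ < 1 / (maxAbs ν + 2))
    (i j : Fin N) : Continuous fun p : Vec n × Vec d => nextPos f g Δ j (p.1, i) p.2 :=
  (continuous_implicitSolve h1 h2 hΔ hΔ' j).comp (continuous_add_toEuclideanLin h1.2.1 i)

lemma measurable_bemMap (h1 : PolynomialLipschitz f g a q)
    (h2 : KhasminskiiMonotone f g ν l₁) (hΔ : 0 < Δ) (hΔ' : Δ < 1 / (maxAbs ν + 2)) :
    Measurable (Function.uncurry (bemMap f g Δ)) := by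
  -- Grouping the finitely many discrete values together reduces joint measurability to continuity
  -- in position and noise.
  have h : Measurable fun p : ((Fin N → Fin N) × Fin N) × (Vec n × Vec d) =>
      ((nextPos f g Δ (p.1.1 p.1.2) (p.2.1, p.1.2) p.2.2, p.1.1 p.1.2) : Vec n × Fin N) :=
    measurable_from_prod_countable_right fun τi => by
      have hc := (continuous_nextPos h1 h2 hΔ hΔ' τi.2 (τi.1 τi.2)).measurable
      exact hc.prodMk (measurable_const (a := τi.1 τi.2))
  exact h.comp (f := fun p : ((Fin N → Fin N) × Vec d) × (Vec n × Fin N) =>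
    ((p.1.1, p.2.2), (p.2.1, p.1.2))) (by fun_prop)

lemma continuous_bemMap (h1 : PolynomialLipschitz f g a q)
    (h2 : KhasminskiiMonotone f g ν l₁) (hΔ : 0 < Δ) (hΔ' : Δ < 1 / (maxAbs ν + 2))
    (e : (Fin N → Fin N) × Vec d) : Continuous (bemMap f g Δ e) := by
  rw [continuous_prod_of_discrete_right]
  intro i
  have h : Continuous fun x : Vec n => nextPos f g Δ (e.1 i) (x, i) e.2 :=
    (continuous_nextPos h1 h2 hΔ hΔ' i (e.1 i)).comp (continuous_id.prodMk continuous_const)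
  exact h.prodMk (continuous_const (y := e.1 i))

lemma measurable_nextPos_right (h1 : PolynomialLipschitz f g a q)
    (h2 : KhasminskiiMonotone f g ν l₁) (hΔ : 0 < Δ) (hΔ' : Δ < 1 / (maxAbs ν + 2)) (j : Fin N)
    (z : Vec n × Fin N) : Measurable (nextPos f g Δ j z) :=
  ((continuous_nextPos h1 h2 hΔ hΔ' z.2 j).comp
    (continuous_const.prodMk continuous_id)).measurable

lemma measurable_bemMap_left (h1 : PolynomialLipschitz f g a q)
    (h2 : KhasminskiiMonotone f g ν l₁) (hΔ : 0 < Δ) (hΔ' : Δ < 1 / (maxAbs ν + 2))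
    (z : Vec n × Fin N) : Measurable fun e => bemMap f g Δ e z :=
  (measurable_bemMap h1 h2 hΔ hΔ').comp (measurable_id.prodMk measurable_const)

/-- The kernel from one state sees a single coordinate of the successor map. The independence
between different coordinates is therefore a free choice, which matters only for the coupling. -/
lemma map_bemMap_eq_bemStep (hΓ : IsGenerator Γ) (h1 : PolynomialLipschitz f g a q)
    (h2 : KhasminskiiMonotone f g ν l₁) (hΔ : 0 < Δ) (hΔ' : Δ < 1 / (maxAbs ν + 2))
    (z : Vec n × Fin N) :
    (noiseLaw d Γ Δ).map (fun e => bemMap f g Δ e z) = bemStep f g Γ Δ z := by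
  have hm := measurable_bemMap_left h1 h2 hΔ hΔ' z
  have hm' : ∀ j, Measurable fun ξ => (nextPos f g Δ j z ξ, j) := fun j =>
    (measurable_nextPos_right h1 h2 hΔ hΔ' j z).prodMk measurable_const
  refine Measure.ext_of_lintegral _ fun φ hφ => ?_
  rw [lintegral_map hφ hm]
  have h := lintegral_noiseLaw (d := d) hΓ hΔ z.2
    (H := fun j ξ => φ (nextPos f g Δ j z ξ, j)) fun j => hφ.comp (hm' j)
  simp only [bemMap]
  rw [h, bemStep, lintegral_finsetSum_measure]
  refine Finset.sum_congr rfl fun j _ => ?_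
  rw [lintegral_smul_measure, smul_eq_mul]
  congr 1
  exact (lintegral_map hφ (hm' j)).symm

/-- The Lyapunov function of the scheme. -/
def lyap (g : Vec n → Fin N → Matrix (Fin n) (Fin d) ℝ) (Δ p : ℝ) (h : Fin N → ℝ)
    (z : Vec n × Fin N) : ℝ :=
  h z.2 * sqDist g Δ z.1 0 z.2 ^ (p / 2)

/-- The cost function contracted by the synchronous coupling of the scheme. -/
def cost (g : Vec n → Fin N → Matrix (Fin n) (Fin d) ℝ) (Δ p : ℝ) (h : Fin N → ℝ) (R : ℝ)
    (zw : (Vec n × Fin N) × (Vec n × Fin N)) : ℝ :=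
  if zw.1.2 = zw.2.2 then h zw.1.2 * sqDist g Δ zw.1.1 zw.2.1 zw.1.2 ^ (p / 2)
  else 2 * lyap g Δ p h zw.1 + 2 * lyap g Δ p h zw.2 + R

lemma measurable_sqDist (hg : ∀ i, Continuous fun x => g x i) (i : Fin N) :
    Measurable fun p : Vec n × Vec n => sqDist g Δ p.1 p.2 i := by
  unfold sqDist
  have h : Measurable fun p : Vec n × Vec n => hsNorm (g p.1 i - g p.2 i) := by
    refine measurable_hsNorm_comp fun k l => ?_
    have e := (hg i).matrix_elem k l
    exact ((e.comp continuous_fst).sub (e.comp continuous_snd)).measurable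
  fun_prop

lemma measurable_lyap (hg : ∀ i, Continuous fun x => g x i) (p : ℝ) (h : Fin N → ℝ) :
    Measurable (lyap g Δ p h) := by
  refine measurable_from_prod_countable_left fun i => ?_
  have : Measurable fun x : Vec n => sqDist g Δ x 0 i :=
    Measurable.comp (g := fun p : Vec n × Vec n => sqDist g Δ p.1 p.2 i)
      (f := fun x => (x, (0 : Vec n))) (measurable_sqDist hg i) (by fun_prop)
  exact (this.pow_const (p / 2)).const_mul (h i)

lemma measurable_cost (hg : ∀ i, Continuous fun x => g x i) (p : ℝ) (h : Fin N → ℝ) (R : ℝ) :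
    Measurable (cost g Δ p h R) := by
  refine Measurable.ite ?_ ?_ ?_
  · exact measurableSet_eq_fun (by fun_prop) (by fun_prop)
  · have h1 : Measurable fun p' : Fin N × (Vec n × Vec n) =>
        h p'.1 * sqDist g Δ p'.2.1 p'.2.2 p'.1 ^ (p / 2) :=
      measurable_from_prod_countable_right fun i =>
        ((measurable_sqDist hg i).pow_const (p / 2)).const_mul (h i)
    exact h1.comp (f := fun zw : (Vec n × Fin N) × (Vec n × Fin N) =>
      (zw.1.2, (zw.1.1, zw.2.1))) (by fun_prop)
  · have h1 := measurable_lyap (Δ := Δ) hg p h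
    exact (((h1.comp measurable_fst).const_mul 2).add
      ((h1.comp measurable_snd).const_mul 2)).add_const R

/-- The exponential bound on the contraction factor of the implicit step. -/
lemma inv_rpow_le_exp (hΔ : 0 < Δ) (hΔ' : Δ < 1 / (maxAbs ν + 2)) (j : Fin N) {s : ℝ}
    (hs : 0 < s) :
    ((1 - ν j * Δ)⁻¹) ^ s ≤ Real.exp (s * Δ * (ν j / (1 - ν j / (maxAbs ν + 2)))) := by
  have hν := (abs_lt.1 (abs_mul_step_lt_one (ν := ν) hΔ hΔ' j)).2
  have hpos : 0 < 1 - ν j * Δ := by linarith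
  have hM := maxAbs_nonneg ν
  have hle := (le_abs_self _).trans (abs_le_maxAbs ν j)
  have hpos' : 0 < 1 - ν j / (maxAbs ν + 2) := by
    rw [sub_pos, div_lt_one (by linarith)]; linarith
  rw [← Real.exp_log (Real.rpow_pos_of_pos (inv_pos.2 hpos) s), Real.exp_le_exp,
    Real.log_rpow (inv_pos.2 hpos), mul_assoc]
  refine mul_le_mul_of_nonneg_left ?_ hs.le
  have h1 := Real.log_le_sub_one_of_pos (inv_pos.2 hpos)
  have h2 : (1 - ν j * Δ)⁻¹ - 1 = Δ * (ν j / (1 - ν j * Δ)) := by field_simp; ring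
  rw [h2] at h1
  refine h1.trans (mul_le_mul_of_nonneg_left ?_ hΔ.le)
  -- t ↦ ν/(1 - νt) is nondecreasing for either sign of ν, so Δ may be replaced by its upper bound
  -- 1/(n_M + 2).
  rw [div_le_div_iff₀ hpos hpos']
  have h3 : 0 ≤ ν j ^ 2 * (1 / (maxAbs ν + 2) - Δ) :=
    mul_nonneg (sq_nonneg _) (by linarith)
  have h4 : ν j / (maxAbs ν + 2) = ν j * (1 / (maxAbs ν + 2)) := by ring
  rw [h4]
  nlinarith

lemma sqDist_nextPos_rpow_le (h1 : PolynomialLipschitz f g a q)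
    (h2 : KhasminskiiMonotone f g ν l₁) (hΔ : 0 < Δ) (hΔ' : Δ < 1 / (maxAbs ν + 2))
    (j : Fin N) {p : ℝ} (hp : 0 < p) (y y' : Vec n) :
    sqDist g Δ (implicitSolve f Δ j y) (implicitSolve f Δ j y') j ^ (p / 2) ≤
      Real.exp (p / 2 * Δ * (ν j / (1 - ν j / (maxAbs ν + 2)))) * ‖y - y'‖ ^ p := by
  have hν := (abs_lt.1 (abs_mul_step_lt_one (ν := ν) hΔ hΔ' j)).2
  have h := Real.rpow_le_rpow (sqDist_nonneg g hΔ _ _ j)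
    (sqDist_implicitSolve_le h1 h2 hΔ hΔ' j y y') (half_pos hp).le
  refine h.trans ?_
  rw [Real.mul_rpow (inv_nonneg.2 (by linarith)) (sq_nonneg _), ← Real.rpow_natCast,
    ← Real.rpow_mul (norm_nonneg _)]
  have e : ((2 : ℕ) : ℝ) * (p / 2) = p := by push_cast; ring
  rw [e]
  gcongr
  exact inv_rpow_le_exp hΔ hΔ' j (half_pos hp)

/-- The data for which the weight `h` makes the weighted one-step operator contract by `1 - η`. -/
structure IsWeight (Γ : Matrix (Fin N) (Fin N) ℝ) (ν : Fin N → ℝ) (Δ p η : ℝ) (h : Fin N → ℝ) :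
    Prop where
  pos : 0 < η
  lt_one : η < 1
  bounds : ∀ i, 1 / 2 ≤ h i ∧ h i ≤ 3 / 2
  contract : ∀ i, ∑ j, stepMatrix Γ Δ i j *
    (Real.exp (p / 2 * Δ * (ν j / (1 - ν j / (maxAbs ν + 2)))) * h j) ≤ (1 - η) * h i

variable {p η : ℝ} {h : Fin N → ℝ}

lemma IsWeight.nonneg (hh : IsWeight Γ ν Δ p η h) (i : Fin N) : 0 ≤ h i := by
  have := (hh.bounds i).1
  linarith

/-- Conditioning on the next state leaves a Gaussian moment common to all states times an
exponential factor; averaging over the next state is then exactly the weighted row contraction. Both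
the coupling and the drift estimate use this. -/
lemma IsWeight.lintegral_le (hh : IsWeight Γ ν Δ p η h) (hΓ : IsGenerator Γ) (hΔ : 0 < Δ)
    (i : Fin N) {H : Fin N → Vec d → ℝ} (hH : ∀ j, Measurable (H j)) {Y : Vec d → ℝ}
    (hY : Measurable Y)
    (hle : ∀ j ξ, H j ξ ≤ Real.exp (p / 2 * Δ * (ν j / (1 - ν j / (maxAbs ν + 2)))) * Y ξ)
    {S : ℝ} (hS : 0 ≤ S) (hint : ∫⁻ ξ, ENNReal.ofReal (Y ξ) ∂stdGaussian (Vec d) ≤ ENNReal.ofReal S) :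
    ∫⁻ e, ENNReal.ofReal (h (e.1 i) * H (e.1 i) e.2) ∂noiseLaw d Γ Δ ≤
      ENNReal.ofReal ((1 - η) * h i * S) := by
  rw [lintegral_noiseLaw (d := d) hΓ hΔ i (H := fun j ξ => ENNReal.ofReal (h j * H j ξ))
    fun j => ((hH j).const_mul _).ennreal_ofReal]
  have key : ∀ j, ∫⁻ ξ, ENNReal.ofReal (h j * H j ξ) ∂stdGaussian (Vec d) ≤
      ENNReal.ofReal ((Real.exp (p / 2 * Δ * (ν j / (1 - ν j / (maxAbs ν + 2)))) * h j) * S) := by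
    intro j
    have hE : 0 ≤ Real.exp (p / 2 * Δ * (ν j / (1 - ν j / (maxAbs ν + 2)))) * h j :=
      mul_nonneg (Real.exp_pos _).le (hh.nonneg j)
    calc _ ≤ ∫⁻ ξ, ENNReal.ofReal (Real.exp (p / 2 * Δ * (ν j / (1 - ν j / (maxAbs ν + 2)))) * h j) *
          ENNReal.ofReal (Y ξ) ∂stdGaussian (Vec d) := by
          refine lintegral_mono fun ξ => ?_
          rw [← ENNReal.ofReal_mul hE]
          refine ENNReal.ofReal_le_ofReal ?_
          calc _ ≤ h j * _ := mul_le_mul_of_nonneg_left (hle j ξ) (hh.nonneg j)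
            _ = _ := by ring
      _ ≤ _ := by
          rw [lintegral_const_mul _ hY.ennreal_ofReal, ENNReal.ofReal_mul hE]
          gcongr
  calc _ ≤ ∑ j, ENNReal.ofReal (stepMatrix Γ Δ i j) *
        ENNReal.ofReal ((Real.exp (p / 2 * Δ * (ν j / (1 - ν j / (maxAbs ν + 2)))) * h j) * S) := by
        gcongr with j _
        exact key j
    _ = ENNReal.ofReal ((∑ j, stepMatrix Γ Δ i j *
        (Real.exp (p / 2 * Δ * (ν j / (1 - ν j / (maxAbs ν + 2)))) * h j)) * S) := by
        rw [Finset.sum_mul, ENNReal.ofReal_sum_of_nonneg]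
        · refine Finset.sum_congr rfl fun j _ => ?_
          rw [← ENNReal.ofReal_mul (stepMatrix_nonneg hΓ hΔ.le i j), ← mul_assoc]
        · exact fun j _ => mul_nonneg (mul_nonneg (stepMatrix_nonneg hΓ hΔ.le i j)
            (mul_nonneg (Real.exp_pos _).le (hh.nonneg j))) hS
    _ ≤ _ := ENNReal.ofReal_le_ofReal (mul_le_mul_of_nonneg_right (hh.contract i) hS)

lemma measurable_norm_add_rpow (x : Vec n) (A : Matrix (Fin n) (Fin d) ℝ) (Δ p : ℝ) :
    Measurable fun ξ : Vec d => ‖x + Matrix.toEuclideanLin A (Real.sqrt Δ • ξ)‖ ^ p := by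
  have h := (LinearMap.continuous_of_finiteDimensional (Matrix.toEuclideanLin A)).measurable
  have h2 : Measurable fun ξ : Vec d => x + Matrix.toEuclideanLin A (Real.sqrt Δ • ξ) :=
    (h.comp (measurable_const_smul _)).const_add x
  exact h2.norm.pow_const p

/-- The synchronous coupling contracts while the switching states agree. -/
lemma lintegral_sqDist_bemMap_le (hh : IsWeight Γ ν Δ p η h) (hΓ : IsGenerator Γ)
    (h1 : PolynomialLipschitz f g a q) (h2 : KhasminskiiMonotone f g ν l₁) (hΔ : 0 < Δ)
    (hΔ' : Δ < 1 / (maxAbs ν + 2)) (hp : 0 < p) (hp1 : p ≤ 1) (i : Fin N) (x y : Vec n) :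
    ∫⁻ e, ENNReal.ofReal (h (e.1 i) *
      sqDist g Δ (nextPos f g Δ (e.1 i) (x, i) e.2) (nextPos f g Δ (e.1 i) (y, i) e.2) (e.1 i)
        ^ (p / 2)) ∂noiseLaw d Γ Δ ≤
      ENNReal.ofReal ((1 - η) * h i * sqDist g Δ x y i ^ (p / 2)) := by
  refine hh.lintegral_le hΓ hΔ i (H := fun j ξ =>
      sqDist g Δ (nextPos f g Δ j (x, i) ξ) (nextPos f g Δ j (y, i) ξ) j ^ (p / 2))
    (fun j => ?_) (measurable_norm_add_rpow (x - y) (g x i - g y i) Δ p) (fun j ξ => ?_)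
    (Real.rpow_nonneg (sqDist_nonneg g hΔ _ _ _) _)
    (lintegral_norm_add_rpow_stdGaussian_le _ _ hΔ.le hp (by linarith))
  · exact ((measurable_sqDist h1.2.1 j).comp ((measurable_nextPos_right h1 h2 hΔ hΔ' j _).prodMk
      (measurable_nextPos_right h1 h2 hΔ hΔ' j _))).pow_const _
  · have := sqDist_nextPos_rpow_le h1 h2 hΔ hΔ' j hp
      (x + Matrix.toEuclideanLin (g x i) (Real.sqrt Δ • ξ))
      (y + Matrix.toEuclideanLin (g y i) (Real.sqrt Δ • ξ))
    refine this.trans (le_of_eq ?_)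
    congr 3
    rw [map_sub, LinearMap.sub_apply]
    abel

/-- The additive constant of the drift condition. -/
def driftConst (f : Vec n → Fin N → Vec n) (g : Vec n → Fin N → Matrix (Fin n) (Fin d) ℝ)
    (Δ p : ℝ) : ℝ :=
  2 * ∑ i, ∑ j, (‖Δ • f 0 j‖ ^ 2 + Δ * hsNorm (g 0 i) ^ 2) ^ (p / 2)

lemma two_mul_sum_le_driftConst (f : Vec n → Fin N → Vec n)
    (g : Vec n → Fin N → Matrix (Fin n) (Fin d) ℝ) (hΔ : 0 < Δ) (p : ℝ) (i : Fin N) :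
    2 * ∑ j, (‖Δ • f 0 j‖ ^ 2 + Δ * hsNorm (g 0 i) ^ 2) ^ (p / 2) ≤ driftConst f g Δ p := by
  have h : ∀ i, 0 ≤ ∑ j, (‖Δ • f 0 j‖ ^ 2 + Δ * hsNorm (g 0 i) ^ 2) ^ (p / 2) := fun i =>
    Finset.sum_nonneg fun j _ => Real.rpow_nonneg (by positivity) _
  exact mul_le_mul_of_nonneg_left
    (Finset.single_le_sum (fun i _ => h i) (Finset.mem_univ i)) zero_le_two

end Scheme

/-! ### Drift condition and contraction of the synchronous coupling. -/

section Drift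

variable {n d N : ℕ} {f : Vec n → Fin N → Vec n} {g : Vec n → Fin N → Matrix (Fin n) (Fin d) ℝ}
  {Γ : Matrix (Fin N) (Fin N) ℝ}
  {a : Fin N → ℝ} {q : ℝ} {ν : Fin N → ℝ} {l₁ Δ : ℝ} {p η : ℝ} {h : Fin N → ℝ}

lemma IsWeight.lyap_nonneg (hh : IsWeight Γ ν Δ p η h) (hΔ : 0 < Δ) (z : Vec n × Fin N) :
    0 ≤ lyap g Δ p h z :=
  mul_nonneg (hh.nonneg _) (Real.rpow_nonneg (sqDist_nonneg g hΔ _ _ _) _)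

lemma driftConst_nonneg (f : Vec n → Fin N → Vec n)
    (g : Vec n → Fin N → Matrix (Fin n) (Fin d) ℝ) (hΔ : 0 < Δ) (p : ℝ) :
    0 ≤ driftConst f g Δ p := by
  unfold driftConst
  positivity

/-- The geometric drift condition. -/
lemma lintegral_lyap_bemMap_le (hh : IsWeight Γ ν Δ p η h) (hΓ : IsGenerator Γ)
    (h1 : PolynomialLipschitz f g a q) (h2 : KhasminskiiMonotone f g ν l₁) (hΔ : 0 < Δ)
    (hΔ' : Δ < 1 / (maxAbs ν + 2)) (hp : 0 < p) (hp1 : p ≤ 1) (z : Vec n × Fin N) :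
    ∫⁻ e, ENNReal.ofReal (lyap g Δ p h (bemMap f g Δ e z)) ∂noiseLaw d Γ Δ ≤
      ENNReal.ofReal ((1 - η) * lyap g Δ p h z + driftConst f g Δ p) := by
  obtain ⟨x, i⟩ := z
  set b : Fin N → ℝ := fun j => (‖Δ • f 0 j‖ ^ 2 + Δ * hsNorm (g 0 i) ^ 2) ^ (p / 2) with hb
  have hb0 : ∀ j, 0 ≤ b j := fun j => by positivity
  set S := sqDist g Δ x 0 i ^ (p / 2) with hS
  have hS0 : 0 ≤ S := Real.rpow_nonneg (sqDist_nonneg g hΔ _ _ _) _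
  set Y₁ : Vec d → ℝ := fun ξ =>
    ‖x + Matrix.toEuclideanLin (g x i - g 0 i) (Real.sqrt Δ • ξ)‖ ^ p with hY₁
  set Y₂ : Fin N → Vec d → ℝ := fun j ξ =>
    ‖Δ • f 0 j + Matrix.toEuclideanLin (g 0 i) (Real.sqrt Δ • ξ)‖ ^ p with hY₂
  have hY₁m : Measurable Y₁ := measurable_norm_add_rpow _ _ _ _
  have hY₂m : ∀ j, Measurable (Y₂ j) := fun j => measurable_norm_add_rpow _ _ _ _
  have hY₁0 : ∀ ξ, 0 ≤ Y₁ ξ := fun ξ => by positivity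
  have hY₂0 : ∀ j ξ, 0 ≤ Y₂ j ξ := fun j ξ => by positivity
  have hle : ∀ j ξ, sqDist g Δ (nextPos f g Δ j (x, i) ξ) 0 j ^ (p / 2) ≤
      Real.exp (p / 2 * Δ * (ν j / (1 - ν j / (maxAbs ν + 2)))) * (Y₁ ξ + ∑ j, Y₂ j ξ) := by
    intro j ξ
    -- The origin solves the implicit equation with right-hand side -Δf(0,j), so the distance to 0
    -- is again a distance of two implicit solutions.
    have h0 : implicitSolve f Δ j (0 - Δ • f 0 j) = 0 := implicitSolve_eq h2 hΔ hΔ' j 0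
    have h3 := sqDist_nextPos_rpow_le h1 h2 hΔ hΔ' j hp
      (x + Matrix.toEuclideanLin (g x i) (Real.sqrt Δ • ξ)) (0 - Δ • f 0 j)
    rw [h0] at h3
    refine h3.trans (mul_le_mul_of_nonneg_left ?_ (Real.exp_pos _).le)
    have e : x + Matrix.toEuclideanLin (g x i) (Real.sqrt Δ • ξ) - (0 - Δ • f 0 j) =
        (x + Matrix.toEuclideanLin (g x i - g 0 i) (Real.sqrt Δ • ξ)) +
        (Δ • f 0 j + Matrix.toEuclideanLin (g 0 i) (Real.sqrt Δ • ξ)) := by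
      rw [map_sub, LinearMap.sub_apply]; abel
    rw [e]
    calc _ ≤ (‖x + Matrix.toEuclideanLin (g x i - g 0 i) (Real.sqrt Δ • ξ)‖ +
          ‖Δ • f 0 j + Matrix.toEuclideanLin (g 0 i) (Real.sqrt Δ • ξ)‖) ^ p :=
          Real.rpow_le_rpow (norm_nonneg _) (norm_add_le _ _) hp.le
      _ ≤ Y₁ ξ + Y₂ j ξ :=
          Real.rpow_add_le_add_rpow (norm_nonneg _) (norm_nonneg _) hp.le hp1
      -- Summing over all states makes the Gaussian bound independent of the next state.
      _ ≤ _ := by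
          gcongr
          exact Finset.single_le_sum (f := fun j => Y₂ j ξ) (fun j _ => hY₂0 j ξ)
            (Finset.mem_univ j)
  have hint : ∫⁻ ξ, ENNReal.ofReal (Y₁ ξ + ∑ j, Y₂ j ξ) ∂stdGaussian (Vec d) ≤
      ENNReal.ofReal (S + ∑ j, b j) := by
    have e : ∀ ξ, ENNReal.ofReal (Y₁ ξ + ∑ j, Y₂ j ξ) =
        ENNReal.ofReal (Y₁ ξ) + ∑ j, ENNReal.ofReal (Y₂ j ξ) := fun ξ => by
      rw [ENNReal.ofReal_add (hY₁0 ξ) (Finset.sum_nonneg fun j _ => hY₂0 j ξ),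
        ENNReal.ofReal_sum_of_nonneg fun j _ => hY₂0 j ξ]
    simp_rw [e]
    rw [lintegral_add_left hY₁m.ennreal_ofReal,
      lintegral_finsetSum _ fun j _ => (hY₂m j).ennreal_ofReal,
      ENNReal.ofReal_add hS0 (Finset.sum_nonneg fun j _ => hb0 j),
      ENNReal.ofReal_sum_of_nonneg fun j _ => hb0 j]
    refine add_le_add ?_ (Finset.sum_le_sum fun j _ => ?_)
    · have := lintegral_norm_add_rpow_stdGaussian_le x (g x i - g 0 i) hΔ.le hp (by linarith)
      rw [hS, sqDist, sub_zero]
      exact this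
    · exact lintegral_norm_add_rpow_stdGaussian_le _ _ hΔ.le hp (by linarith)
  have hHm : ∀ j, Measurable fun ξ => sqDist g Δ (nextPos f g Δ j (x, i) ξ) 0 j := fun j =>
    Measurable.comp (g := fun p : Vec n × Vec n => sqDist g Δ p.1 p.2 j)
      (f := fun ξ => (nextPos f g Δ j (x, i) ξ, (0 : Vec n))) (measurable_sqDist h1.2.1 j)
      ((measurable_nextPos_right h1 h2 hΔ hΔ' j (x, i)).prodMk measurable_const)
  have main := hh.lintegral_le hΓ hΔ i (H := fun j ξ =>
      sqDist g Δ (nextPos f g Δ j (x, i) ξ) 0 j ^ (p / 2))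
    (fun j => (hHm j).pow_const (p / 2))
    (hY₁m.add (Finset.measurable_sum _ fun j _ => hY₂m j)) hle
    (add_nonneg hS0 (Finset.sum_nonneg fun j _ => hb0 j)) hint
  simp only [lyap, bemMap]
  refine main.trans (ENNReal.ofReal_le_ofReal ?_)
  have hk : (1 - η) * h i ≤ 2 := by
    have := hh.bounds i
    nlinarith [hh.pos]
  have hsum0 : 0 ≤ ∑ j, b j := Finset.sum_nonneg fun j _ => hb0 j
  calc (1 - η) * h i * (S + ∑ j, b j) = (1 - η) * (h i * S) + (1 - η) * h i * ∑ j, b j := by ring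
    _ ≤ (1 - η) * (h i * S) + 2 * ∑ j, b j :=
        add_le_add_right (mul_le_mul_of_nonneg_right hk hsum0) _
    _ ≤ _ := add_le_add_right (two_mul_sum_le_driftConst f g hΔ p i) _

/-- The probability that all switching states jump to the same state. -/
def meetProb (Γ : Matrix (Fin N) (Fin N) ℝ) (Δ : ℝ) (l : Fin N) : ℝ := ∏ i, stepMatrix Γ Δ i l

lemma meetProb_pos (hΓ : IsGenerator Γ) (hirr : IsIrreducibleGenerator Γ) (hΔ : 0 < Δ)
    (l : Fin N) : 0 < meetProb Γ Δ l :=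
  Finset.prod_pos fun i _ => stepMatrix_pos hΓ hirr hΔ i l

lemma meetProb_nonneg (hΓ : IsGenerator Γ) (hΔ : 0 < Δ) (l : Fin N) : 0 ≤ meetProb Γ Δ l :=
  Finset.prod_nonneg fun i _ => stepMatrix_nonneg hΓ hΔ.le i l

lemma meetProb_le_one (hΓ : IsGenerator Γ) (hΔ : 0 < Δ) (l : Fin N) : meetProb Γ Δ l ≤ 1 := by
  refine Finset.prod_le_one (fun i _ => stepMatrix_nonneg hΓ hΔ.le i l) fun i _ => ?_
  rw [← sum_stepMatrix hΓ Δ i]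
  exact Finset.single_le_sum (fun j _ => stepMatrix_nonneg hΓ hΔ.le i j) (Finset.mem_univ l)

/-- If every state jumps to `l` then any two states meet, and by independence this has probability
`meetProb`. -/
lemma noiseLaw_ne_le (hΓ : IsGenerator Γ) (hΔ : 0 < Δ) (l i j : Fin N) :
    noiseLaw d Γ Δ {e | e.1 i ≠ e.1 j} ≤ ENNReal.ofReal (1 - meetProb Γ Δ l) := by
  have := isProbabilityMeasure_switchLaw hΓ hΔ
  have := isProbabilityMeasure_noiseLaw d hΓ hΔ
  set A : Set ((Fin N → Fin N) × Vec d) := (Set.univ.pi fun _ => {l}) ×ˢ Set.univ with hA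
  have hAm : MeasurableSet A :=
    (MeasurableSet.univ_pi fun _ => measurableSet_singleton l).prod MeasurableSet.univ
  have hAp : noiseLaw d Γ Δ A = ENNReal.ofReal (meetProb Γ Δ l) := by
    rw [hA, noiseLaw, Measure.prod_prod, Measure.pi_pi, measure_univ, mul_one, meetProb,
      ENNReal.ofReal_prod_of_nonneg fun i _ => stepMatrix_nonneg hΓ hΔ.le i l]
    refine Finset.prod_congr rfl fun i _ => ?_
    simp [switchLaw, Set.indicator_apply, Finset.sum_ite_eq']
  have hsub : {e : (Fin N → Fin N) × Vec d | e.1 i ≠ e.1 j} ⊆ Aᶜ := by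
    intro e he hA'
    have h1 := hA'.1 i (Set.mem_univ _)
    have h2 := hA'.1 j (Set.mem_univ _)
    simp only [Set.mem_singleton_iff] at h1 h2
    exact he (h1.trans h2.symm)
  refine (measure_mono hsub).trans ?_
  rw [prob_compl_eq_one_sub hAm, hAp, ENNReal.ofReal_sub _ (meetProb_nonneg hΓ hΔ l),
    ENNReal.ofReal_one]

/-- The constant of the cost function. -/
def costConst (f : Vec n → Fin N → Vec n) (g : Vec n → Fin N → Matrix (Fin n) (Fin d) ℝ)
    (Γ : Matrix (Fin N) (Fin N) ℝ) (Δ p : ℝ) (l : Fin N) : ℝ :=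
  8 * driftConst f g Δ p / meetProb Γ Δ l + 1

/-- The contraction rate of the cost function. -/
def costRate (Γ : Matrix (Fin N) (Fin N) ℝ) (Δ η : ℝ) (l : Fin N) : ℝ :=
  max (1 - η) (1 - meetProb Γ Δ l / 2)

lemma costRate_lt_one (hΓ : IsGenerator Γ) (hirr : IsIrreducibleGenerator Γ) (hΔ : 0 < Δ)
    (hη : 0 < η) (l : Fin N) : costRate Γ Δ η l < 1 := by
  have := meetProb_pos hΓ hirr hΔ l
  exact max_lt (by linarith) (by linarith)

lemma costRate_pos (hΓ : IsGenerator Γ) (hΔ : 0 < Δ) (l : Fin N) : 0 < costRate Γ Δ η l := by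
  have := meetProb_le_one hΓ hΔ l
  exact lt_of_lt_of_le (by linarith) (le_max_right _ _)

lemma one_le_costConst (hΓ : IsGenerator Γ) (hΔ : 0 < Δ) (l : Fin N) :
    1 ≤ costConst f g Γ Δ p l := by
  have h1 := meetProb_nonneg hΓ hΔ l
  have h2 := driftConst_nonneg f g hΔ p
  unfold costConst
  have : 0 ≤ 8 * driftConst f g Δ p / meetProb Γ Δ l := by positivity
  linarith

lemma two_rpow_half_le (hp1 : p ≤ 1) : (2 : ℝ) ^ (p / 2) ≤ 2 := by
  calc (2 : ℝ) ^ (p / 2) ≤ 2 ^ (1 : ℝ) :=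
        Real.rpow_le_rpow_of_exponent_le (by norm_num) (by linarith)
    _ = 2 := Real.rpow_one 2

/-- At equal switching states the cost is controlled by the Lyapunov function. -/
lemma IsWeight.weighted_sqDist_le (hh : IsWeight Γ ν Δ p η h) (hΔ : 0 < Δ) (hp : 0 < p)
    (hp1 : p ≤ 1) (x y : Vec n) (i : Fin N) :
    h i * sqDist g Δ x y i ^ (p / 2) ≤ 2 * lyap g Δ p h (x, i) + 2 * lyap g Δ p h (y, i) := by
  have hx := sqDist_nonneg g hΔ x 0 i
  have hy := sqDist_nonneg g hΔ y 0 i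
  have h3 : sqDist g Δ x y i ^ (p / 2) ≤
      2 * (sqDist g Δ x 0 i ^ (p / 2) + sqDist g Δ y 0 i ^ (p / 2)) := by
    calc _ ≤ (2 * (sqDist g Δ x 0 i + sqDist g Δ y 0 i)) ^ (p / 2) :=
          Real.rpow_le_rpow (sqDist_nonneg g hΔ _ _ _) (sqDist_le_two_mul g hΔ x y 0 i)
            (by linarith)
      _ = 2 ^ (p / 2) * (sqDist g Δ x 0 i + sqDist g Δ y 0 i) ^ (p / 2) :=
          Real.mul_rpow (by norm_num) (by linarith)
      _ ≤ 2 * (sqDist g Δ x 0 i ^ (p / 2) + sqDist g Δ y 0 i ^ (p / 2)) :=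
          mul_le_mul (two_rpow_half_le hp1)
            (Real.rpow_add_le_add_rpow hx hy (by linarith) (by linarith))
            (Real.rpow_nonneg (by linarith) _) (by norm_num)
  have h4 := mul_le_mul_of_nonneg_left h3 (hh.nonneg i)
  simp only [lyap]
  linarith

/-- The synchronous coupling contracts the cost. -/
lemma lintegral_cost_pairMap_le (hh : IsWeight Γ ν Δ p η h) (hΓ : IsGenerator Γ)
    (hirr : IsIrreducibleGenerator Γ)
    (h1 : PolynomialLipschitz f g a q) (h2 : KhasminskiiMonotone f g ν l₁) (hΔ : 0 < Δ)
    (hΔ' : Δ < 1 / (maxAbs ν + 2)) (hp : 0 < p) (hp1 : p ≤ 1) (l : Fin N)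
    (zw : (Vec n × Fin N) × (Vec n × Fin N)) :
    ∫⁻ e, ENNReal.ofReal (cost g Δ p h (costConst f g Γ Δ p l) (pairMap (bemMap f g Δ) e zw))
      ∂noiseLaw d Γ Δ ≤
      ENNReal.ofReal (costRate Γ Δ η l) *
        ENNReal.ofReal (cost g Δ p h (costConst f g Γ Δ p l) zw) := by
  obtain ⟨⟨x, i⟩, ⟨y, j⟩⟩ := zw
  have hρ := costRate_pos (η := η) hΓ hΔ l
  rw [← ENNReal.ofReal_mul hρ.le]
  by_cases hij : i = j
  · subst hij
    simp only [cost, pairMap, bemMap, if_true]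
    refine (lintegral_sqDist_bemMap_le hh hΓ h1 h2 hΔ hΔ' hp hp1 i x y).trans
      (ENNReal.ofReal_le_ofReal ?_)
    rw [mul_assoc]
    refine mul_le_mul_of_nonneg_right (le_max_left _ _) ?_
    exact mul_nonneg (hh.nonneg _) (Real.rpow_nonneg (sqDist_nonneg g hΔ _ _ _) _)
  · set R := costConst f g Γ Δ p l with hR
    have hR0 : 0 ≤ R := zero_le_one.trans (one_le_costConst hΓ hΔ l)
    set b := driftConst f g Δ p with hb
    have hb0 : 0 ≤ b := driftConst_nonneg f g hΔ p
    set δ := meetProb Γ Δ l with hδ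
    have hδ0 : 0 < δ := meetProb_pos hΓ hirr hΔ l
    have hδ1 : δ ≤ 1 := meetProb_le_one hΓ hΔ l
    have hmeas : ∀ z : Vec n × Fin N, Measurable fun e : (Fin N → Fin N) × Vec d =>
        ENNReal.ofReal (lyap g Δ p h (bemMap f g Δ e z)) := fun z =>
      (Measurable.comp (g := lyap g Δ p h) (f := fun e => bemMap f g Δ e z)
        (measurable_lyap h1.2.1 p h)
        (measurable_bemMap_left h1 h2 hΔ hΔ' z)).ennreal_ofReal
    set A : Set ((Fin N → Fin N) × Vec d) := {e | e.1 i ≠ e.1 j} with hA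
    have hAm : MeasurableSet A := by
      refine (measurableSet_eq_fun ?_ ?_).compl <;> fun_prop
    -- The Lyapunov terms dominate the cost even after a meeting, so `R` is paid only on the event
    -- `A` that the states still differ.
    have hpt : ∀ e, ENNReal.ofReal (cost g Δ p h R (pairMap (bemMap f g Δ) e ((x, i), (y, j)))) ≤
        2 * ENNReal.ofReal (lyap g Δ p h (bemMap f g Δ e (x, i))) +
        2 * ENNReal.ofReal (lyap g Δ p h (bemMap f g Δ e (y, j))) +
        A.indicator (fun _ => ENNReal.ofReal R) e := by
      intro e
      have hl1 := hh.lyap_nonneg (g := g) hΔ (bemMap f g Δ e (x, i))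
      have hl2 := hh.lyap_nonneg (g := g) hΔ (bemMap f g Δ e (y, j))
      have e2 : (2 : ℝ≥0∞) = ENNReal.ofReal 2 := by simp
      rw [e2, ← ENNReal.ofReal_mul zero_le_two, ← ENNReal.ofReal_mul zero_le_two,
        ← ENNReal.ofReal_add (by linarith) (by linarith)]
      by_cases he : e.1 i = e.1 j
      · have heA : e ∉ A := fun h => h he
        rw [Set.indicator_of_notMem heA, add_zero]
        refine ENNReal.ofReal_le_ofReal ?_
        have h3 := hh.weighted_sqDist_le (g := g) hΔ hp hp1 (bemMap f g Δ e (x, i)).1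
          (bemMap f g Δ e (y, j)).1 (e.1 i)
        have h4 : cost g Δ p h R (pairMap (bemMap f g Δ) e ((x, i), (y, j))) =
            h (e.1 i) * sqDist g Δ (bemMap f g Δ e (x, i)).1 (bemMap f g Δ e (y, j)).1 (e.1 i)
              ^ (p / 2) := by
          unfold cost
          rw [if_pos (show (pairMap (bemMap f g Δ) e ((x, i), (y, j))).1.2 =
            (pairMap (bemMap f g Δ) e ((x, i), (y, j))).2.2 from he)]
          rfl
        rw [h4]
        refine h3.trans (le_of_eq ?_)
        conv_lhs => rw [he]
        conv_lhs => rw [← he]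
        congr 2
        have : bemMap f g Δ e (y, j) = ((bemMap f g Δ e (y, j)).1, e.1 i) := Prod.ext rfl he.symm
        rw [← this]
      · have heA : e ∈ A := he
        rw [Set.indicator_of_mem heA, ← ENNReal.ofReal_add (by linarith) hR0]
        refine ENNReal.ofReal_le_ofReal (le_of_eq ?_)
        unfold cost
        rw [if_neg (show ¬ (pairMap (bemMap f g Δ) e ((x, i), (y, j))).1.2 =
            (pairMap (bemMap f g Δ) e ((x, i), (y, j))).2.2 from he)]
        rfl
    have hl1 := hh.lyap_nonneg (g := g) hΔ (x, i)
    have hl2 := hh.lyap_nonneg (g := g) hΔ (y, j)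
    have hη : 0 ≤ 1 - η := by linarith [hh.lt_one]
    have d1 := lintegral_lyap_bemMap_le hh hΓ h1 h2 hΔ hΔ' hp hp1 (x, i)
    have d2 := lintegral_lyap_bemMap_le hh hΓ h1 h2 hΔ hΔ' hp hp1 (y, j)
    have hcost : cost g Δ p h R ((x, i), (y, j)) =
        2 * lyap g Δ p h (x, i) + 2 * lyap g Δ p h (y, j) + R := by
      unfold cost
      rw [if_neg hij]
    rw [hcost]
    set u := lyap g Δ p h (x, i) with hu
    set v := lyap g Δ p h (y, j) with hv
    -- R was chosen with Rδ = 8b + δ: half of the expected drop Rδ absorbs the drift contribution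
    -- 4b, the other half gives the rate 1 - δ/2.
    have hnum : 2 * ((1 - η) * u + b) + 2 * ((1 - η) * v + b) + R * (1 - δ) ≤
        costRate Γ Δ η l * (2 * u + 2 * v + R) := by
      have hr1 : 1 - η ≤ costRate Γ Δ η l := le_max_left _ _
      have hr2 : 1 - δ / 2 ≤ costRate Γ Δ η l := le_max_right _ _
      have hRδ : R * δ = 8 * b + δ := by
        rw [hR, costConst, ← hδ, ← hb]; field_simp
      have k1 := mul_le_mul_of_nonneg_right hr1 (show 0 ≤ 2 * u + 2 * v by linarith)
      have k2 := mul_le_mul_of_nonneg_right hr2 hR0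
      nlinarith
    calc _ ≤ ∫⁻ e, (2 * ENNReal.ofReal (lyap g Δ p h (bemMap f g Δ e (x, i))) +
        2 * ENNReal.ofReal (lyap g Δ p h (bemMap f g Δ e (y, j))) +
        A.indicator (fun _ => ENNReal.ofReal R) e) ∂noiseLaw d Γ Δ := lintegral_mono hpt
      _ = 2 * ∫⁻ e, ENNReal.ofReal (lyap g Δ p h (bemMap f g Δ e (x, i))) ∂noiseLaw d Γ Δ +
          2 * ∫⁻ e, ENNReal.ofReal (lyap g Δ p h (bemMap f g Δ e (y, j))) ∂noiseLaw d Γ Δ +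
          ENNReal.ofReal R * noiseLaw d Γ Δ A := by
          rw [lintegral_add_right _ (measurable_const.indicator hAm),
            lintegral_add_left ((hmeas _).const_mul 2), lintegral_const_mul _ (hmeas _),
            lintegral_const_mul _ (hmeas _), lintegral_indicator_const hAm]
      _ ≤ 2 * ENNReal.ofReal ((1 - η) * u + b) + 2 * ENNReal.ofReal ((1 - η) * v + b) +
          ENNReal.ofReal R * ENNReal.ofReal (1 - δ) := by
          gcongr
          exact noiseLaw_ne_le hΓ hΔ l i j
      _ = ENNReal.ofReal (2 * ((1 - η) * u + b) + 2 * ((1 - η) * v + b) + R * (1 - δ)) := by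
          have e2 : (2 : ℝ≥0∞) = ENNReal.ofReal 2 := by simp
          have p1 : 0 ≤ (1 - η) * u + b := by positivity
          have p2 : 0 ≤ (1 - η) * v + b := by positivity
          have p3 : 0 ≤ 1 - δ := by linarith
          rw [e2, ← ENNReal.ofReal_mul zero_le_two, ← ENNReal.ofReal_mul zero_le_two,
            ← ENNReal.ofReal_mul hR0, ← ENNReal.ofReal_add (by positivity) (by positivity),
            ← ENNReal.ofReal_add (by positivity) (by positivity)]
      _ ≤ _ := ENNReal.ofReal_le_ofReal hnum

lemma IsWeight.norm_rpow_le (hh : IsWeight Γ ν Δ p η h) (hΔ : 0 < Δ) (hp : 0 < p)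
    (x y : Vec n) (i : Fin N) : ‖x - y‖ ^ p ≤ 2 * (h i * sqDist g Δ x y i ^ (p / 2)) := by
  have h1 := Real.rpow_le_rpow (sq_nonneg _) (norm_sq_le_sqDist g hΔ x y i) (half_pos hp).le
  rw [← Real.rpow_natCast, ← Real.rpow_mul (norm_nonneg _),
    show ((2 : ℕ) : ℝ) * (p / 2) = p by push_cast; ring] at h1
  have h2 := (hh.bounds i).1
  have h3 := Real.rpow_nonneg (sqDist_nonneg g hΔ x y i) (p / 2)
  nlinarith

/-- The factor 2 undoes h ≥ 1/2. For different states, subadditivity of t ↦ t^p passes through the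
origin, and R ≥ 1 pays for the indicator. -/
lemma IsWeight.dp_le_cost (hh : IsWeight Γ ν Δ p η h) (hΔ : 0 < Δ) (hp : 0 < p) (hp1 : p ≤ 1)
    {R : ℝ} (hR : 1 ≤ R) (zw : (Vec n × Fin N) × (Vec n × Fin N)) :
    dp p zw.1 zw.2 ≤ 2 * cost g Δ p h R zw := by
  obtain ⟨⟨x, i⟩, ⟨y, j⟩⟩ := zw
  by_cases hij : i = j
  · subst hij
    simpa [dp, cost] using hh.norm_rpow_le (g := g) hΔ hp x y i
  · have k1 := hh.norm_rpow_le (g := g) hΔ hp x 0 i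
    have k2 := hh.norm_rpow_le (g := g) hΔ hp y 0 j
    rw [sub_zero] at k1 k2
    have k3 : ‖x - y‖ ^ p ≤ ‖x‖ ^ p + ‖y‖ ^ p :=
      (Real.rpow_le_rpow (norm_nonneg _) (norm_sub_le _ _) hp.le).trans
        (Real.rpow_add_le_add_rpow (norm_nonneg _) (norm_nonneg _) hp.le hp1)
    have k4 := hh.lyap_nonneg (g := g) hΔ (x, i)
    have k5 := hh.lyap_nonneg (g := g) hΔ (y, j)
    simp only [dp, cost, lyap, if_neg hij, if_pos (show i ≠ j from hij)] at *
    linarith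

end Drift

/-! ### Transition kernels, the invariant measure and the Wasserstein bound. -/

section Kernel

variable {n d N : ℕ} {f : Vec n → Fin N → Vec n} {g : Vec n → Fin N → Matrix (Fin n) (Fin d) ℝ}
  {Γ : Matrix (Fin N) (Fin N) ℝ}
  {a : Fin N → ℝ} {q : ℝ} {ν : Fin N → ℝ} {l₁ Δ : ℝ} {p η : ℝ} {h : Fin N → ℝ}

lemma measurable_bemStep (hΓ : IsGenerator Γ) (h1 : PolynomialLipschitz f g a q)
    (h2 : KhasminskiiMonotone f g ν l₁) (hΔ : 0 < Δ) (hΔ' : Δ < 1 / (maxAbs ν + 2)) :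
    Measurable (bemStep f g Γ Δ) := by
  have := isProbabilityMeasure_noiseLaw d hΓ hΔ
  refine Measure.measurable_of_measurable_coe _ fun s hs => ?_
  have h : ∀ z, bemStep f g Γ Δ z s =
      noiseLaw d Γ Δ ((fun e => (e, z)) ⁻¹' (Function.uncurry (bemMap f g Δ) ⁻¹' s)) := fun z => by
    rw [← map_bemMap_eq_bemStep hΓ h1 h2 hΔ hΔ' z,
      Measure.map_apply (measurable_bemMap_left h1 h2 hΔ hΔ' z) hs]
    rfl
  simp_rw [h]
  exact measurable_measure_prodMk_right (measurable_bemMap h1 h2 hΔ hΔ' hs)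

lemma measurable_bemKernel (hΓ : IsGenerator Γ) (h1 : PolynomialLipschitz f g a q)
    (h2 : KhasminskiiMonotone f g ν l₁) (hΔ : 0 < Δ) (hΔ' : Δ < 1 / (maxAbs ν + 2)) (k : ℕ) :
    Measurable (bemKernel f g Γ Δ k) := by
  induction k with
  | zero => exact Measure.measurable_dirac
  | succ k ih =>
    exact (Measure.measurable_bind' (measurable_bemStep hΓ h1 h2 hΔ hΔ')).comp ih

lemma bind_bemStep_eq_stepLaw (hΓ : IsGenerator Γ) (h1 : PolynomialLipschitz f g a q)
    (h2 : KhasminskiiMonotone f g ν l₁) (hΔ : 0 < Δ) (hΔ' : Δ < 1 / (maxAbs ν + 2))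
    (u : Measure (Vec n × Fin N)) [IsProbabilityMeasure u] :
    u.bind (bemStep f g Γ Δ) = stepLaw (noiseLaw d Γ Δ) (bemMap f g Δ) u := by
  have := isProbabilityMeasure_noiseLaw d hΓ hΔ
  refine Measure.ext_of_lintegral _ fun φ hφ => ?_
  rw [Measure.lintegral_bind (measurable_bemStep hΓ h1 h2 hΔ hΔ').aemeasurable hφ.aemeasurable,
    lintegral_stepLaw (measurable_bemMap h1 h2 hΔ hΔ') u hφ]
  refine lintegral_congr fun z => ?_
  rw [← map_bemMap_eq_bemStep hΓ h1 h2 hΔ hΔ' z,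
    lintegral_map hφ (measurable_bemMap_left h1 h2 hΔ hΔ' z)]

lemma bemKernel_eq_iterate (hΓ : IsGenerator Γ) (h1 : PolynomialLipschitz f g a q)
    (h2 : KhasminskiiMonotone f g ν l₁) (hΔ : 0 < Δ) (hΔ' : Δ < 1 / (maxAbs ν + 2)) (k : ℕ)
    (z : Vec n × Fin N) :
    bemKernel f g Γ Δ k z = (stepLaw (noiseLaw d Γ Δ) (bemMap f g Δ))^[k] (Measure.dirac z) := by
  have := isProbabilityMeasure_noiseLaw d hΓ hΔ
  have : Fact (Measurable (Function.uncurry (bemMap f g Δ))) := ⟨measurable_bemMap h1 h2 hΔ hΔ'⟩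
  induction k with
  | zero => rfl
  | succ k ih =>
    rw [bemKernel, ih, bind_bemStep_eq_stepLaw hΓ h1 h2 hΔ hΔ', Function.iterate_succ_apply']

/-- A measurable set is the disjoint union of its finitely many sections, so the rectangles used to
state invariance determine the measure. -/
lemma measure_ext_of_prod_singleton {X : Type*} [MeasurableSpace X]
    {u v : Measure (X × Fin N)} [IsFiniteMeasure u]
    (huv : ∀ (A : Set X) (j : Fin N), MeasurableSet A → u (A ×ˢ {j}) = v (A ×ˢ {j})) : u = v := by
  refine Measure.ext fun S hS => ?_
  have hS' : S = ⋃ j : Fin N, ((fun x => (x, j)) ⁻¹' S) ×ˢ {j} := by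
    ext ⟨x, j⟩
    simp
  have hm : ∀ j : Fin N, MeasurableSet ((fun x => (x, j)) ⁻¹' S) := fun j =>
    (measurable_id.prodMk measurable_const) hS
  have hd : Pairwise (Function.onFun Disjoint
      fun j : Fin N => (((fun x => (x, j)) ⁻¹' S) ×ˢ {j} : Set (X × Fin N))) := by
    intro i j hij
    refine Set.disjoint_left.2 fun z hz hz' => hij ?_
    exact (hz.2 : z.2 = i).symm.trans hz'.2
  rw [hS', measure_iUnion hd fun j => (hm j).prod (measurableSet_singleton j),
    measure_iUnion hd fun j => (hm j).prod (measurableSet_singleton j)]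
  exact tsum_congr fun j => huv _ j (hm j)

/-- The case k = 1 is invariance under one step; conversely one-step invariance iterates by
associativity of composition of kernels. -/
lemma isInvariantMeasure_iff (hΓ : IsGenerator Γ) (h1 : PolynomialLipschitz f g a q)
    (h2 : KhasminskiiMonotone f g ν l₁) (hΔ : 0 < Δ) (hΔ' : Δ < 1 / (maxAbs ν + 2))
    (π : Measure (Vec n × Fin N)) :
    IsInvariantMeasure (bemKernel f g Γ Δ) π ↔
      IsProbabilityMeasure π ∧ stepLaw (noiseLaw d Γ Δ) (bemMap f g Δ) π = π := by
  have hb := measurable_bemStep (Γ := Γ) hΓ h1 h2 hΔ hΔ'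
  have hk := measurable_bemKernel (Γ := Γ) hΓ h1 h2 hΔ hΔ'
  refine ⟨fun ⟨hπ, hinv⟩ => ⟨hπ, ?_⟩, fun ⟨hπ, hinv⟩ => ⟨hπ, ?_⟩⟩
  · symm
    rw [← bind_bemStep_eq_stepLaw hΓ h1 h2 hΔ hΔ']
    refine measure_ext_of_prod_singleton fun A j hA => ?_
    rw [Measure.bind_apply (hA.prod (measurableSet_singleton j)) hb.aemeasurable, hinv 1 A j hA]
    refine lintegral_congr fun z => ?_
    change ((Measure.dirac z).bind (bemStep f g Γ Δ)) _ = _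
    rw [Measure.dirac_bind hb]
  · have key : ∀ k, π.bind (bemKernel f g Γ Δ k) = π := by
      intro k
      induction k with
      | zero => exact Measure.bind_dirac
      | succ k ih =>
        have h3 := Measure.bind_bind (m := π) (hk k).aemeasurable
          (hb.aemeasurable (μ := π.bind (bemKernel f g Γ Δ k)))
        rw [ih, bind_bemStep_eq_stepLaw hΓ h1 h2 hΔ hΔ', hinv] at h3
        exact h3.symm
    intro k A j hA
    rw [← Measure.bind_apply (hA.prod (measurableSet_singleton j)) (hk k).aemeasurable, key]

/-- A metric inducing the discrete topology of `Fin N`. -/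
abbrev finMetric (N : ℕ) : MetricSpace (Fin N) :=
  (MetricSpace.induced (fun i : Fin N => ((i : ℕ) : ℝ))
    (fun _ _ hij => Fin.ext (Nat.cast_injective hij)) inferInstance).replaceTopology (by
      have h1 : (inferInstance : TopologicalSpace (Fin N)) = ⊥ := DiscreteTopology.eq_bot
      let m : MetricSpace (Fin N) := MetricSpace.induced (fun i : Fin N => ((i : ℕ) : ℝ))
        (fun _ _ hij => Fin.ext (Nat.cast_injective hij)) inferInstance
      have h2 : m.toUniformSpace.toTopologicalSpace = ⊥ :=
        @DiscreteTopology.eq_bot _ m.toUniformSpace.toTopologicalSpace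
          (@Finite.instDiscreteTopology _ m.toUniformSpace.toTopologicalSpace inferInstance
            inferInstance)
      exact h1.trans h2.symm)

/-- The truncation at 1 makes the choice of metric on the finite state space irrelevant. -/
lemma min_one_dist_le_dp [MetricSpace (Fin N)] (hp : 0 < p) (hp1 : p ≤ 1)
    (zw : (Vec n × Fin N) × (Vec n × Fin N)) : min 1 (dist zw.1 zw.2) ≤ dp p zw.1 zw.2 := by
  obtain ⟨⟨x, i⟩, ⟨y, j⟩⟩ := zw
  have h0 : 0 ≤ ‖x - y‖ ^ p := by positivity
  by_cases hij : i = j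
  · subst hij
    simp only [dp, Prod.dist_eq, dist_self, ne_eq, not_true_eq_false, if_false, add_zero,
      dist_eq_norm, max_eq_left (norm_nonneg (x - y))]
    rcases le_total 1 ‖x - y‖ with h | h
    · exact (min_le_left _ _).trans (Real.one_le_rpow h hp.le)
    · refine (min_le_right _ _).trans ?_
      exact Real.self_le_rpow_of_le_one (norm_nonneg _) h hp1
  · simp only [dp, ne_eq, hij, not_false_eq_true, if_true]
    exact (min_le_left _ _).trans (by linarith)

/-- The cost is integrable as soon as the Lyapunov function is. -/
lemma IsWeight.cost_le (hh : IsWeight Γ ν Δ p η h) (hΔ : 0 < Δ) (hp : 0 < p) (hp1 : p ≤ 1)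
    {R : ℝ} (hR : 0 ≤ R) (zw : (Vec n × Fin N) × (Vec n × Fin N)) :
    cost g Δ p h R zw ≤ 2 * lyap g Δ p h zw.1 + 2 * lyap g Δ p h zw.2 + R := by
  obtain ⟨⟨x, i⟩, ⟨y, j⟩⟩ := zw
  unfold cost
  split_ifs with hij
  · simp only at hij
    subst hij
    have := hh.weighted_sqDist_le (g := g) hΔ hp hp1 x y i
    simp only
    linarith
  · exact le_rfl

lemma exists_unique_invariant (hh : IsWeight Γ ν Δ p η h) (hΓ : IsGenerator Γ)
    (hirr : IsIrreducibleGenerator Γ) (h1 : PolynomialLipschitz f g a q)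
    (h2 : KhasminskiiMonotone f g ν l₁) (hΔ : 0 < Δ) (hΔ' : Δ < 1 / (maxAbs ν + 2)) (hp : 0 < p)
    (hp1 : p ≤ 1) (l : Fin N) :
    ∃ π : Measure (Vec n × Fin N),
      (IsProbabilityMeasure π ∧ stepLaw (noiseLaw d Γ Δ) (bemMap f g Δ) π = π) ∧
      ∀ π' : Measure (Vec n × Fin N), IsProbabilityMeasure π' →
        stepLaw (noiseLaw d Γ Δ) (bemMap f g Δ) π' = π' → π' = π := by
  let _ : MetricSpace (Fin N) := finMetric N
  have := isProbabilityMeasure_noiseLaw d hΓ hΔ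
  have hF := measurable_bemMap h1 h2 hΔ hΔ'
  have hL : Measurable fun zw => ENNReal.ofReal (cost g Δ p h (costConst f g Γ Δ p l) zw) :=
    (measurable_cost h1.2.1 p h _).ennreal_ofReal
  have hΦ : Measurable fun z => ENNReal.ofReal (lyap g Δ p h z) :=
    (measurable_lyap h1.2.1 p h).ennreal_ofReal
  have hρ : ENNReal.ofReal (costRate Γ Δ η l) < 1 :=
    ENNReal.ofReal_lt_one.2 (costRate_lt_one hΓ hirr hΔ hh.pos l)
  have H := lintegral_cost_pairMap_le hh hΓ hirr h1 h2 hΔ hΔ' hp hp1 l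
  have hdist : ∀ zw : (Vec n × Fin N) × (Vec n × Fin N),
      ENNReal.ofReal (min 1 (dist zw.1 zw.2)) ≤
        ENNReal.ofReal 2 * min (ENNReal.ofReal (cost g Δ p h (costConst f g Γ Δ p l) zw)) 1 := by
    intro zw
    have k1 := min_one_dist_le_dp hp hp1 zw
    have k2 := hh.dp_le_cost (g := g) hΔ hp hp1
      (one_le_costConst (f := f) (g := g) (p := p) hΓ hΔ l) zw
    rw [← ENNReal.ofReal_one, ← ENNReal.ofReal_min, ← ENNReal.ofReal_mul zero_le_two,
      mul_min_of_nonneg _ _ zero_le_two]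
    refine ENNReal.ofReal_le_ofReal (le_min (k1.trans k2) ?_)
    exact (min_le_left _ _).trans (by norm_num)
  have HΦ : ∀ z, ∫⁻ e, ENNReal.ofReal (lyap g Δ p h (bemMap f g Δ e z)) ∂noiseLaw d Γ Δ ≤
      ENNReal.ofReal (costRate Γ Δ η l) * ENNReal.ofReal (lyap g Δ p h z) +
        ENNReal.ofReal (driftConst f g Δ p) := by
    intro z
    have k0 := hh.lyap_nonneg (g := g) hΔ z
    have k1 := costRate_pos (η := η) hΓ hΔ l
    refine (lintegral_lyap_bemMap_le hh hΓ h1 h2 hΔ hΔ' hp hp1 z).trans ?_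
    rw [← ENNReal.ofReal_mul k1.le, ← ENNReal.ofReal_add (mul_nonneg k1.le k0)
      (driftConst_nonneg f g hΔ p)]
    refine ENNReal.ofReal_le_ofReal (add_le_add_left ?_ _)
    exact mul_le_mul_of_nonneg_right (le_max_left _ _) k0
  have hcpt : ∀ r : ℝ≥0, ∃ C : Set (Vec n × Fin N), IsCompact C ∧
      ∀ z, ENNReal.ofReal (lyap g Δ p h z) ≤ r → z ∈ C := by
    intro r
    refine ⟨Metric.closedBall 0 ((2 * r : ℝ) ^ (1 / p)) ×ˢ Set.univ,
      (isCompact_closedBall _ _).prod isCompact_univ, fun z hz => ⟨?_, Set.mem_univ _⟩⟩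
    rw [mem_closedBall_zero_iff]
    have k1 : lyap g Δ p h z ≤ r := by
      rw [← ENNReal.ofReal_coe_nnreal] at hz
      exact (ENNReal.ofReal_le_ofReal_iff (NNReal.coe_nonneg r)).1 hz
    have k2 := hh.norm_rpow_le (g := g) hΔ hp z.1 0 z.2
    rw [sub_zero] at k2
    unfold lyap at k1
    have k3 : ‖z.1‖ ^ p ≤ 2 * r := by linarith
    have k4 := Real.rpow_le_rpow (by positivity) k3 (by positivity : 0 ≤ 1 / p)
    rwa [← Real.rpow_mul (norm_nonneg _), mul_one_div_cancel hp.ne', Real.rpow_one] at k4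
  obtain ⟨π, hπ, hπ'⟩ := exists_stepLaw_invariant hF (continuous_bemMap h1 h2 hΔ hΔ') hL
    (fun _ => ENNReal.ofReal_ne_top) hΦ hρ ENNReal.ofReal_ne_top (by simp) H hdist HΦ hcpt
    ((0 : Vec n), l) ENNReal.ofReal_ne_top
  refine ⟨π, ⟨hπ, hπ'⟩, fun π' hp' hinv' => ?_⟩
  exact stepLaw_invariant_unique hF hL (fun _ => ENNReal.ofReal_ne_top) hρ (by simp) H hdist
    hinv' hπ'

/-- The synchronous coupling is started from a point mass times `π`. Its initial cost is finite
because an invariant law integrates the Lyapunov function, and it then decays geometrically. -/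
lemma exists_wasserstein_le (hh : IsWeight Γ ν Δ p η h) (hΓ : IsGenerator Γ)
    (hirr : IsIrreducibleGenerator Γ) (h1 : PolynomialLipschitz f g a q)
    (h2 : KhasminskiiMonotone f g ν l₁) (hΔ : 0 < Δ) (hΔ' : Δ < 1 / (maxAbs ν + 2)) (hp : 0 < p)
    (hp1 : p ≤ 1) (l : Fin N) {π : Measure (Vec n × Fin N)} [IsProbabilityMeasure π]
    (hπ : stepLaw (noiseLaw d Γ Δ) (bemMap f g Δ) π = π) (z : Vec n × Fin N) :
    ∃ C : ℝ, 0 < C ∧ ∀ k : ℕ, wasserstein p (bemKernel f g Γ Δ k z) π ≤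
      ENNReal.ofReal (C * costRate Γ Δ η l ^ k) := by
  have := isProbabilityMeasure_noiseLaw d hΓ hΔ
  have hF := measurable_bemMap h1 h2 hΔ hΔ'
  set R := costConst f g Γ Δ p l with hRdef
  have hR1 : 1 ≤ R := one_le_costConst hΓ hΔ l
  have hL : Measurable fun zw => ENNReal.ofReal (cost g Δ p h R zw) :=
    (measurable_cost h1.2.1 p h _).ennreal_ofReal
  have hΦ : Measurable fun z => ENNReal.ofReal (lyap g Δ p h z) :=
    (measurable_lyap h1.2.1 p h).ennreal_ofReal
  have hη0 : 0 ≤ 1 - η := by linarith [hh.lt_one]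
  have hmom : ∫⁻ w, ENNReal.ofReal (lyap g Δ p h w) ∂π ≠ ∞ := by
    have h3 : ENNReal.ofReal (1 - η) < 1 := ENNReal.ofReal_lt_one.2 (by linarith [hh.pos])
    refine ne_top_of_le_ne_top ?_ (lintegral_le_of_stepLaw_eq (ρ := ENNReal.ofReal (1 - η))
      (b := ENNReal.ofReal (driftConst f g Δ p)) hF hΦ (fun _ => ENNReal.ofReal_ne_top) h3
      (fun z => ?_) hπ)
    · refine ENNReal.mul_ne_top ENNReal.ofReal_ne_top ?_
      simpa [tsub_eq_zero_iff_le] using h3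
    · have k0 := hh.lyap_nonneg (g := g) hΔ z
      rw [← ENNReal.ofReal_mul hη0, ← ENNReal.ofReal_add (mul_nonneg hη0 k0)
        (driftConst_nonneg f g hΔ p)]
      exact lintegral_lyap_bemMap_le hh hΓ h1 h2 hΔ hΔ' hp hp1 z
  set I := ∫⁻ w, ENNReal.ofReal (cost g Δ p h R (z, w)) ∂π with hI
  have hItop : I ≠ ∞ := by
    have hle : I ≤ ∫⁻ w, (2 * ENNReal.ofReal (lyap g Δ p h w) +
        ENNReal.ofReal (2 * lyap g Δ p h z + R)) ∂π := by
      refine lintegral_mono fun w => ?_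
      have k0 := hh.lyap_nonneg (g := g) hΔ z
      have k1 := hh.lyap_nonneg (g := g) hΔ w
      have e2 : (2 : ℝ≥0∞) = ENNReal.ofReal 2 := by simp
      rw [e2, ← ENNReal.ofReal_mul zero_le_two, ← ENNReal.ofReal_add (by linarith) (by linarith)]
      refine ENNReal.ofReal_le_ofReal ?_
      have := hh.cost_le (g := g) hΔ hp hp1 (R := R) (by linarith) (z, w)
      simp only at this
      linarith
    refine ne_top_of_le_ne_top ?_ hle
    rw [lintegral_add_right _ measurable_const, lintegral_const_mul _ hΦ]
    simp [hmom, ENNReal.mul_eq_top]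
  have hρ := costRate_pos (η := η) hΓ hΔ l
  -- The factor 2 is the one from `dp_le_cost`; the summand 1 only ensures positivity.
  refine ⟨2 * I.toReal + 1, by positivity, fun k => ?_⟩
  obtain ⟨θ, hθ, hθ1, hθ2, hθ3⟩ := exists_coupling_iterate hF hL
    (lintegral_cost_pairMap_le hh hΓ hirr h1 h2 hΔ hΔ' hp hp1 l) (Measure.dirac z) π k
  rw [← bemKernel_eq_iterate hΓ h1 h2 hΔ hΔ'] at hθ1
  rw [Function.iterate_fixed hπ] at hθ2
  have hθL : ∫⁻ zw, ENNReal.ofReal (cost g Δ p h R zw) ∂θ ≤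
      ENNReal.ofReal (costRate Γ Δ η l) ^ k * I := by
    have h3 := hθ3 ∞
    simp only [le_top, inf_of_le_left] at h3
    refine h3.trans (le_of_eq ?_)
    rw [lintegral_const_mul _ hL, lintegral_prod _ hL.aemeasurable, lintegral_dirac']
    exact hL.lintegral_prod_right'
  calc wasserstein p (bemKernel f g Γ Δ k z) π
      ≤ ∫⁻ zw, ENNReal.ofReal (dp p zw.1 zw.2) ∂θ :=
        iInf_le_of_le ⟨θ, hθ1, hθ2⟩ le_rfl
    _ ≤ ∫⁻ zw, 2 * ENNReal.ofReal (cost g Δ p h R zw) ∂θ := by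
        refine lintegral_mono fun zw => ?_
        have e2 : (2 : ℝ≥0∞) = ENNReal.ofReal 2 := by simp
        rw [e2, ← ENNReal.ofReal_mul zero_le_two]
        exact ENNReal.ofReal_le_ofReal (hh.dp_le_cost hΔ hp hp1 hR1 zw)
    _ ≤ 2 * (ENNReal.ofReal (costRate Γ Δ η l) ^ k * I) := by
        rw [lintegral_const_mul _ hL]
        exact mul_le_mul_right hθL _
    _ = ENNReal.ofReal (2 * I.toReal * costRate Γ Δ η l ^ k) := by
        have e2 : (2 : ℝ≥0∞) = ENNReal.ofReal 2 := by simp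
        rw [ENNReal.ofReal_mul (by positivity), ENNReal.ofReal_mul zero_le_two,
          ENNReal.ofReal_toReal hItop, ENNReal.ofReal_pow hρ.le, ← e2]
        ring
    _ ≤ _ := ENNReal.ofReal_le_ofReal (by
        have := pow_pos hρ k
        nlinarith)

end Kernel

/-! ### The law of the scheme. -/

section Law

variable {n d N : ℕ} {f : Vec n → Fin N → Vec n} {g : Vec n → Fin N → Matrix (Fin n) (Fin d) ℝ}
  {Γ : Matrix (Fin N) (Fin N) ℝ}
  {a : Fin N → ℝ} {q : ℝ} {ν : Fin N → ℝ} {l₁ Δ : ℝ}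
  {Ω : Type*} [MeasurableSpace Ω] {P : Measure Ω}
  {x₀ : Vec n} {i₀ : Fin N} {B : Fin d → ℝ≥0 → Ω → ℝ} {X : ℕ → Ω → Vec n} {r : ℕ → Ω → Fin N}

/-- The coordinates of the Brownian increments, scaled to unit variance. -/
def noiseCoord (B : Fin d → ℝ≥0 → Ω → ℝ) (Δ : ℝ) (l : Fin d) (m : ℕ) (ω : Ω) : ℝ :=
  (Real.sqrt Δ)⁻¹ * (B l (Real.toNNReal ((m + 1 : ℝ) * Δ)) ω - B l (Real.toNNReal (m * Δ)) ω)

/-- The Brownian increments, scaled to unit variance. -/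
def noise (B : Fin d → ℝ≥0 → Ω → ℝ) (Δ : ℝ) (m : ℕ) (ω : Ω) : Vec d :=
  WithLp.toLp 2 fun l => noiseCoord B Δ l m ω

lemma sqrt_smul_noise {Ω : Type*} (B : Fin d → ℝ≥0 → Ω → ℝ) (hΔ : 0 < Δ) (m : ℕ) (ω : Ω) :
    Real.sqrt Δ • noise B Δ m ω = increment B Δ m ω := by
  have : Real.sqrt Δ ≠ 0 := (Real.sqrt_pos.2 hΔ).ne'
  ext l
  simp only [noise, noiseCoord, increment, PiLp.smul_apply, smul_eq_mul]
  rw [mul_inv_cancel_left₀ this]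

lemma IsBrownianMotion.measurable_noiseCoord (hB : IsBrownianMotion P B) (l : Fin d) (m : ℕ) :
    Measurable (noiseCoord B Δ l m) :=
  ((hB.measurable l _).sub (hB.measurable l _)).const_mul _

lemma IsBrownianMotion.measurable_noise (hB : IsBrownianMotion P B) (m : ℕ) :
    Measurable (noise B Δ m) :=
  (WithLp.measurable_toLp 2 _).comp (measurable_pi_lambda _ fun l => hB.measurable_noiseCoord l m)

/-- Two layers of independence are combined: between the coordinate processes, and between the
increments of each coordinate. -/
lemma IsBrownianMotion.iIndepFun_noiseCoord (hB : IsBrownianMotion P B) (hΔ : 0 < Δ) :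
    iIndepFun (fun (p : Fin d × ℕ) ω => noiseCoord B Δ p.1 p.2 ω) P := by
  refine iIndepFun_uncurry' (X := fun l m ω => noiseCoord B Δ l m ω)
    (fun l m => hB.measurable_noiseCoord l m) ?_ fun l => ?_
  · exact hB.indep.comp (fun _ b (m : ℕ) => (Real.sqrt Δ)⁻¹ *
      (b (Real.toNNReal ((m + 1 : ℝ) * Δ)) - b (Real.toNNReal (m * Δ)))) fun _ => by fun_prop
  · have ht : Monotone fun m : ℕ => Real.toNNReal (m * Δ) := fun m m' h =>
      Real.toNNReal_le_toNNReal (mul_le_mul_of_nonneg_right (Nat.cast_le.2 h) hΔ.le)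
    have h := ((hB.brownian l).toIsPreBrownianReal.hasIndepIncrements.nat ht).comp
      (fun _ x => (Real.sqrt Δ)⁻¹ * x) fun _ => by fun_prop
    convert h using 3 with m ω
    simp [noiseCoord]

lemma IsBrownianMotion.map_noiseCoord (hB : IsBrownianMotion P B) (hΔ : 0 < Δ) (l : Fin d)
    (m : ℕ) : P.map (noiseCoord B Δ l m) = gaussianReal 0 1 := by
  have h := gaussianReal_const_mul ((hB.brownian l).toIsPreBrownianReal.hasLaw_sub
    (Real.toNNReal ((m + 1 : ℝ) * Δ)) (Real.toNNReal (m * Δ))) (Real.sqrt Δ)⁻¹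
  refine h.map_eq.trans ?_
  congr 1
  · simp
  · ext
    have h1 : (0 : ℝ) ≤ (m + 1 : ℝ) * Δ := by positivity
    have h2 : (0 : ℝ) ≤ (m : ℝ) * Δ := by positivity
    have h3 : ((m + 1 : ℝ) * Δ - m * Δ) = Δ := by ring
    change (Real.sqrt Δ)⁻¹ ^ 2 *
      (nndist (Real.toNNReal ((m + 1 : ℝ) * Δ) : ℝ) (Real.toNNReal (m * Δ) : ℝ) : ℝ) = 1
    rw [coe_nndist, Real.coe_toNNReal _ h1, Real.coe_toNNReal _ h2, Real.dist_eq, h3,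
      abs_of_pos hΔ, inv_pow, Real.sq_sqrt hΔ.le, inv_mul_cancel₀ hΔ.ne']

lemma IsBrownianMotion.map_noise [IsProbabilityMeasure P] (hB : IsBrownianMotion P B) (hΔ : 0 < Δ) (m : ℕ) :
    P.map (noise B Δ m) = stdGaussian (Vec d) := by
  have hi : iIndepFun (fun l ω => noiseCoord B Δ l m ω) P :=
    (hB.iIndepFun_noiseCoord hΔ).precomp (g := fun l => (l, m)) fun l l' h => (Prod.ext_iff.1 h).1
  have h := (iIndepFun_iff_map_fun_eq_pi_map
    fun l => (hB.measurable_noiseCoord l m).aemeasurable).1 hi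
  have he : (fun l => P.map fun ω => noiseCoord B Δ l m ω) = fun _ => gaussianReal 0 1 :=
    funext fun l => hB.map_noiseCoord hΔ l m
  rw [he] at h
  rw [← map_pi_eq_stdGaussian, ← h, Measure.map_map (WithLp.measurable_toLp 2 _)
    (measurable_pi_lambda _ fun l => hB.measurable_noiseCoord l m)]
  rfl

/-- The positions of the scheme along a fixed switching path `s`, driven by the noise `w`. -/
def pathPos (f : Vec n → Fin N → Vec n) (g : Vec n → Fin N → Matrix (Fin n) (Fin d) ℝ) (Δ : ℝ)
    (x₀ : Vec n) (s : ℕ → Fin N) (w : ℕ → Vec d) : ℕ → Vec n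
  | 0 => x₀
  | k + 1 => nextPos f g Δ (s (k + 1)) (pathPos f g Δ x₀ s w k, s k) (w k)

lemma pathPos_congr (s : ℕ → Fin N) {w w' : ℕ → Vec d} {k : ℕ} (h : ∀ m < k, w m = w' m) :
    pathPos f g Δ x₀ s w k = pathPos f g Δ x₀ s w' k := by
  induction k with
  | zero => rfl
  | succ k ih =>
    rw [pathPos, pathPos, ih fun m hm => h m (hm.trans (Nat.lt_succ_self k)),
      h k (Nat.lt_succ_self k)]

lemma measurable_pathPos (h1 : PolynomialLipschitz f g a q)
    (h2 : KhasminskiiMonotone f g ν l₁) (hΔ : 0 < Δ) (hΔ' : Δ < 1 / (maxAbs ν + 2))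
    (s : ℕ → Fin N) (k : ℕ) :
    Measurable fun w : ℕ → Vec d => pathPos f g Δ x₀ s w k := by
  induction k with
  | zero => exact measurable_const
  | succ k ih =>
    exact (continuous_nextPos h1 h2 hΔ hΔ' (s k) (s (k + 1))).measurable.comp
      (ih.prodMk (measurable_pi_apply k))

lemma IsBrownianMotion.measurable_pathPos_noise (hB : IsBrownianMotion P B)
    (h1 : PolynomialLipschitz f g a q)
    (h2 : KhasminskiiMonotone f g ν l₁) (hΔ : 0 < Δ) (hΔ' : Δ < 1 / (maxAbs ν + 2))
    (s : ℕ → Fin N) (k : ℕ) :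
    Measurable fun ω => pathPos f g Δ x₀ s (fun m => noise B Δ m ω) k :=
  (measurable_pathPos h1 h2 hΔ hΔ' s k).comp
    (measurable_pi_lambda _ fun m => hB.measurable_noise m)

/-- The position at time k uses only noise with index below k, so the two variables are functions of
disjoint families of independent coordinates. -/
lemma IsBrownianMotion.indepFun_pathPos_noise (hB : IsBrownianMotion P B)
    (h1 : PolynomialLipschitz f g a q)
    (h2 : KhasminskiiMonotone f g ν l₁) (hΔ : 0 < Δ) (hΔ' : Δ < 1 / (maxAbs ν + 2))
    (s : ℕ → Fin N) (k : ℕ) :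
    IndepFun (fun ω => pathPos f g Δ x₀ s (fun m => noise B Δ m ω) k) (noise B Δ k) P := by
  classical
  have hd : Disjoint ((Finset.univ : Finset (Fin d)) ×ˢ Finset.range k)
      ((Finset.univ : Finset (Fin d)) ×ˢ {k}) := by
    refine Finset.disjoint_left.2 fun p hp hp' => ?_
    simp only [Finset.mem_product, Finset.mem_univ, Finset.mem_range, Finset.mem_singleton,
      true_and] at hp hp'
    omega
  have hi := (hB.iIndepFun_noiseCoord hΔ).indepFun_finset _ _ hd
    fun p => hB.measurable_noiseCoord p.1 p.2
  let past : (((Finset.univ : Finset (Fin d)) ×ˢ Finset.range k : Finset (Fin d × ℕ)) → ℝ) →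
      ℕ → Vec d := fun v m => WithLp.toLp 2 fun l =>
    if h : (l, m) ∈ (Finset.univ : Finset (Fin d)) ×ˢ Finset.range k then v ⟨(l, m), h⟩ else 0
  have hpast : Measurable past := by
    refine measurable_pi_lambda _ fun m => (WithLp.measurable_toLp 2 _).comp
      (measurable_pi_lambda _ fun l => ?_)
    by_cases h : (l, m) ∈ (Finset.univ : Finset (Fin d)) ×ˢ Finset.range k
    · simpa only [h, dif_pos] using measurable_pi_apply _
    · simpa only [h, dif_neg, not_false_eq_true] using measurable_const
  let cur : (((Finset.univ : Finset (Fin d)) ×ˢ {k} : Finset (Fin d × ℕ)) → ℝ) → Vec d :=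
    fun v => WithLp.toLp 2 fun l => v ⟨(l, k), by simp⟩
  have hcur : Measurable cur := (WithLp.measurable_toLp 2 _).comp
    (measurable_pi_lambda _ fun l => measurable_pi_apply _)
  have h := hi.comp ((measurable_pathPos (x₀ := x₀) h1 h2 hΔ hΔ' s k).comp hpast) hcur
  have he : (fun ω => pathPos f g Δ x₀ s (fun m => noise B Δ m ω) k) =
      ((fun w => pathPos f g Δ x₀ s w k) ∘ past) ∘
        fun ω i => noiseCoord B Δ i.1.1 i.1.2 ω := by
    funext ω
    refine pathPos_congr s fun m hm => ?_
    ext l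
    simp [past, noise, hm]
  rw [he]
  exact h

lemma IsBrownianMotion.measure_pathPos_succ [IsProbabilityMeasure P] (hB : IsBrownianMotion P B)
    (h1 : PolynomialLipschitz f g a q)
    (h2 : KhasminskiiMonotone f g ν l₁) (hΔ : 0 < Δ) (hΔ' : Δ < 1 / (maxAbs ν + 2))
    (s : ℕ → Fin N) (k : ℕ) {A : Set (Vec n)} (hA : MeasurableSet A) :
    P {ω | pathPos f g Δ x₀ s (fun m => noise B Δ m ω) (k + 1) ∈ A} =
      ∫⁻ ω, stdGaussian (Vec d) {ξ | nextPos f g Δ (s (k + 1))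
        (pathPos f g Δ x₀ s (fun m => noise B Δ m ω) k, s k) ξ ∈ A} ∂P := by
  have hY := hB.measurable_pathPos_noise (x₀ := x₀) h1 h2 hΔ hΔ' s k
  have hW := hB.measurable_noise (Δ := Δ) k
  have hi := hB.indepFun_pathPos_noise (x₀ := x₀) h1 h2 hΔ hΔ' s k
  have hS := (continuous_nextPos h1 h2 hΔ hΔ' (s k) (s (k + 1))).measurable hA
  have hprod := (indepFun_iff_map_prod_eq_prod_map_map hY.aemeasurable hW.aemeasurable).1 hi
  have h := congrArg (fun m => m ((fun p : Vec n × Vec d =>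
    nextPos f g Δ (s (k + 1)) (p.1, s k) p.2) ⁻¹' A)) hprod
  simp only [hB.map_noise hΔ k] at h
  rw [Measure.map_apply (hY.prodMk hW) hS, Measure.prod_apply hS,
    lintegral_map (measurable_measure_prodMk_left hS) hY] at h
  exact h

/-- Uniqueness for the implicit equation forces any solution of the scheme to follow the recursion
on the event that the switching path is `s`. -/
lemma IsBEMSolution.ae_eq_pathPos (hX : IsBEMSolution P f g Γ Δ x₀ i₀ B X r)
    (h2 : KhasminskiiMonotone f g ν l₁) (hΔ : 0 < Δ) (hΔ' : Δ < 1 / (maxAbs ν + 2))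
    (s : ℕ → Fin N) (k : ℕ) :
    ∀ᵐ ω ∂P, (∀ m ≤ k, r m ω = s m) → X k ω = pathPos f g Δ x₀ s (fun m => noise B Δ m ω) k := by
  induction k with
  | zero => filter_upwards [hX.initial] with ω hω _ using hω
  | succ k ih =>
    filter_upwards [ih, hX.step k] with ω hω hstep hs
    have hk := hω fun m hm => hs m (hm.trans (Nat.le_succ k))
    rw [hs (k + 1) le_rfl, hs k (Nat.le_succ k)] at hstep
    rw [pathPos, ← hk, nextPos, sqrt_smul_noise B hΔ,
      ← implicitSolve_eq h2 hΔ hΔ' (s (k + 1)) (X (k + 1) ω)]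
    congr 1
    rw [sub_eq_iff_eq_add]
    exact hstep.trans (by abel)

lemma IsMarkovChain.measurableSet_path {Q : Matrix (Fin N) (Fin N) ℝ}
    (hr : IsMarkovChain P Q i₀ r) (s : ℕ → Fin N) (k : ℕ) :
    MeasurableSet {ω | ∀ m ≤ k, r m ω = s m} := by
  have : {ω | ∀ m ≤ k, r m ω = s m} = ⋂ m ≤ k, r m ⁻¹' {s m} := by
    ext ω
    simp
  rw [this]
  exact .biInter (Set.to_countable _) fun m _ => hr.measurable m (measurableSet_singleton _)

/-- With the switching path frozen, the position is a function of the Brownian motion alone, hence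
independent of the event that this path occurs. -/
lemma IsBEMSolution.setLIntegral_path (hX : IsBEMSolution P f g Γ Δ x₀ i₀ B X r)
    (h1 : PolynomialLipschitz f g a q)
    (h2 : KhasminskiiMonotone f g ν l₁) (hΔ : 0 < Δ) (hΔ' : Δ < 1 / (maxAbs ν + 2))
    (s : ℕ → Fin N) (k : ℕ) {H : Vec n → ℝ≥0∞} (hH : Measurable H) :
    ∫⁻ ω in {ω | ∀ m ≤ k, r m ω = s m}, H (X k ω) ∂P =
      P {ω | ∀ m ≤ k, r m ω = s m} *
        ∫⁻ ω, H (pathPos f g Δ x₀ s (fun m => noise B Δ m ω) k) ∂P := by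
  have hS := hX.chain.measurableSet_path s k
  have hY := hX.brownian.measurable_pathPos_noise (x₀ := x₀) h1 h2 hΔ hΔ' s k
  have hSr : MeasurableSet {ρ : ℕ → Fin N | ∀ m ≤ k, ρ m = s m} := by
    have : {ρ : ℕ → Fin N | ∀ m ≤ k, ρ m = s m} = ⋂ m ≤ k, (fun ρ => ρ m) ⁻¹' {s m} := by
      ext ω
      simp
    rw [this]
    exact .biInter (Set.to_countable _) fun m _ =>
      measurable_pi_apply m (measurableSet_singleton _)
  have hw : Measurable fun (b : Fin d → ℝ≥0 → ℝ) (m : ℕ) => (WithLp.toLp 2 fun l =>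
      (Real.sqrt Δ)⁻¹ * (b l (Real.toNNReal ((m + 1 : ℝ) * Δ)) - b l (Real.toNNReal (m * Δ))) :
      Vec d) :=
    measurable_pi_lambda _ fun m => (WithLp.measurable_toLp 2 _).comp
      (measurable_pi_lambda _ fun l => by fun_prop)
  have hi := hX.indep.comp ((hH.comp (measurable_pathPos (x₀ := x₀) h1 h2 hΔ hΔ' s k)).comp hw)
    (Measurable.indicator (mβ := ENNReal.measurableSpace) measurable_const hSr
      (f := fun _ => (1 : ℝ≥0∞)))
  have hmul := lintegral_mul_eq_lintegral_mul_lintegral_of_indepFun (hH.comp hY)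
    ((measurable_const.indicator hS (f := fun _ => (1 : ℝ≥0∞)))) hi
  rw [lintegral_indicator hS, setLIntegral_one] at hmul
  rw [mul_comm]
  refine Eq.trans ?_ hmul
  rw [← lintegral_indicator hS]
  refine lintegral_congr_ae ?_
  filter_upwards [hX.ae_eq_pathPos h2 hΔ hΔ' s k] with ω hω
  by_cases h : ω ∈ {ω | ∀ m ≤ k, r m ω = s m}
  · simp [Set.indicator_of_mem h, hω h]
  · simp [Set.indicator_of_notMem h]

lemma IsMarkovChain.measure_path_succ (hΓ : IsGenerator Γ) (hΔ : 0 < Δ)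
    (hr : IsMarkovChain P (stepMatrix Γ Δ) i₀ r) (s : ℕ → Fin N) (k : ℕ) :
    P {ω | ∀ m ≤ k + 1, r m ω = s m} =
      P {ω | ∀ m ≤ k, r m ω = s m} * ENNReal.ofReal (stepMatrix Γ Δ (s k) (s (k + 1))) := by
  rw [hr.law, hr.law]
  split_ifs
  · rw [Finset.prod_range_succ, ENNReal.ofReal_mul]
    exact Finset.prod_nonneg fun m _ => stepMatrix_nonneg hΓ hΔ.le _ _
  · simp

lemma bemStep_apply_prod_singleton (h1 : PolynomialLipschitz f g a q)
    (h2 : KhasminskiiMonotone f g ν l₁) (hΔ : 0 < Δ) (hΔ' : Δ < 1 / (maxAbs ν + 2))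
    (z : Vec n × Fin N) {A : Set (Vec n)} (hA : MeasurableSet A) (j : Fin N) :
    bemStep f g Γ Δ z (A ×ˢ {j}) = ENNReal.ofReal (stepMatrix Γ Δ z.2 j) *
      stdGaussian (Vec d) {ξ | nextPos f g Δ j z ξ ∈ A} := by
  have hm' : ∀ j, Measurable fun ξ => (nextPos f g Δ j z ξ, j) := fun j =>
    (measurable_nextPos_right h1 h2 hΔ hΔ' j z).prodMk measurable_const
  have hAj : MeasurableSet (A ×ˢ ({j} : Set (Fin N))) := hA.prod (measurableSet_singleton j)
  rw [bemStep, Measure.finsetSum_apply, Finset.sum_eq_single j]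
  · rw [Measure.smul_apply, smul_eq_mul]
    congr 1
    refine (Measure.map_apply (hm' j) hAj).trans (congrArg _ ?_)
    ext ξ
    simp
  · intro j' _ hj'
    rw [Measure.smul_apply, smul_eq_mul]
    refine mul_eq_zero_of_right _ ((Measure.map_apply (hm' j') hAj).trans ?_)
    convert measure_empty (μ := stdGaussian (Vec d))
    ext ξ
    simp [hj']
  · simp

/-- Switching paths up to time k partition the space. The value `j` given to later times has no
effect here; it lets the path be continued by a prescribed next state. -/
lemma lintegral_eq_sum_path (hr : ∀ k, Measurable (r k)) (k : ℕ) (j : Fin N) (F : Ω → ℝ≥0∞) :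
    ∫⁻ ω, F ω ∂P = ∑ t : Fin (k + 1) → Fin N, ∫⁻ ω in {ω | ∀ m ≤ k, r m ω =
      if h : m < k + 1 then t ⟨m, h⟩ else j}, F ω ∂P := by
  let R : Ω → Fin (k + 1) → Fin N := fun ω m => r m ω
  have hR : Measurable R := measurable_pi_lambda _ fun m => hr m
  have hset : ∀ t : Fin (k + 1) → Fin N,
      {ω | ∀ m ≤ k, r m ω = if h : m < k + 1 then t ⟨m, h⟩ else j} = R ⁻¹' {t} := fun t => by
    ext ω
    simp only [Set.mem_ofPred_eq, Set.mem_preimage, Set.mem_singleton_iff, R, funext_iff]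
    constructor
    · intro h m
      simpa [m.2] using h m (Nat.lt_succ_iff.1 m.2)
    · intro h m hm
      simpa [Nat.lt_succ_iff.2 hm] using h ⟨m, Nat.lt_succ_iff.2 hm⟩
  simp_rw [hset]
  rw [← tsum_fintype (L := .unconditional _), ← lintegral_iUnion (fun t => hR (measurableSet_singleton t))]
  · rw [show ⋃ t, R ⁻¹' {t} = Set.univ by ext ω; simp, Measure.restrict_univ]
  · intro t t' htt'
    exact Disjoint.preimage R (Set.disjoint_singleton.2 htt')

/-- Proved path by path: the chain contributes one more transition probability and the position one
fresh Gaussian increment. The sum over paths gives the one-step kernel. -/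
lemma IsBEMSolution.map_succ [IsProbabilityMeasure P] (hX : IsBEMSolution P f g Γ Δ x₀ i₀ B X r) (hΓ : IsGenerator Γ)
    (h1 : PolynomialLipschitz f g a q)
    (h2 : KhasminskiiMonotone f g ν l₁) (hΔ : 0 < Δ) (hΔ' : Δ < 1 / (maxAbs ν + 2)) (k : ℕ) :
    P.map (fun ω => (X (k + 1) ω, r (k + 1) ω)) =
      (P.map fun ω => (X k ω, r k ω)).bind (bemStep f g Γ Δ) := by
  have hm : ∀ k, Measurable fun ω => (X k ω, r k ω) := fun k =>
    (hX.measurable k).prodMk (hX.chain.measurable k)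
  have := Measure.isProbabilityMeasure_map (μ := P) (hm (k + 1)).aemeasurable
  have hstep := measurable_bemStep hΓ h1 h2 hΔ hΔ'
  refine measure_ext_of_prod_singleton fun A j hA => ?_
  have hAj : MeasurableSet (A ×ˢ ({j} : Set (Fin N))) := hA.prod (measurableSet_singleton j)
  rw [Measure.map_apply (hm _) hAj, Measure.bind_apply hAj hstep.aemeasurable,
    lintegral_map (f := fun z => bemStep f g Γ Δ z (A ×ˢ {j}))
      ((Measure.measurable_coe hAj).comp hstep) (hm k),
    ← lintegral_indicator_one (hm (k + 1) hAj),
    lintegral_eq_sum_path hX.chain.measurable k j,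
    lintegral_eq_sum_path (P := P) hX.chain.measurable k j]
  refine Finset.sum_congr rfl fun t _ => ?_
  set s : ℕ → Fin N := fun m => if h : m < k + 1 then t ⟨m, h⟩ else j with hs
  have hsj : s (k + 1) = j := by simp [hs]
  have hS := hX.chain.measurableSet_path s k
  have hS' := hX.chain.measurableSet_path s (k + 1)
  have hleft : ∫⁻ ω in {ω | ∀ m ≤ k, r m ω = s m},
      ((fun ω => (X (k + 1) ω, r (k + 1) ω)) ⁻¹' A ×ˢ {j}).indicator 1 ω ∂P =
      ∫⁻ ω in {ω | ∀ m ≤ k + 1, r m ω = s m}, A.indicator 1 (X (k + 1) ω) ∂P := by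
    rw [← lintegral_indicator hS, ← lintegral_indicator hS']
    refine lintegral_congr fun ω => ?_
    have hiff : (∀ m ≤ k + 1, r m ω = s m) ↔ (∀ m ≤ k, r m ω = s m) ∧ r (k + 1) ω = j := by
      rw [← hsj]
      simp only [Nat.le_succ_iff_eq_or_le, or_imp, forall_and, forall_eq]
      tauto
    by_cases hk : ∀ m ≤ k, r m ω = s m
    · by_cases hj : r (k + 1) ω = j <;> by_cases hxA : X (k + 1) ω ∈ A <;>
        simp [Set.indicator, hiff, hj, hxA]
    · simp [Set.indicator, hiff, hk]
  have hmeas : Measurable fun x => bemStep f g Γ Δ (x, s k) (A ×ˢ {j}) :=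
    ((Measure.measurable_coe hAj).comp hstep).comp (measurable_id.prodMk measurable_const)
  have hright : ∫⁻ ω in {ω | ∀ m ≤ k, r m ω = s m}, bemStep f g Γ Δ (X k ω, r k ω) (A ×ˢ {j}) ∂P =
      ∫⁻ ω in {ω | ∀ m ≤ k, r m ω = s m}, bemStep f g Γ Δ (X k ω, s k) (A ×ˢ {j}) ∂P :=
    setLIntegral_congr_fun hS fun ω hω => by simp only [hω k le_rfl]
  refine hleft.trans (Eq.trans ?_ hright.symm)
  rw [hX.setLIntegral_path h1 h2 hΔ hΔ' s (k + 1) (measurable_one.indicator hA),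
    hX.setLIntegral_path h1 h2 hΔ hΔ' s k hmeas, hX.chain.measure_path_succ hΓ hΔ, mul_assoc]
  congr 1
  have hpos : ∫⁻ ω, A.indicator 1 (pathPos f g Δ x₀ s (fun m => noise B Δ m ω) (k + 1)) ∂P =
      P {ω | pathPos f g Δ x₀ s (fun m => noise B Δ m ω) (k + 1) ∈ A} :=
    lintegral_indicator_one
      (hX.brownian.measurable_pathPos_noise (x₀ := x₀) h1 h2 hΔ hΔ' s (k + 1) hA)
  rw [hpos, hX.brownian.measure_pathPos_succ h1 h2 hΔ hΔ' s k hA, ← lintegral_const_mul', hsj]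
  · exact lintegral_congr fun ω => (bemStep_apply_prod_singleton (Γ := Γ) h1 h2 hΔ hΔ'
      (pathPos f g Δ x₀ s (fun m => noise B Δ m ω) k, s k) hA j).symm
  · exact ENNReal.ofReal_ne_top

lemma IsBEMSolution.map_eq_bemKernel [IsProbabilityMeasure P] (hX : IsBEMSolution P f g Γ Δ x₀ i₀ B X r)
    (hΓ : IsGenerator Γ) (h1 : PolynomialLipschitz f g a q)
    (h2 : KhasminskiiMonotone f g ν l₁) (hΔ : 0 < Δ) (hΔ' : Δ < 1 / (maxAbs ν + 2)) (k : ℕ) :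
    P.map (fun ω => (X k ω, r k ω)) = bemKernel f g Γ Δ k (x₀, i₀) := by
  induction k with
  | zero =>
    have hr : ∀ᵐ ω ∂P, r 0 ω = i₀ := by
      have h := hX.chain.law 0 fun _ => i₀
      simp only [nonpos_iff_eq_zero, forall_eq, if_true, Finset.range_zero, Finset.prod_empty,
        ENNReal.ofReal_one] at h
      exact (prob_compl_eq_zero_iff (hX.chain.measurable 0 (measurableSet_singleton i₀))).2 h
    have he : (fun ω => (X 0 ω, r 0 ω)) =ᵐ[P] fun _ => (x₀, i₀) := by
      filter_upwards [hX.initial, hr] with ω hω hω'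
      rw [hω, hω']
    rw [Measure.map_congr he, Measure.map_const, measure_univ, one_smul]
    rfl
  | succ k ih => rw [hX.map_succ hΓ h1 h2 hΔ hΔ', ih, bemKernel]

end Law

end HybridBEM

end

/-! ### Assembly of the theorem. -/

open HybridBEM

theorem theorem3p1 {n d N : ℕ}
    (f : HybridBEM.Vec n → Fin N → HybridBEM.Vec n)
    (g : HybridBEM.Vec n → Fin N → Matrix (Fin n) (Fin d) ℝ)
    (Γ : Matrix (Fin N) (Fin N) ℝ) (μ : Fin N → ℝ)
    (a : Fin N → ℝ) (q : ℝ) (ν : Fin N → ℝ) (l₁ : ℝ)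
    (hΓ : HybridBEM.IsGenerator Γ) (hirr : HybridBEM.IsIrreducibleGenerator Γ)
    (hμ : HybridBEM.IsStationaryDistribution Γ μ)
    (h1 : HybridBEM.PolynomialLipschitz f g a q)
    (h2 : HybridBEM.KhasminskiiMonotone f g ν l₁)
    (h3 : HybridBEM.AveragedStable μ ν) :
    ∃ p₀ : ℝ, 0 < p₀ ∧ p₀ ≤ 1 ∧
      ∀ Δ : ℝ, 0 < Δ → Δ < 1 / (HybridBEM.maxAbs ν + 2) →
        -- the implicit equation of the scheme is uniquely solvable
        (∀ (i : Fin N) (y : HybridBEM.Vec n), ∃! u, u - Δ • f u i = y) ∧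
        -- the law of `(X_k, r_k)` is `𝐏^Δ_k((x₀, i₀), ·)`
        (∀ (Ω : Type*) [MeasurableSpace Ω] (P : Measure Ω) [IsProbabilityMeasure P]
          (x₀ : HybridBEM.Vec n) (i₀ : Fin N) (B : Fin d → ℝ≥0 → Ω → ℝ)
          (X : ℕ → Ω → HybridBEM.Vec n) (r : ℕ → Ω → Fin N),
          HybridBEM.IsBEMSolution P f g Γ Δ x₀ i₀ B X r →
          ∀ k, P.map (fun ω => (X k ω, r k ω)) = HybridBEM.bemKernel f g Γ Δ k (x₀, i₀)) ∧
        -- existence and uniqueness of the invariant measure, and exponential convergence to it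
        ∃ π : Measure (HybridBEM.Vec n × Fin N),
          HybridBEM.IsInvariantMeasure (HybridBEM.bemKernel f g Γ Δ) π ∧
          (∀ π' : Measure (HybridBEM.Vec n × Fin N),
            HybridBEM.IsInvariantMeasure (HybridBEM.bemKernel f g Γ Δ) π' → π' = π) ∧
          ∀ p : ℝ, 0 < p → p < p₀ → ∃ γ : ℝ, 0 < γ ∧
            ∀ (x₀ : HybridBEM.Vec n) (i₀ : Fin N), ∃ C : ℝ, 0 < C ∧ ∀ k : ℕ,
              HybridBEM.wasserstein p (HybridBEM.bemKernel f g Γ Δ k (x₀, i₀)) π ≤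
                ENNReal.ofReal (C * Real.exp (-(γ * (k * Δ)))) := by
  obtain ⟨lam, hlam, hsum⟩ := h3.2
  obtain ⟨s₀, hs₀, hw⟩ := exists_weight hΓ hirr hμ
    (c := fun j => ν j / (1 - ν j / (maxAbs ν + 2))) (by rw [hsum]; linarith)
  have hN : Nonempty (Fin N) := by
    by_contra hne
    have := not_nonempty_iff.1 hne
    simpa using hμ.2.1
  have l : Fin N := hN.some
  -- The weight is taken at s = p/2, whence the bound 2s₀; the bound 1 on p is needed for
  -- subadditivity of t ↦ t^p.
  have hweight : ∀ Δ : ℝ, 0 < Δ → Δ < 1 / (maxAbs ν + 2) → ∀ p : ℝ, 0 < p → p ≤ min 1 (2 * s₀) →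
      ∃ h η, IsWeight Γ ν Δ p η h := by
    intro Δ hΔ hΔ' p hp hp'
    have hps : p / 2 ≤ s₀ := by linarith [hp'.trans (min_le_right _ _)]
    obtain ⟨h, η, hη, hη1, hb, hc⟩ := hw Δ hΔ (step_lt_one hΔ').le (p / 2) (half_pos hp) hps
    exact ⟨h, η, hη, hη1, hb, hc⟩
  have hp₀ : 0 < min 1 (2 * s₀) := lt_min one_pos (by linarith)
  refine ⟨min 1 (2 * s₀), hp₀, min_le_left _ _, fun Δ hΔ hΔ' => ⟨fun i y => ?_, ?_, ?_⟩⟩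
  · obtain ⟨u, hu⟩ := surjective_sub_smul h1 h2 hΔ hΔ' i y
    exact ⟨u, hu, fun v hv => injective_sub_smul h2 hΔ hΔ' i (hv.trans hu.symm)⟩
  · intro Ω _ P _ x₀ i₀ B X r hX k
    exact hX.map_eq_bemKernel hΓ h1 h2 hΔ hΔ' k
  · obtain ⟨h, η, hh⟩ := hweight Δ hΔ hΔ' _ hp₀ le_rfl
    obtain ⟨π, ⟨hπ, hinv⟩, huniq⟩ :=
      exists_unique_invariant hh hΓ hirr h1 h2 hΔ hΔ' hp₀ (min_le_left _ _) l
    refine ⟨π, (isInvariantMeasure_iff hΓ h1 h2 hΔ hΔ' π).2 ⟨hπ, hinv⟩, fun π' hπ' => ?_,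
      fun p hp hpp₀ => ?_⟩
    · obtain ⟨hπ'p, hπ'i⟩ := (isInvariantMeasure_iff hΓ h1 h2 hΔ hΔ' π').1 hπ'
      exact huniq π' hπ'p hπ'i
    -- π was built with the exponent p₀. Each smaller p brings its own weight and rate but keeps the
    -- same π, as the Wasserstein bound needs only invariance. The rate γ is chosen so that exp(-γΔ)
    -- is the contraction factor.
    · obtain ⟨h, η, hh⟩ := hweight Δ hΔ hΔ' p hp hpp₀.le
      have hρ := costRate_pos (η := η) hΓ hΔ l
      have hρ1 := costRate_lt_one hΓ hirr hΔ hh.pos l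
      refine ⟨-Real.log (costRate Γ Δ η l) / Δ,
        div_pos (neg_pos.2 (Real.log_neg hρ hρ1)) hΔ, fun x₀ i₀ => ?_⟩
      obtain ⟨C, hC, hW⟩ := exists_wasserstein_le hh hΓ hirr h1 h2 hΔ hΔ' hp
        (hpp₀.le.trans (min_le_left _ _)) l hinv (x₀, i₀)
      refine ⟨C, hC, fun k => (hW k).trans_eq ?_⟩
      have he : -(-Real.log (costRate Γ Δ η l) / Δ * (k * Δ)) =
          k * Real.log (costRate Γ Δ η l) := by
        field_simp
      rw [he, Real.exp_nat_mul, Real.exp_log hρ]
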